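/- Setting. Fix $T>0$, integers $n,d\ge 0$, and a measurable function $\hat\phi:(0,\infty)\to\mathbb R$. For $V=\mathbb R^k$ or $V=\mathbb R^{k,l}$ let $\mathcal L_1(V)$ be the Banach space of (classes of) measurable $g:(0,\infty)\to V$ with $\int_0^\infty|\hat\phi(\xi)|(1+\xi)\|g(\xi)\|_V\,d\xi<\infty$. For $T\ge t\ge u\ge s\ge 0$ set $$(\tilde\delta A)_{ts}(\xi)=A_t(\xi)-e^{-\xi(t-s)}A_s(\xi),\qquad (\tilde\delta B)_{tus}(\xi)=B_{ts}(\xi)-B_{tu}(\xi)-e^{-\xi(t-u)}B_{us}(\xi).$$ Let $\tilde{\mathcal C}_2^\mu(V)$ be the space of continuous maps $B$ from $\{T\ge t\ge s\ge0\}$ to $\mathcal L_1(V)$ with $\sup_{s<t}\|B_{ts}\|_{\mathcal L_1}/|t-s|^{\mu}<\infty$. Let $\tilde{\mathcal C}_3^\mu(V)$ be the space of continuous maps $h$ from $\{T\ge t\ge u\ge s\ge0\}$ to $\mathcal L_1(V)$ that can be written $h=\sum_i h_i$ with $h_i$ continuous, $0<\rho_i<\mu$, and $\sum_i\sup_{s<u<t}\|(h_i)_{tus}\|_{\mathcal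 L_1}/(|t-u|^{\rho_i}|u-s|^{\mu-\rho_i})<\infty$. The spaces $\mathcal C_1^\kappa$ of Hölder paths on $[0,T]$ and $\mathcal C_2^{\mu}$ of two-parameter functions on $\{T\ge t\ge s\ge 0\}$ with values in a finite-dimensional space are defined in the usual way. For $\mu>1$ and given $h$ there is at most one $M\in\tilde{\mathcal C}_2^\mu$ with $\tilde\delta M=h$; when it exists it is denoted $\tilde\Lambda h$. For matrices, $A\cdot B=\mathrm{Tr}(AB^*)$, and $(\delta f)_{ts}=f_t-f_s$. Driver. Let $\gamma\in(1/3,1/2)$. A convolutional rough path is a triple $\tilde x^1\in\tilde{\mathcal C}_2^{\gamma}(\mathbb R^{1,n})$, $\tilde x^2\in\tilde{\mathcal C}_2^{2\gamma}(\mathbb R^{n,n})$, $\tilde x^3\in\tilde{\mathcal C}_3^{3\gamma}(\mathbb R^{n,n})$ with $$\tilde\delta\tilde x^1=0,\qquad(\tilde\delta\tilde x^2)_{tus}=\tilde x^1_{tu}\otimes x^1_{us}+\tilde x^3_{tus},\qquad\text{where } x^1_{ts}=\int_0^\infty\hat\phi(\xi)\,\tilde x^1_{ts}(\xi)\,d\xi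 .$$ Controlled paths and integral. Let $1/3<\kappa<\gamma$. An element of $\tilde{\mathcal Q}_0^\kappa([0,T];\mathbb R^d)$ is a pair $(\tilde y,\zeta)$, where $\tilde y:[0,T]\to\mathcal L_1(\mathbb R^d)$ is continuous with $\tilde y_0=0$, $\zeta\in\mathcal C_1^\kappa([0,T];\mathbb R^{n,d})$, and $(\tilde\delta\tilde y)_{ts}-(\tilde x^1_{ts}\zeta_s)^*$ belongs to $\tilde{\mathcal C}_2^{2\kappa}(\mathbb R^d)$. Similarly, a path $z$ in $\mathbb R^n$ is controlled by $x^1$ with derivative $\zeta^z\in\mathcal C_1^\kappa([0,T];\mathbb R^{n,n})$ if $(\delta z)_{ts}=(x^1_{ts}\zeta^z_s)^*+r_{ts}$ with $r\in\mathcal C_2^{2\kappa}$; its integral is then $$\mathcal J(\tilde dx\,z)=\tilde x^1z+\tilde x^2\cdot(\zeta^z)^*+\tilde\Lambda\big(\tilde x^1r+\tilde x^2\cdot(\delta\zeta^z)^*-\tilde x^3\cdot(\zeta^z)^*\big),$$ with $\tilde\Lambda$ taken in $\tilde{\mathcal C}_2^{\gamma+2\kappa}$; here the argument of $\tilde\Lambda$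 at $(t,u,s)$ is $\tilde x^1_{tu}r_{us}+\tilde x^2_{tu}\cdot(\zeta^z_u-\zeta^z_s)^*-\tilde x^3_{tus}\cdot(\zeta^z_s)^*$. It is applied column by column to matrix-valued $z$, and $\mathcal J(\tilde dx\,z)$ has derivative $z$ as a controlled increment. Theorem. Let $\sigma:\mathbb R^d\to\mathbb R^{n,d}$ be of class $\mathcal C^3$, bounded together with its derivatives up to order $3$, and let $a\in\mathbb R^d$. Then the Volterra equation $$\tilde y_0=0,\qquad\tilde\delta\tilde y=\mathcal J(\tilde dx\,\sigma(y)),\qquad y_t=a+\int_0^\infty\hat\phi(\xi)\,\tilde y_t(\xi)\,d\xi,$$ has exactly one solution $(\tilde y,\zeta)\in\tilde{\mathcal Q}_0^\kappa([0,T];\mathbb R^d)$. Here the equation is understood between controlled paths, that is, the derivative is $\zeta=\sigma(y)$, and the $i$-th column $\sigma^{(i)}(y)$ of $\sigma(y)$ is a path controlled by $x^1$ with derivative $\zeta\,(D\sigma^{(i)}(y))^*$. -/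

import Mathlib

open MeasureTheory Set
open scoped NNReal

namespace RoughVolterra

noncomputable section

/-! ### The space of functions of the Laplace variable -/

/-- The measure `|φ̂(ξ)| (1 + ξ) dξ` on `(0, ∞)`. -/
def laplaceMeasure (φhat : ℝ → ℝ) : Measure ℝ :=
  (volume.restrict (Ioi 0)).withDensity fun ξ => ENNReal.ofReal (|φhat ξ| * (1 + ξ))

/-- The space `𝓛₁(ℝ)`, with norm `∫₀^∞ |φ̂(ξ)| (1 + ξ) |g(ξ)| dξ`. The spaces `𝓛₁(ℝᵏ)` and
`𝓛₁(ℝ^{k,l})` are represented by vectors and matrices with entries in this space (all norms on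
`ℝᵏ` and `ℝ^{k,l}` being equivalent). -/
abbrev LaplaceSpace (φhat : ℝ → ℝ) : Type :=
  Lp ℝ 1 (laplaceMeasure φhat)

theorem laplaceMeasure_nonneg (φhat : ℝ → ℝ) : ∀ᵐ ξ ∂(laplaceMeasure φhat), 0 ≤ ξ := by
  refine (withDensity_absolutelyContinuous _ _).ae_le ?_
  filter_upwards [ae_restrict_mem measurableSet_Ioi] with ξ hξ
  exact le_of_lt hξ

theorem memLp_decay (φhat : ℝ → ℝ) (r : ℝ≥0) (g : LaplaceSpace φhat) :
    MemLp (fun ξ => Real.exp (-(ξ * r)) * g ξ) 1 (laplaceMeasure φhat) := by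
  refine (Lp.memLp g).mono ?_ ?_
  · exact (by fun_prop : Continuous fun ξ : ℝ => Real.exp (-(ξ * r))).aestronglyMeasurable.mul
      (Lp.aestronglyMeasurable g)
  · filter_upwards [laplaceMeasure_nonneg φhat] with ξ hξ
    rw [norm_mul, Real.norm_eq_abs, abs_of_pos (Real.exp_pos _)]
    refine mul_le_of_le_one_left (norm_nonneg _) (Real.exp_le_one_iff.2 ?_)
    have : 0 ≤ ξ * (r : ℝ) := mul_nonneg hξ r.2
    linarith

/-- Multiplication of `g ∈ 𝓛₁` by the function `ξ ↦ e^{-ξ r}`, where `r ≥ 0`. -/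
def decay (φhat : ℝ → ℝ) (r : ℝ≥0) (g : LaplaceSpace φhat) : LaplaceSpace φhat :=
  (memLp_decay φhat r g).toLp

/-- The number `∫₀^∞ φ̂(ξ) g(ξ) dξ`. -/
def laplaceIntegral (φhat : ℝ → ℝ) (g : LaplaceSpace φhat) : ℝ :=
  ∫ ξ in Ioi 0, φhat ξ * g ξ

/-! ### Twisted increments and Hölder spaces -/

/-- The simplex `{(t, s) : T ≥ t ≥ s ≥ 0}`. -/
def simplexTwo (T : ℝ) : Set (ℝ × ℝ) :=
  {p | 0 ≤ p.2 ∧ p.2 ≤ p.1 ∧ p.1 ≤ T}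

/-- The simplex `{(t, u, s) : T ≥ t ≥ u ≥ s ≥ 0}`. -/
def simplexThree (T : ℝ) : Set (ℝ × ℝ × ℝ) :=
  {p | 0 ≤ p.2.2 ∧ p.2.2 ≤ p.2.1 ∧ p.2.1 ≤ p.1 ∧ p.1 ≤ T}

/-- The twisted coboundary of a path, for `t ≥ s`:
`(δ̃A)_{ts}(ξ) = A_t(ξ) - A_s(ξ) - (e^{-ξ(t-s)} - 1) A_s(ξ) = A_t(ξ) - e^{-ξ(t-s)} A_s(ξ)`. -/
def twistedDeltaOne (φhat : ℝ → ℝ) (A : ℝ → LaplaceSpace φhat) (t s : ℝ) : LaplaceSpace φhat :=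
  (A t - A s) - (decay φhat (t - s).toNNReal (A s) - A s)

/-- The twisted coboundary of a function of two times, for `t ≥ u ≥ s`:
`(δ̃B)_{tus}(ξ) = B_{ts}(ξ) - B_{tu}(ξ) - B_{us}(ξ) - (e^{-ξ(t-u)} - 1) B_{us}(ξ)`. -/
def twistedDeltaTwo (φhat : ℝ → ℝ) (B : ℝ → ℝ → LaplaceSpace φhat) (t u s : ℝ) :
    LaplaceSpace φhat :=
  (B t s - B t u - B u s) - (decay φhat (t - u).toNNReal (B u s) - B u s)

/-- `f` is continuous and `κ`-Hölder on `[0, T]`. -/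
def HolderOne {E : Type*} [NormedAddCommGroup E] (T κ : ℝ) (f : ℝ → E) : Prop :=
  ContinuousOn f (Icc 0 T) ∧
    ∃ K : ℝ, ∀ s t : ℝ, 0 ≤ s → s < t → t ≤ T → ‖f t - f s‖ ≤ K * (t - s) ^ κ

/-- `f` is a continuous function of `T ≥ t ≥ s ≥ 0` with `sup_{s<t} ‖f_{ts}‖ / (t - s)^μ < ∞`. -/
def HolderTwo {E : Type*} [NormedAddCommGroup E] (T μ : ℝ) (f : ℝ → ℝ → E) : Prop :=
  ContinuousOn (fun p : ℝ × ℝ => f p.1 p.2) (simplexTwo T) ∧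
    ∃ K : ℝ, ∀ s t : ℝ, 0 ≤ s → s < t → t ≤ T → ‖f t s‖ ≤ K * (t - s) ^ μ

/-- `h` is a continuous function of `T ≥ t ≥ u ≥ s ≥ 0` which can be written as `h = ∑ᵢ hᵢ`, with
continuous `hᵢ`, exponents `0 < ρᵢ < μ` and
`∑ᵢ sup_{s<u<t} ‖(hᵢ)_{tus}‖ / (|t - u|^ρᵢ |u - s|^(μ-ρᵢ)) < ∞`. -/
def HolderThree {E : Type*} [NormedAddCommGroup E] (T μ : ℝ) (h : ℝ → ℝ → ℝ → E) : Prop :=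
  ContinuousOn (fun p : ℝ × ℝ × ℝ => h p.1 p.2.1 p.2.2) (simplexThree T) ∧
    ∃ (H : ℕ → ℝ → ℝ → ℝ → E) (ρ : ℕ → ℝ) (K : ℕ → ℝ),
      Summable K ∧
      (∀ i, 0 < ρ i ∧ ρ i < μ) ∧
      (∀ i, ContinuousOn (fun p : ℝ × ℝ × ℝ => H i p.1 p.2.1 p.2.2) (simplexThree T)) ∧
      (∀ i, ∀ s u t : ℝ, 0 ≤ s → s < u → u < t → t ≤ T →
        ‖H i t u s‖ ≤ K i * ((t - u) ^ ρ i * (u - s) ^ (μ - ρ i))) ∧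
      ∀ s u t : ℝ, 0 ≤ s → s ≤ u → u ≤ t → t ≤ T → HasSum (fun i => H i t u s) (h t u s)

/-! ### The driving signal -/

/-- Convolutional rough path data of regularity `γ` on `[0, T]` above an `n`-dimensional signal
(regarded as a row vector): `x1 t s = x̃¹_{ts}`, `x2 t s = x̃²_{ts}` and `x3 t u s = x̃³_{tus}`, with
`δ̃x̃¹ = 0` and `(δ̃x̃²)_{tus} = x̃¹_{tu} ⊗ x¹_{us} + x̃³_{tus}`, where
`x¹_{us} = ∫₀^∞ φ̂(ξ) x̃¹_{us}(ξ) dξ`. -/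
structure ConvRoughPath (φhat : ℝ → ℝ) (T γ : ℝ) (n : ℕ) where
  x1 : ℝ → ℝ → Fin n → LaplaceSpace φhat
  x2 : ℝ → ℝ → Fin n → Fin n → LaplaceSpace φhat
  x3 : ℝ → ℝ → ℝ → Fin n → Fin n → LaplaceSpace φhat
  holder_x1 : HolderTwo T γ x1
  holder_x2 : HolderTwo T (2 * γ) x2
  holder_x3 : HolderThree T (3 * γ) x3
  delta_x1 : ∀ s u t : ℝ, 0 ≤ s → s ≤ u → u ≤ t → t ≤ T → ∀ j,
    twistedDeltaTwo φhat (fun t s => x1 t s j) t u s = 0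
  delta_x2 : ∀ s u t : ℝ, 0 ≤ s → s ≤ u → u ≤ t → t ≤ T → ∀ j l,
    twistedDeltaTwo φhat (fun t s => x2 t s j l) t u s =
      laplaceIntegral φhat (x1 u s l) • x1 t u j + x3 t u s j l

namespace ConvRoughPath

variable {φhat : ℝ → ℝ} {T γ : ℝ} {n d : ℕ}

/-- `x¹_{ts} = ∫₀^∞ φ̂(ξ) x̃¹_{ts}(ξ) dξ`. -/
def x1int (X : ConvRoughPath φhat T γ n) (t s : ℝ) (j : Fin n) : ℝ :=
  laplaceIntegral φhat (X.x1 t s j)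

/-! ### Controlled paths -/

/-- The remainder `r` in `(δz)_{ts} = (x¹_{ts} ζ_s)^* + r_{ts}`, for a path `z` with values in
`ℝᵐ` and a path `ζ` with values in `ℝ^{n,m}`. -/
def remainder (X : ConvRoughPath φhat T γ n) {m : ℕ} (z : ℝ → Fin m → ℝ)
    (ζ : ℝ → Fin n → Fin m → ℝ) (t s : ℝ) (k : Fin m) : ℝ :=
  z t k - z s k - ∑ l, X.x1int t s l * ζ s l k

/-- The remainder `r̃` in `(δ̃ỹ)_{ts} = (x̃¹_{ts} ζ_s)^* + r̃_{ts}`. -/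
def twistedRemainder (X : ConvRoughPath φhat T γ n) (ytil : ℝ → Fin d → LaplaceSpace φhat)
    (ζ : ℝ → Fin n → Fin d → ℝ) (t s : ℝ) (k : Fin d) : LaplaceSpace φhat :=
  twistedDeltaOne φhat (fun v => ytil v k) t s - ∑ j, ζ s j k • X.x1 t s j

/-- `z`, with derivative `ζ`, is a convolutional path controlled by `x¹`:
`(z, ζ)` is an element of `𝓠^κ([0, T]; ℝᵐ)`. -/
structure IsControlled (X : ConvRoughPath φhat T γ n) (κ : ℝ) {m : ℕ} (z : ℝ → Fin m → ℝ)
    (ζ : ℝ → Fin n → Fin m → ℝ) : Prop where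
  continuousOn : ContinuousOn z (Icc 0 T)
  holder_deriv : HolderOne T κ ζ
  holder_remainder : HolderTwo T (2 * κ) (X.remainder z ζ)

/-- `ỹ`, with derivative `ζ`, is a path controlled by `x̃¹`:
`(ỹ, ζ)` is an element of `𝓠̃^κ([0, T]; ℝᵈ)`. -/
structure IsTwistedControlled (X : ConvRoughPath φhat T γ n) (κ : ℝ)
    (ytil : ℝ → Fin d → LaplaceSpace φhat) (ζ : ℝ → Fin n → Fin d → ℝ) : Prop where
  continuousOn : ContinuousOn ytil (Icc 0 T)
  holder_deriv : HolderOne T κ ζ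
  holder_remainder : HolderTwo T (2 * κ) (X.twistedRemainder ytil ζ)

end ConvRoughPath

/-! ### The rough convolution integral -/

/-- `M` is the convolutional sewing `Λ̃h` of `h`, that is, the element of `𝓒̃₂^μ` with `δ̃M = h`
(there is at most one for `μ > 1`). -/
structure IsConvSewing (φhat : ℝ → ℝ) (T μ : ℝ) (h : ℝ → ℝ → ℝ → LaplaceSpace φhat)
    (M : ℝ → ℝ → LaplaceSpace φhat) : Prop where
  holder : HolderTwo T μ M
  delta_eq : ∀ s u t : ℝ, 0 ≤ s → s ≤ u → u ≤ t → t ≤ T → twistedDeltaTwo φhat M t u s = h t u s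

namespace ConvRoughPath

variable {φhat : ℝ → ℝ} {T γ : ℝ} {n d : ℕ}

/-- `x̃¹_{ts} z_s + x̃²_{ts} · ζ_s^*`, where `A · B = Tr(A B^*)`. -/
def germ (X : ConvRoughPath φhat T γ n) (z : ℝ → Fin n → ℝ) (ζ : ℝ → Fin n → Fin n → ℝ)
    (t s : ℝ) : LaplaceSpace φhat :=
  ∑ j, z s j • X.x1 t s j + ∑ j, ∑ l, ζ s l j • X.x2 t s j l

/-- `x̃¹_{tu} r_{us} + x̃²_{tu} · (δζ)_{us}^* - x̃³_{tus} · ζ_s^*`. -/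
def defect (X : ConvRoughPath φhat T γ n) (z : ℝ → Fin n → ℝ) (ζ : ℝ → Fin n → Fin n → ℝ)
    (t u s : ℝ) : LaplaceSpace φhat :=
  ∑ j, X.remainder z ζ u s j • X.x1 t u j
    + ∑ j, ∑ l, (ζ u l j - ζ s l j) • X.x2 t u j l
    - ∑ j, ∑ l, ζ s l j • X.x3 t u s j l

/-- `J = 𝓙(d̃x z)` for the controlled path `z ∈ 𝓠^κ([0, T]; ℝⁿ)` with derivative `ζ`:
`J = x̃¹ z + x̃² · ζ^* + Λ̃(x̃¹ r + x̃² · (δζ)^* - x̃³ · ζ^*)`. -/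
structure IsIntegral (X : ConvRoughPath φhat T γ n) (κ : ℝ) (z : ℝ → Fin n → ℝ)
    (ζ : ℝ → Fin n → Fin n → ℝ) (J : ℝ → ℝ → LaplaceSpace φhat) : Prop where
  controlled : X.IsControlled κ z ζ
  eq_germ_add_sewing : ∃ M : ℝ → ℝ → LaplaceSpace φhat,
    IsConvSewing φhat T (γ + 2 * κ) (X.defect z ζ) M ∧
      ∀ s t : ℝ, 0 ≤ s → s ≤ t → t ≤ T → J t s = X.germ z ζ t s + M t s

end ConvRoughPath

/-! ### The Volterra equation -/

/-- `f` is three times continuously differentiable, and is bounded together with its derivatives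
up to order three. -/
def IsCThreeBounded {d : ℕ} (f : (Fin d → ℝ) → ℝ) : Prop :=
  ContDiff ℝ 3 f ∧ ∀ m : ℕ, m ≤ 3 → ∃ C : ℝ, ∀ v, ‖iteratedFDeriv ℝ m f v‖ ≤ C

/-- The path `y = a + ∫₀^∞ φ̂(ξ) ỹ(ξ) dξ`. -/
def pathOf (φhat : ℝ → ℝ) {d : ℕ} (a : Fin d → ℝ) (ytil : ℝ → Fin d → LaplaceSpace φhat)
    (t : ℝ) (k : Fin d) : ℝ :=
  a k + laplaceIntegral φhat (ytil t k)

/-- The controlled path `(ỹ, ζ) ∈ 𝓠̃^κ([0, T]; ℝᵈ)` solves `ỹ₀ = 0`, `δ̃ỹ = 𝓙(d̃x σ(y))`,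
`y = a + ∫₀^∞ φ̂(ξ) ỹ(ξ) dξ`. The equation is an equality of controlled paths: the derivative of the
left-hand side is `ζ`, and that of `𝓙(d̃x z)` is `z`, so that `ζ = σ(y)`. The `i`-th column of
`σ(y)` is a path in `ℝⁿ`, controlled by `x¹` with derivative `ζ (Dσ^{(i)}(y))^*`, whose `(j, l)`
entry is `∑ₖ ζ_{jk} ∂ₖσ_{li}(y)`. -/
structure IsVolterraSolution {φhat : ℝ → ℝ} {T γ : ℝ} {n d : ℕ} (X : ConvRoughPath φhat T γ n)
    (κ : ℝ) (σ : (Fin d → ℝ) → Matrix (Fin n) (Fin d) ℝ) (a : Fin d → ℝ)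
    (ytil : ℝ → Fin d → LaplaceSpace φhat) (ζ : ℝ → Fin n → Fin d → ℝ) : Prop where
  controlled : X.IsTwistedControlled κ ytil ζ
  initial : ytil 0 = 0
  deriv_eq : ∀ t ∈ Icc 0 T, ∀ j k, ζ t j k = σ (pathOf φhat a ytil t) j k
  equation : ∀ i : Fin d,
    X.IsIntegral κ
      (fun t j => σ (pathOf φhat a ytil t) j i)
      (fun t j l => fderiv ℝ (fun v => σ v l i) (pathOf φhat a ytil t) (ζ t j))
      (fun t s => twistedDeltaOne φhat (fun v => ytil v i) t s)

end

end RoughVolterra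

namespace RoughVolterra

section AlmostFlow

open Filter Topology

/-! ### Almost flows -/

/-! The theorem is a nonlinear sewing argument on the state space `E = Fin d → LaplaceSpace φhat`.
Write S_r for multiplication by e^{-ξr}, I for integration against φ̂, f for σ transposed and F for
the array Dσ·σ, and consider the second-order step m_{ts}(e) = S_{t-s}e + x̃¹_{ts} f(a+Ie) +
x̃²_{ts}·F(a+Ie).

Reduction. Since δ̃δ̃ = 0 and δ̃ of the germ is minus the defect (`twistedDeltaTwo_germ`), the
difference M of δ̃ỹ and the germ automatically satisfies δ̃M = defect. Hence a continuous ỹ with ỹ_0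
= 0 and ζ = σ(y) solves the equation exactly when ‖ỹ_t - m_{ts}ỹ_s‖ = O((t-s)^α) with α = γ+2κ > 1
(`IsVolterraSolution.flow_line`, `isVolterraSolution_of_flow_line`). No sewing map has to be
constructed.

Consistency. The default m_{tu}∘m_{us} - m_{ts} consists of x̃¹ applied to a Taylor remainder of σ,
x̃² applied to an increment of F, and an x̃³ term (`comp_sub_eq`). The semigroup has no rate of
continuity in time on E, but inside σ only I(S_r e - e) occurs, and there the weight 1+ξ pays for
one factor ξ: the size is at most r‖e‖. So the default has order (t-s)^γ((t-s)+(t-s)^{2γ}), better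
than (t-s)^α because κ < γ < 1/2. Its Lipschitz constant in e has the same order; comparing two
Taylor remainders uses second differences of Dσ, which is where three derivatives are spent
(`IsRoughField.almostFlow`).

Sewing on grids. Defaults are summed by cutting a grid interval into two nearly equal pieces: x^b +
y^b ≤ θ(x+y)^b with θ < 1, and the gain 1-θ absorbs all errors on short intervals. This gives a
priori bounds for the scheme (`euler_global`) and a stability estimate for two sequences on a grid
(`stability`). Stability yields uniqueness, by sampling two solutions on finer and finer grids, and
existence, since the schemes of mesh h and h/2 differ by O(h^{α-b}) for any b strictly between 1 and
α. -/

theorem rpow_add_rpow_le_of_balanced {x y b : ℝ} (hx : 0 < x) (hy : 0 < y) (hb : 1 ≤ b)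
    (hxy : x ≤ 2 / 3 * (x + y)) (hyx : y ≤ 2 / 3 * (x + y)) :
    x ^ b + y ^ b ≤ (2 / 3 : ℝ) ^ (b - 1) * (x + y) ^ b := by
  -- Each piece keeps one factor w; the other b-1 powers are bounded by the common length, and the
  -- two factors w then add up to x+y.
  have key : ∀ w : ℝ, 0 < w → w ≤ 2 / 3 * (x + y) →
      w ^ b ≤ w * ((2 / 3 : ℝ) ^ (b - 1) * (x + y) ^ (b - 1)) := by
    intro w hw hwz
    rw [← Real.mul_rpow (by norm_num) (by positivity)]
    calc w ^ b = w * w ^ (b - 1) := by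
          rw [Real.rpow_sub_one hw.ne', mul_div_cancel₀ _ hw.ne']
      _ ≤ _ := by gcongr
  have hz : (x + y) ^ b = (x + y) * (x + y) ^ (b - 1) := by
    rw [Real.rpow_sub_one (by positivity), mul_div_cancel₀ _ (by positivity)]
  rw [hz]
  linarith [key x hx hxy, key y hy hyx]

/-- A family of maps `m t s : E → E` that is nearly a flow on `[0, T]`: the maps are nearly
nonexpansive, their second differences are controlled, and the default `m t u ∘ m u s - m t s` is of
order `(t - s) ^ α`, both in size and as a Lipschitz map. -/
structure AlmostFlow {E : Type*} [NormedAddCommGroup E] (T γ α C : ℝ) (m : ℝ → ℝ → E → E) :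
    Prop where
  const_nonneg : 0 ≤ C
  exponent_pos : 0 < γ
  one_lt_exponent : 1 < α
  second_difference : ∀ s t : ℝ, 0 ≤ s → s ≤ t → t ≤ T → ∀ p q p' q',
    ‖(m t s p - m t s q) - (m t s p' - m t s q')‖ ≤
      (1 + C * (t - s) ^ γ) * ‖(p - q) - (p' - q')‖
        + C * ‖p' - q'‖ * (‖p - p'‖ + ‖q - q'‖)
  comp_sub_le : ∀ s u t : ℝ, 0 ≤ s → s ≤ u → u ≤ t → t ≤ T → ∀ e,
    ‖m t u (m u s e) - m t s e‖ ≤ C * (1 + ‖e‖) * (t - s) ^ α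
  comp_sub_sub_le : ∀ s u t : ℝ, 0 ≤ s → s ≤ u → u ≤ t → t ≤ T → ∀ e e',
    ‖(m t u (m u s e) - m t s e) - (m t u (m u s e') - m t s e')‖ ≤
      C * (1 + ‖e'‖) * ‖e - e'‖ * (t - s) ^ α
  norm_le : ∀ s t : ℝ, 0 ≤ s → s ≤ t → t ≤ T → ∀ e, ‖m t s e‖ ≤ ‖e‖ + C * (t - s) ^ γ
  continuousOn : ∀ s : ℝ, 0 ≤ s → ∀ e, ContinuousOn (fun t => m t s e) (Icc s T)

/-- The scheme `e ↦ m (t + h) t e`, started from zero. -/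
def euler {E : Type*} [Zero E] (m : ℝ → ℝ → E → E) (h : ℝ) : ℕ → E
  | 0 => 0
  | k + 1 => m ((k + 1 : ℕ) * h) (k * h) (euler m h k)

/-- A discrete Gronwall inequality: a quantity that at most doubles over each window of length η
grows at most exponentially, uniformly in the mesh. -/
theorem le_two_pow_of_doubling {f : ℕ → ℝ} {h η T : ℝ} (hh : 0 < h) (hhη : h ≤ η)
    (hf : ∀ k, 0 ≤ f k)
    (H : ∀ j k : ℕ, j ≤ k → (k : ℝ) * h ≤ T → (k : ℝ) * h - j * h ≤ η → f k ≤ 2 * f j)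
    (m : ℕ) : ∀ k : ℕ, (k : ℝ) * h ≤ T → (k : ℝ) * h ≤ m * (η / 2) → f k ≤ 2 ^ m * f 0 := by
  induction m with
  | zero =>
    intro k _ hk
    have : k = 0 := by
      by_contra hne
      have : (0 : ℝ) < k := by exact_mod_cast Nat.pos_of_ne_zero hne
      have : 0 < (k : ℝ) * h := by positivity
      simp at hk
      linarith
    simp [this]
  | succ m ih =>
    intro k hkT hk
    have hη : 0 < η := hh.trans_le hhη
    -- The longest window that fits in η. As h ≤ η, it has at least one step and covers at least
    -- η/2, which explains the η/2 in the statement.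
    set q := ⌊η / h⌋₊ with hq
    have hq1 : (q : ℝ) * h ≤ η := by
      have := Nat.floor_le (div_nonneg hη.le hh.le)
      rwa [← hq, le_div_iff₀ hh] at this
    have hq2 : η / 2 ≤ (q : ℝ) * h := by
      have h1 : η / h < q + 1 := Nat.lt_floor_add_one _
      rw [div_lt_iff₀ hh] at h1
      have h2 : (1 : ℝ) ≤ q := by
        have : 1 ≤ q := Nat.le_floor (by rw [Nat.cast_one, one_le_div hh]; exact hhη)
        exact_mod_cast this
      nlinarith
    have hle : k - q ≤ k := Nat.sub_le _ _
    rcases le_total k q with hkq | hkq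
    · have h1 := H 0 k (Nat.zero_le _) hkT (by
        have : (k : ℝ) ≤ q := by exact_mod_cast hkq
        simp only [Nat.cast_zero]
        nlinarith)
      have h2 : (1 : ℝ) ≤ 2 ^ m := one_le_pow₀ (by norm_num)
      rw [pow_succ]
      nlinarith [hf 0]
    · have hc : ((k - q : ℕ) : ℝ) = k - q := Nat.cast_sub hkq
      have h1 := H (k - q) k hle hkT (by rw [hc]; linarith)
      have h2 := ih (k - q) (by rw [hc]; nlinarith [hkT, (Nat.cast_nonneg q : (0 : ℝ) ≤ q)]) (by
        rw [hc]; push_cast at hk; linarith)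
      rw [pow_succ]
      linarith

/-- Small time steps make `C η ^ γ` and `K η ^ α` negligible. -/
theorem exists_small_step {γ α : ℝ} (hγ : 0 < γ) (hα : 0 < α) (C K : ℝ) {ε : ℝ} (hε : 0 < ε) :
    ∃ η : ℝ, 0 < η ∧ η ≤ 1 ∧ C * η ^ γ + K * η ^ α ≤ ε := by
  have h1 : Tendsto (fun η : ℝ => C * η ^ γ + K * η ^ α) (𝓝[>] 0) (𝓝 0) := by
    have : ContinuousAt (fun η : ℝ => C * η ^ γ + K * η ^ α) 0 := by
      refine ContinuousAt.add ?_ ?_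
      · exact continuousAt_const.mul (Real.continuousAt_rpow_const _ _ (Or.inr hγ.le))
      · exact continuousAt_const.mul (Real.continuousAt_rpow_const _ _ (Or.inr hα.le))
    have h2 := this.tendsto
    rw [Real.zero_rpow hγ.ne', Real.zero_rpow hα.ne'] at h2
    simp only [mul_zero, add_zero] at h2
    exact h2.mono_left nhdsWithin_le_nhds
  have h2 : ∀ᶠ η : ℝ in 𝓝[>] 0, C * η ^ γ + K * η ^ α < ε := h1.eventually_lt_const hε
  have h3 : ∀ᶠ η : ℝ in 𝓝[>] 0, η ∈ Ioc (0 : ℝ) 1 := Ioc_mem_nhdsGT one_pos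
  obtain ⟨η, h4, h5⟩ := (h2.and h3).exists
  exact ⟨η, h5.1, h5.2, h4.le⟩

/-- The cut is at the integer midpoint. The worst case is three steps, cut as 1+2, hence the ratio
2/3. -/
theorem halving (j k : ℕ) (hjk : j + 2 ≤ k) {h : ℝ} (hh : 0 < h) :
    ∃ (u : ℕ) (x y : ℝ), j < u ∧ u < k ∧ 0 < x ∧ 0 < y ∧ x ≤ 2 / 3 * (x + y) ∧
      y ≤ 2 / 3 * (x + y) ∧ (u : ℝ) * h - j * h = x ∧ (k : ℝ) * h - u * h = y ∧
      (k : ℝ) * h - j * h = x + y := by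
  obtain ⟨l, rfl⟩ := Nat.exists_eq_add_of_le hjk
  set u := j + (l + 2) / 2 with hu
  have h1 : 3 * (u : ℝ) ≤ 2 * (j + 2 + l : ℕ) + j := by
    exact_mod_cast (by omega : 3 * u ≤ 2 * (j + 2 + l) + j)
  have h2 : ((j + 2 + l : ℕ) : ℝ) + 2 * j ≤ 3 * u := by
    exact_mod_cast (by omega : j + 2 + l + 2 * j ≤ 3 * u)
  have h3 : (j : ℝ) < u := by exact_mod_cast (by omega : j < u)
  have h4 : (u : ℝ) < (j + 2 + l : ℕ) := by exact_mod_cast (by omega : u < j + 2 + l)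
  refine ⟨u, _, _, by omega, by omega, ?_, ?_, ?_, ?_, rfl, rfl, by ring⟩
  · linarith [mul_lt_mul_of_pos_right h3 hh]
  · linarith [mul_lt_mul_of_pos_right h4 hh]
  · linarith [mul_le_mul_of_nonneg_right h1 hh.le]
  · linarith [mul_le_mul_of_nonneg_right h2 hh.le]

/-! ### Discrete sewing: estimates, stability and convergence of the scheme -/

namespace AlmostFlow

variable {E : Type*} [NormedAddCommGroup E] {T γ α C : ℝ} {m : ℝ → ℝ → E → E}

theorem lipschitz (H : AlmostFlow T γ α C m) {s t : ℝ} (hs : 0 ≤ s) (hst : s ≤ t) (ht : t ≤ T)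
    (e e' : E) : ‖m t s e - m t s e'‖ ≤ (1 + C * (t - s) ^ γ) * ‖e - e'‖ := by
  simpa using H.second_difference s t hs hst ht e e' e' e'

theorem map_zero_zero (H : AlmostFlow T γ α C m) {s : ℝ} (hs : 0 ≤ s) (hsT : s ≤ T) :
    m s s 0 = 0 := by
  have h := H.norm_le s s hs le_rfl hsT 0
  rw [sub_self, Real.zero_rpow H.exponent_pos.ne', mul_zero, add_zero, norm_zero] at h
  exact norm_le_zero_iff.1 h

/-- The estimate `‖g_t - m t s g_s‖ ≤ K (1 + ‖g_s‖) (t - s) ^ α` for the scheme, over short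
intervals. -/
theorem euler_local (H : AlmostFlow T γ α C m) :
    ∃ η K : ℝ, 0 < η ∧ 0 ≤ K ∧ η ≤ 1 ∧ C * η ^ γ + K * η ^ α ≤ 1 ∧
      ∀ h : ℝ, 0 < h → ∀ l j k : ℕ, k = j + l → 0 < l → (k : ℝ) * h ≤ T →
        (k : ℝ) * h - j * h ≤ η →
        ‖euler m h k - m (k * h) (j * h) (euler m h j)‖ ≤
          K * (1 + ‖euler m h j‖) * ((k : ℝ) * h - j * h) ^ α := by
  have hα := H.one_lt_exponent
  have hγ := H.exponent_pos
  have hC := H.const_nonneg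
  set θ : ℝ := (2 / 3 : ℝ) ^ (α - 1) with hθ
  have hθ0 : 0 < θ := by positivity
  have hθ1 : θ < 1 := Real.rpow_lt_one (by norm_num) (by norm_num) (by linarith)
  -- With this K the composition default C is the fraction (1-θ)/2 of K. Short intervals allow a
  -- loss factor 1+(1-θ)/2, and the induction closes because (1+(1-θ)/2)θ + (1-θ)/2 ≤ 1.
  set K := 2 * C / (1 - θ) with hK
  have hK0 : 0 ≤ K := div_nonneg (by positivity) (by linarith)
  have hKC : C = K * ((1 - θ) / 2) := by rw [hK]; field_simp [(by linarith : (1 - θ) ≠ 0)]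
  obtain ⟨η, hη0, hη1, hη⟩ := exists_small_step hγ (by linarith : 0 < α) C K
    (ε := min 1 ((1 - θ) / 2)) (lt_min one_pos (by linarith))
  have hηa := hη.trans (min_le_left _ _)
  have hηb := hη.trans (min_le_right _ _)
  refine ⟨η, K, hη0, hK0, hη1, hηa, ?_⟩
  intro h hh l
  induction l using Nat.strong_induction_on with
  | _ l ih =>
  intro j k hk hl hkT hkη
  -- Over a single step the default is zero, by definition of the scheme.
  rcases Nat.lt_or_ge l 2 with hl2 | hl2
  · obtain rfl : k = j + 1 := by omega
    have : euler m h (j + 1) = m ((j + 1 : ℕ) * h) (j * h) (euler m h j) := rfl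
    rw [this, sub_self, norm_zero]
    push_cast
    have : 0 ≤ ((j : ℝ) + 1) * h - j * h := by ring_nf; exact hh.le
    positivity
  · obtain ⟨u, x, y, hju, huk, hx0, hy0, hxz, hyz, hxu, hyu, hzu⟩ := halving j k (by omega) hh
    have hj0 : (0 : ℝ) ≤ j := Nat.cast_nonneg j
    have hjh : 0 ≤ (j : ℝ) * h := by positivity
    have huT : (u : ℝ) * h ≤ T := by linarith
    have h1 := ih (u - j) (by omega) j u (by omega) (by omega) huT (by linarith)
    have h2 := ih (k - u) (by omega) u k (by omega) (by omega) hkT (by linarith)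
    have h3 := H.norm_le (j * h) (u * h) hjh (by linarith) huT (euler m h j)
    have h4 := H.lipschitz (s := u * h) (t := k * h) (by linarith) (by linarith) hkT
      (euler m h u) (m (u * h) (j * h) (euler m h j))
    have h5 := H.comp_sub_le (j * h) (u * h) (k * h) hjh (by linarith) (by linarith) hkT
      (euler m h j)
    rw [hxu] at h1 h3
    rw [hyu] at h2 h4
    rw [hzu] at h5 hkη ⊢
    set g := ‖euler m h j‖
    have hg : 0 ≤ g := norm_nonneg _
    have hxγ : x ^ γ ≤ η ^ γ := Real.rpow_le_rpow hx0.le (by linarith) hγ.le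
    have hyγ : y ^ γ ≤ η ^ γ := Real.rpow_le_rpow hy0.le (by linarith) hγ.le
    have hxα : x ^ α ≤ η ^ α := Real.rpow_le_rpow hx0.le (by linarith) (by linarith)
    have hηα : 0 ≤ η ^ α := by positivity
    have hηγ : 0 ≤ η ^ γ := by positivity
    have hbal : x ^ α + y ^ α ≤ θ * (x + y) ^ α := by
      exact rpow_add_rpow_le_of_balanced hx0 hy0 hα.le hxz hyz
    -- The weight at the midpoint is compared with the weight at the left endpoint, using the
    -- induction hypothesis on the left half.
    have hlam : 1 + ‖euler m h u‖ ≤ (1 + (1 - θ) / 2) * (1 + g) := by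
      have : ‖euler m h u‖ ≤ ‖euler m h u - m (u * h) (j * h) (euler m h j)‖
          + ‖m (u * h) (j * h) (euler m h j)‖ := by
        simpa using norm_add_le (euler m h u - m (u * h) (j * h) (euler m h j))
          (m (u * h) (j * h) (euler m h j))
      have e1 : K * (1 + g) * x ^ α ≤ K * (1 + g) * η ^ α := by gcongr
      have e2 : C * x ^ γ ≤ C * η ^ γ := by gcongr
      have e3 : C * η ^ γ ≤ C * η ^ γ * (1 + g) := by
        have := mul_nonneg (mul_nonneg hC hηγ) hg
        linarith
      have e4 : (1 + g) * (C * η ^ γ + K * η ^ α) ≤ (1 + g) * ((1 - θ) / 2) := by gcongr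
      linarith
    have hlam2 : 1 + C * y ^ γ ≤ 1 + (1 - θ) / 2 := by
      have : C * y ^ γ ≤ C * η ^ γ := by gcongr
      have := mul_nonneg hK0 hηα
      linarith
    -- The default on the right half, the default on the left half transported by a nearly
    -- nonexpansive map, and the composition default at the left endpoint.
    have hsplit : euler m h k - m (k * h) (j * h) (euler m h j) =
        (euler m h k - m (k * h) (u * h) (euler m h u))
        + (m (k * h) (u * h) (euler m h u) - m (k * h) (u * h) (m (u * h) (j * h) (euler m h j)))
        + (m (k * h) (u * h) (m (u * h) (j * h) (euler m h j))
            - m (k * h) (j * h) (euler m h j)) := by abel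
    rw [hsplit]
    refine (norm_add₃_le).trans ?_
    have f1 : K * (1 + ‖euler m h u‖) * y ^ α ≤ K * ((1 + (1 - θ) / 2) * (1 + g)) * y ^ α := by
      gcongr
    have f2 : (1 + C * y ^ γ) * ‖euler m h u - m (u * h) (j * h) (euler m h j)‖ ≤
        (1 + (1 - θ) / 2) * (K * (1 + g) * x ^ α) := by
      gcongr
    have f3 : K * (1 + g) * (1 + (1 - θ) / 2) * (x ^ α + y ^ α) ≤
        K * (1 + g) * (1 + (1 - θ) / 2) * (θ * (x + y) ^ α) := by
      gcongr
    have f4 : C * (1 + g) * (x + y) ^ α = K * (1 + g) * ((1 - θ) / 2) * (x + y) ^ α := by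
      rw [hKC]; ring
    have f5 : K * (1 + g) * (x + y) ^ α * ((1 + (1 - θ) / 2) * θ + (1 - θ) / 2) ≤
        K * (1 + g) * (x + y) ^ α * 1 := by
      have : 0 ≤ (x + y) ^ α := by positivity
      refine mul_le_mul_of_nonneg_left ?_ (by positivity)
      have : 0 ≤ (1 - θ) * (1 - θ) := mul_self_nonneg _
      linarith
    linarith

/-- Uniform bounds for the scheme on the whole of `[0, T]`. -/
theorem euler_global (H : AlmostFlow T γ α C m) :
    ∃ η N K : ℝ, 0 < η ∧ 0 ≤ N ∧ 0 ≤ K ∧ ∀ h : ℝ, 0 < h → h ≤ η →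
      (∀ k : ℕ, (k : ℝ) * h ≤ T → ‖euler m h k‖ ≤ N) ∧
      ∀ j k : ℕ, j < k → (k : ℝ) * h ≤ T →
        ‖euler m h k - m (k * h) (j * h) (euler m h j)‖ ≤ K * ((k : ℝ) * h - j * h) ^ α := by
  obtain ⟨η, K, hη, hK, hη1, hsmall, hloc⟩ := H.euler_local
  have hα : 0 < α := by linarith [H.one_lt_exponent]
  have hγ := H.exponent_pos
  have hC := H.const_nonneg
  set p := ⌈2 * T / η⌉₊
  have hp : T ≤ p * (η / 2) := by
    have := Nat.le_ceil (2 * T / η)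
    rw [div_le_iff₀ hη] at this
    linarith
  set N : ℝ := 2 ^ p with hNdef
  have hN : 0 ≤ N := by positivity
  -- The first summand serves intervals shorter than η. The second serves longer ones, where the
  -- trivial bound 2N + C|T|^γ is divided by η^α.
  set K' := K * (1 + N) + (2 * N + C * |T| ^ γ) / η ^ α with hK'
  have hηα : 0 < η ^ α := by positivity
  refine ⟨η, N, K', hη, hN, by positivity, fun h hh hhη => ?_⟩
  have hbound : ∀ k : ℕ, (k : ℝ) * h ≤ T → ‖euler m h k‖ ≤ N := by
    intro k hk
    have key := le_two_pow_of_doubling (f := fun k => 1 + ‖euler m h k‖) hh hhη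
      (fun k => by positivity) (T := T) (fun j k hjk hkT hkη => ?_) p k hk (hk.trans hp)
    · have : euler m h 0 = 0 := rfl
      rw [this, norm_zero, add_zero, mul_one] at key
      linarith
    · have hjk' : (j : ℝ) * h ≤ k * h := by gcongr
      rcases hjk.eq_or_lt with rfl | hlt
      · linarith [norm_nonneg (euler m h j)]
      · have h1 := hloc h hh (k - j) j k (by omega) (by omega) hkT hkη
        have h2 := H.norm_le (j * h) (k * h) (by positivity) hjk' hkT (euler m h j)
        have h3 : ‖euler m h k‖ ≤ ‖euler m h k - m (k * h) (j * h) (euler m h j)‖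
            + ‖m (k * h) (j * h) (euler m h j)‖ := by
          simpa using norm_add_le (euler m h k - m (k * h) (j * h) (euler m h j))
            (m (k * h) (j * h) (euler m h j))
        set x := (k : ℝ) * h - j * h
        set g := ‖euler m h j‖
        have hg : 0 ≤ g := norm_nonneg _
        have hx : 0 ≤ x := by linarith
        have e1 : K * (1 + g) * x ^ α ≤ K * (1 + g) * η ^ α := by gcongr
        have e2 : C * x ^ γ ≤ C * η ^ γ := by gcongr
        have e3 : 0 ≤ C * η ^ γ * g := by positivity
        have e4 : (1 + g) * (C * η ^ γ + K * η ^ α) ≤ (1 + g) * 1 := by gcongr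
        linarith
  refine ⟨hbound, fun j k hjk hkT => ?_⟩
  have hjk' : (j : ℝ) * h < k * h := by gcongr
  have hj0 : 0 ≤ (j : ℝ) * h := by positivity
  have hgj := hbound j (hjk'.le.trans hkT)
  set x := (k : ℝ) * h - j * h with hx
  have hx0 : 0 < x := by linarith
  rcases le_total x η with hxη | hxη
  · refine (hloc h hh (k - j) j k (by omega) (by omega) hkT hxη).trans ?_
    rw [hK', add_mul]
    have e1 : K * (1 + ‖euler m h j‖) * x ^ α ≤ K * (1 + N) * x ^ α := by gcongr
    have e2 : 0 ≤ (2 * N + C * |T| ^ γ) / η ^ α * x ^ α := by positivity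
    linarith
  · have h2 := H.norm_le (j * h) (k * h) hj0 hjk'.le hkT (euler m h j)
    have h3 := norm_sub_le (euler m h k) (m (k * h) (j * h) (euler m h j))
    have h4 := hbound k hkT
    have h5 : x ^ γ ≤ |T| ^ γ := by
      gcongr
      exact le_trans (by linarith) (le_abs_self T)
    have h6 : C * x ^ γ ≤ C * |T| ^ γ := by gcongr
    have h7 : (2 * N + C * |T| ^ γ) ≤ (2 * N + C * |T| ^ γ) / η ^ α * x ^ α := by
      rw [div_mul_eq_mul_div, le_div_iff₀ hηα]
      gcongr
    have h8 : 0 ≤ K * (1 + N) * x ^ α := by positivity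
    rw [hK', add_mul]
    linarith

set_option maxHeartbeats 1000000 in
/-- Two sequences on a grid of mesh `h` which start at the same point and whose one-step defaults
differ by at most `ρ h ^ b` with `b > 1` stay at distance `O(ρ)`. -/
theorem stability (H : AlmostFlow T γ α C m) {K N b : ℝ} (hK : 0 ≤ K) (hN : 0 ≤ N)
    (hb : 1 < b) (hbα : b ≤ α) :
    ∃ η L : ℝ, 0 < η ∧ 0 ≤ L ∧ ∀ h : ℝ, 0 < h → h ≤ η → ∀ ρ : ℝ, 0 ≤ ρ → ∀ g g' : ℕ → E,
      g 0 = g' 0 →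
      (∀ k : ℕ, (k : ℝ) * h ≤ T → ‖g' k‖ ≤ N) →
      (∀ j k : ℕ, j < k → (k : ℝ) * h ≤ T →
        ‖g' k - m (k * h) (j * h) (g' j)‖ ≤ K * ((k : ℝ) * h - j * h) ^ α) →
      (∀ k : ℕ, ((k + 1 : ℕ) : ℝ) * h ≤ T →
        ‖(g (k + 1) - m ((k + 1 : ℕ) * h) (k * h) (g k))
          - (g' (k + 1) - m ((k + 1 : ℕ) * h) (k * h) (g' k))‖ ≤ ρ * h ^ b) →
      ∀ k : ℕ, (k : ℝ) * h ≤ T → ‖g k - g' k‖ ≤ L * ρ := by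
  have hα := H.one_lt_exponent
  have hγ := H.exponent_pos
  have hC := H.const_nonneg
  set θ : ℝ := (2 / 3 : ℝ) ^ (b - 1) with hθ
  have hθ0 : 0 < θ := by positivity
  have hθ1 : θ < 1 := Real.rpow_lt_one (by norm_num) (by norm_num) (by linarith)
  -- `4 * C * K` comes from the quadratic term of the second difference, `C * (1 + N)` from the
  -- difference of composition defaults. The extra 1 makes K' ≥ 1, so that the one-step hypothesis
  -- starts the induction.
  set A := 4 * C * K + C * (1 + N) + 1 with hA
  have hA1 : 1 ≤ A := by
    have : 0 ≤ 4 * C * K + C * (1 + N) := by positivity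
    linarith
  have h1θ : 0 < 1 - θ := by linarith
  set K' := A * 2 / (1 - θ) with hK'
  have hKA : A = K' * ((1 - θ) / 2) := by rw [hK']; field_simp
  have hK'0 : 0 ≤ K' := by positivity
  have hK'1 : 1 ≤ K' := by rw [hK', le_div_iff₀ h1θ]; linarith
  obtain ⟨η, hη0, hη1, hη⟩ := exists_small_step hγ (by linarith : 0 < b) C K'
    (ε := min 1 ((1 - θ) / 2)) (lt_min one_pos (by linarith))
  have hηa := hη.trans (min_le_left _ _)
  have hηb := hη.trans (min_le_right _ _)
  have hηγ : 0 ≤ C * η ^ γ := by positivity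
  have hηb0 : 0 ≤ K' * η ^ b := by positivity
  set p := ⌈2 * T / η⌉₊
  have hp : T ≤ p * (η / 2) := by
    have := Nat.le_ceil (2 * T / η)
    rw [div_le_iff₀ hη0] at this
    linarith
  refine ⟨η, 2 ^ p, hη0, by positivity, ?_⟩
  intro h hh hhη ρ hρ g g' h0 hgN hgK hstep
  set D : ℕ → ℕ → E := fun k j =>
    (g k - m (k * h) (j * h) (g j)) - (g' k - m (k * h) (j * h) (g' j)) with hD
  -- A bound on the difference of defaults makes ‖g - g'‖ + ρ grow by a factor close to 1 on a short
  -- window. It is used at the midpoint during the induction and once more for the final doubling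
  -- argument.
  have hgrow : ∀ j k : ℕ, j < k → (k : ℝ) * h ≤ T → (k : ℝ) * h - j * h ≤ η →
      ‖D k j‖ ≤ K' * (‖g j - g' j‖ + ρ) * ((k : ℝ) * h - j * h) ^ b →
      ‖g k - g' k‖ + ρ ≤ (1 + (C * η ^ γ + K' * η ^ b)) * (‖g j - g' j‖ + ρ) := by
    intro j k hjk hkT hkη hDk
    have hjk' : (j : ℝ) * h < k * h := by gcongr
    have h1 := H.lipschitz (s := j * h) (t := k * h) (by positivity) hjk'.le hkT (g j) (g' j)
    have h2 : g k - g' k = D k j + (m (k * h) (j * h) (g j) - m (k * h) (j * h) (g' j)) := by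
      simp only [hD]; abel
    have h3 := norm_add_le (D k j) (m (k * h) (j * h) (g j) - m (k * h) (j * h) (g' j))
    rw [← h2] at h3
    set x := (k : ℝ) * h - j * h
    set δ := ‖g j - g' j‖
    have hδ : 0 ≤ δ := norm_nonneg _
    have hx : 0 ≤ x := by linarith
    have e1 : K' * (δ + ρ) * x ^ b ≤ K' * (δ + ρ) * η ^ b := by gcongr
    have e2 : (1 + C * x ^ γ) * δ ≤ (1 + C * η ^ γ) * δ := by gcongr
    have e3 : 0 ≤ C * η ^ γ * ρ := by positivity
    linarith
  have main : ∀ l j k : ℕ, k = j + l → 0 < l → (k : ℝ) * h ≤ T → (k : ℝ) * h - j * h ≤ η →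
      ‖D k j‖ ≤ K' * (‖g j - g' j‖ + ρ) * ((k : ℝ) * h - j * h) ^ b := by
    intro l
    induction l using Nat.strong_induction_on with
    | _ l ih =>
    intro j k hk hl hkT hkη
    rcases Nat.lt_or_ge l 2 with hl2 | hl2
    · obtain rfl : k = j + 1 := by omega
      refine (hstep j hkT).trans ?_
      have e1 : ((j + 1 : ℕ) : ℝ) * h - j * h = h := by push_cast; ring
      rw [e1]
      gcongr
      nlinarith [norm_nonneg (g j - g' j)]
    · obtain ⟨u, x, y, hju, huk, hx0, hy0, hxz, hyz, hxu, hyu, hzu⟩ :=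
        halving j k (by omega) hh
      have hjh : 0 ≤ (j : ℝ) * h := by positivity
      have huT : (u : ℝ) * h ≤ T := by linarith
      have h1 := ih (u - j) (by omega) j u (by omega) (by omega) huT (by linarith)
      have h2 := ih (k - u) (by omega) u k (by omega) (by omega) hkT (by linarith)
      have h3 := hgrow j u hju huT (by linarith) h1
      -- Here (p - q) - (p' - q') is the difference of defaults on the left half, and p' - q' is a
      -- default of g' alone. This is why only g' has to be bounded and close to a flow line; g
      -- enters through its one-step defaults.
      have h4 := H.second_difference (u * h) (k * h) (by linarith) (by linarith) hkT
        (g u) (m (u * h) (j * h) (g j)) (g' u) (m (u * h) (j * h) (g' j))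
      have h5 := H.comp_sub_sub_le (j * h) (u * h) (k * h) hjh (by linarith) (by linarith) hkT
        (g j) (g' j)
      have h6 := H.lipschitz (s := j * h) (t := u * h) hjh (by linarith) huT (g j) (g' j)
      have h7 := hgK j u hju huT
      have h8 := hgN j (by linarith)
      have hsplit : D k j = D k u
          + ((m (k * h) (u * h) (g u) - m (k * h) (u * h) (m (u * h) (j * h) (g j)))
            - (m (k * h) (u * h) (g' u) - m (k * h) (u * h) (m (u * h) (j * h) (g' j))))
          + ((m (k * h) (u * h) (m (u * h) (j * h) (g j)) - m (k * h) (j * h) (g j))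
            - (m (k * h) (u * h) (m (u * h) (j * h) (g' j)) - m (k * h) (j * h) (g' j))) := by
        simp only [hD]; abel
      have hDu : (g u - m (u * h) (j * h) (g j)) - (g' u - m (u * h) (j * h) (g' j)) = D u j := rfl
      rw [hDu] at h4
      rw [hxu] at h1 h6 h7
      rw [hyu] at h2 h4
      rw [hzu] at h5 hkη ⊢
      rw [hsplit]
      refine norm_add₃_le.trans ?_
      clear_value D
      clear hsplit hDu ih
      set δ := ‖g j - g' j‖
      set δu := ‖g u - g' u‖
      have hδ : 0 ≤ δ := norm_nonneg _
      have hxγ : x ^ γ ≤ η ^ γ := Real.rpow_le_rpow hx0.le (by linarith) hγ.le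
      have hyγ : y ^ γ ≤ η ^ γ := Real.rpow_le_rpow hy0.le (by linarith) hγ.le
      have hbal : x ^ b + y ^ b ≤ θ * (x + y) ^ b :=
        rpow_add_rpow_le_of_balanced hx0 hy0 hb.le hxz hyz
      -- All lengths are at most η ≤ 1, so the exponent α may be lowered to b.
      have hxα : x ^ α ≤ (x + y) ^ b :=
        (Real.rpow_le_rpow_of_exponent_ge hx0 (by linarith) hbα).trans (by gcongr; linarith)
      have hzα : (x + y) ^ α ≤ (x + y) ^ b :=
        Real.rpow_le_rpow_of_exponent_ge (by linarith) (by linarith) hbα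
      have hzb : 0 ≤ (x + y) ^ b := by positivity
      set lam := 1 + (1 - θ) / 2 with hlam
      have hlam2 : lam ≤ 2 := by linarith
      have hlam0 : 0 ≤ lam := by linarith
      have c1 : δu + ρ ≤ lam * (δ + ρ) := h3.trans (by gcongr; linarith)
      have c2 : 1 + C * x ^ γ ≤ lam := by
        have : C * x ^ γ ≤ C * η ^ γ := by gcongr
        linarith
      have c3 : 1 + C * y ^ γ ≤ lam := by
        have : C * y ^ γ ≤ C * η ^ γ := by gcongr
        linarith
      have c4 : δu + ‖m (u * h) (j * h) (g j) - m (u * h) (j * h) (g' j)‖ ≤ 4 * (δ + ρ) := by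
        have : (1 + C * x ^ γ) * δ ≤ 2 * δ := by gcongr; linarith
        have : lam * (δ + ρ) ≤ 2 * (δ + ρ) := by gcongr
        linarith
      have f1 : K' * (δu + ρ) * y ^ b ≤ K' * (lam * (δ + ρ)) * y ^ b := by gcongr
      have f2 : (1 + C * y ^ γ) * ‖D u j‖ ≤ lam * (K' * (δ + ρ) * x ^ b) := by gcongr
      have f3 : C * ‖g' u - m (u * h) (j * h) (g' j)‖
          * (δu + ‖m (u * h) (j * h) (g j) - m (u * h) (j * h) (g' j)‖) ≤
          C * (K * (x + y) ^ b) * (4 * (δ + ρ)) := by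
        have : K * x ^ α ≤ K * (x + y) ^ b := by gcongr
        gcongr
        linarith
      have f4 : C * (1 + ‖g' j‖) * δ * (x + y) ^ α ≤ C * (1 + N) * (δ + ρ) * (x + y) ^ b := by
        gcongr
        linarith
      have f5 : K' * lam * (δ + ρ) * (x ^ b + y ^ b) ≤
          K' * lam * (δ + ρ) * (θ * (x + y) ^ b) := by gcongr
      have f6 : (4 * C * K + C * (1 + N)) * ((δ + ρ) * (x + y) ^ b) ≤
          A * ((δ + ρ) * (x + y) ^ b) := by gcongr; linarith
      have f7 : K' * ((δ + ρ) * (x + y) ^ b) * (lam * θ + (1 - θ) / 2) ≤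
          K' * ((δ + ρ) * (x + y) ^ b) * 1 := by
        gcongr
        rw [hlam]
        have : 0 ≤ (1 - θ) * (1 - θ) := mul_self_nonneg _
        linarith
      rw [hKA] at f6
      linarith
  intro k hkT
  have key := le_two_pow_of_doubling (f := fun k => ‖g k - g' k‖ + ρ) hh hhη
    (fun k => by positivity) (T := T) (fun j k hjk hkT hkη => ?_) p k hkT (hkT.trans hp)
  · simp only [h0, sub_self, norm_zero, zero_add] at key
    linarith
  · rcases hjk.eq_or_lt with rfl | hlt
    · have : 0 ≤ ‖g j - g' j‖ + ρ := by positivity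
      linarith
    · refine (hgrow j k hlt hkT hkη (main (k - j) j k (by omega) (by omega) hkT hkη)).trans ?_
      gcongr
      linarith

theorem exists_between_exponent (H : AlmostFlow T γ α C m) : ∃ b, 1 < b ∧ b < α :=
  exists_between H.one_lt_exponent

/-- A bounded path which follows an almost flow up to `O((t - s) ^ α)` is determined by its
initial value. -/
theorem eqOn_of_flow_line (H : AlmostFlow T γ α C m) {y y' : ℝ → E} {K N : ℝ}
    (hN : ∀ t ∈ Icc 0 T, ‖y' t‖ ≤ N) (h0 : y 0 = y' 0)
    (hy : ∀ s t : ℝ, 0 ≤ s → s < t → t ≤ T → ‖y t - m t s (y s)‖ ≤ K * (t - s) ^ α)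
    (hy' : ∀ s t : ℝ, 0 ≤ s → s < t → t ≤ T → ‖y' t - m t s (y' s)‖ ≤ K * (t - s) ^ α) :
    EqOn y y' (Icc 0 T) := by
  rintro t ⟨ht0, htT⟩
  rcases ht0.eq_or_lt with rfl | ht
  · exact h0
  have hK : 0 ≤ K := by
    have h1 := (norm_nonneg _).trans (hy 0 t le_rfl ht htT)
    have h2 : 0 < (t - 0) ^ α := by rw [sub_zero]; positivity
    exact nonneg_of_mul_nonneg_left h1 h2
  have hN0 : 0 ≤ N := (norm_nonneg _).trans (hN t ⟨ht0, htT⟩)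
  -- The slack α - b turns the one-step default 2K h^α into ρ h^b with ρ = 2K h^{α-b}, which tends
  -- to zero with the mesh.
  obtain ⟨b, hb1, hbα⟩ := H.exists_between_exponent
  obtain ⟨η, L, hη, hL, hstab⟩ := H.stability hK hN0 hb1 hbα.le
  have hlim : Tendsto (fun q : ℕ => t / q) atTop (𝓝 0) := tendsto_const_div_atTop_nhds_zero_nat t
  have hbound : ∀ᶠ q : ℕ in atTop, ‖y t - y' t‖ ≤ L * (2 * K * (t / q) ^ (α - b)) := by
    filter_upwards [hlim.eventually_lt_const hη, eventually_gt_atTop 0] with q hqη hq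
    have hq0 : (0 : ℝ) < q := by exact_mod_cast hq
    have hh : 0 < t / q := by positivity
    set h := t / q with hhdef
    have hqh : (q : ℝ) * h = t := by rw [hhdef]; field_simp
    have key := hstab h hh hqη.le (2 * K * h ^ (α - b)) (by positivity) (fun k => y (k * h))
      (fun k => y' (k * h)) (by simpa using h0) (fun k hk => hN _ ⟨by positivity, hk⟩)
      (fun j k hjk hk => hy' _ _ (by positivity) (by gcongr) hk) (fun k hk => ?_) q
      (by rw [hqh]; exact htT)
    · simpa only [hqh] using key
    · have hlt : (k : ℝ) * h < (k + 1 : ℕ) * h := by gcongr; omega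
      have e : ((k + 1 : ℕ) : ℝ) * h - k * h = h := by push_cast; ring
      have h1 := hy (k * h) ((k + 1 : ℕ) * h) (by positivity) hlt hk
      have h2 := hy' (k * h) ((k + 1 : ℕ) * h) (by positivity) hlt hk
      rw [e] at h1 h2
      refine (norm_sub_le _ _).trans ?_
      have e2 : 2 * K * h ^ (α - b) * h ^ b = 2 * K * h ^ α := by
        rw [mul_assoc, ← Real.rpow_add hh, sub_add_cancel]
      rw [e2]
      linarith
  have hlim2 : Tendsto (fun q : ℕ => L * (2 * K * (t / q) ^ (α - b))) atTop (𝓝 0) := by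
    have h1 : 0 < α - b := by linarith
    have h2 := (Real.continuousAt_rpow_const (0 : ℝ) (α - b) (Or.inr h1.le)).tendsto.comp hlim
    rw [Real.zero_rpow h1.ne'] at h2
    simpa using (h2.const_mul (2 * K)).const_mul L
  have := ge_of_tendsto hlim2 hbound
  exact sub_eq_zero.1 (norm_le_zero_iff.1 this)

/-- The interpolation of the scheme at the time `t`. -/
noncomputable def eulerAt (m : ℝ → ℝ → E → E) (h t : ℝ) : E :=
  m t (⌊t / h⌋₊ * h) (euler m h ⌊t / h⌋₊)

theorem floor_mul_le {t h : ℝ} (ht : 0 ≤ t) (hh : 0 < h) : (⌊t / h⌋₊ : ℝ) * h ≤ t := by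
  have := Nat.floor_le (div_nonneg ht hh.le)
  rwa [le_div_iff₀ hh] at this

theorem lt_floor_mul_add {t h : ℝ} (hh : 0 < h) : t < (⌊t / h⌋₊ : ℝ) * h + h := by
  have h1 : t / h < ⌊t / h⌋₊ + 1 := Nat.lt_floor_add_one _
  rw [div_lt_iff₀ hh] at h1
  linarith

theorem lipschitz_const_le (H : AlmostFlow T γ α C m) {s t : ℝ} (hs : 0 ≤ s) (hst : s ≤ t)
    (ht : t ≤ T) (e e' : E) : ‖m t s e - m t s e'‖ ≤ (1 + C * T ^ γ) * ‖e - e'‖ := by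
  have hC := H.const_nonneg
  have hγ := H.exponent_pos
  refine (H.lipschitz hs hst ht e e').trans ?_
  have : (t - s) ^ γ ≤ T ^ γ := by
    apply Real.rpow_le_rpow (by linarith) (by linarith) hγ.le
  gcongr

/-- On the coarse grid, the even points of the fine scheme have one-step default m∘m - m over two
half steps, of size O(h^α), while the coarse scheme has none. `stability` therefore applies with ρ
of order h^{α-b}. -/
theorem euler_half_step (H : AlmostFlow T γ α C m) {b : ℝ} (hb : 1 < b) (hbα : b < α) :
    ∃ η B : ℝ, 0 < η ∧ 0 ≤ B ∧ ∀ h : ℝ, 0 < h → h ≤ η → ∀ t ∈ Icc 0 T,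
      ‖eulerAt m h t - eulerAt m (h / 2) t‖ ≤ B * h ^ (α - b) := by
  have hC := H.const_nonneg
  obtain ⟨η₁, N, K, hη₁, hN, hK, hglob⟩ := H.euler_global
  obtain ⟨η₂, L, hη₂, hL, hstab⟩ := H.stability hK hN hb hbα.le
  set A := 1 + C * |T| ^ γ with hA
  have hA0 : 0 ≤ A := by positivity
  refine ⟨min 1 (min η₁ η₂), C * (1 + N) + A * (L * (C * (1 + N))),
    by positivity, by positivity, ?_⟩
  intro h hh hhη t ht
  have hh1 : h ≤ 1 := hhη.trans (min_le_left _ _)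
  have hhη₁ : h ≤ η₁ := hhη.trans ((min_le_right _ _).trans (min_le_left _ _))
  have hhη₂ : h ≤ η₂ := hhη.trans ((min_le_right _ _).trans (min_le_right _ _))
  have hT : 0 ≤ T := ht.1.trans ht.2
  obtain ⟨hN', hK'⟩ := hglob (h / 2) (by positivity) (by linarith)
  have hcast : ∀ k : ℕ, ((2 * k : ℕ) : ℝ) * (h / 2) = k * h := by intro k; push_cast; ring
  have hcmp : ∀ k : ℕ, (k : ℝ) * h ≤ T →
      ‖euler m h k - euler m (h / 2) (2 * k)‖ ≤ L * (C * (1 + N) * h ^ (α - b)) := by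
    refine hstab h hh hhη₂ _ (by positivity) (euler m h) (fun k => euler m (h / 2) (2 * k)) rfl
      (fun k hk => hN' (2 * k) (by rw [hcast]; exact hk)) (fun j k hjk hk => ?_)
      (fun k hk => ?_)
    · have := hK' (2 * j) (2 * k) (by omega) (by rw [hcast]; exact hk)
      simpa only [hcast] using this
    · have hk0 : (k : ℝ) * h ≤ (k + 1 : ℕ) * h := by gcongr; omega
      have e0 : euler m h (k + 1) = m ((k + 1 : ℕ) * h) (k * h) (euler m h k) := rfl
      have e1 : euler m (h / 2) (2 * (k + 1)) =
          m ((k + 1 : ℕ) * h) ((2 * k + 1 : ℕ) * (h / 2))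
            (m ((2 * k + 1 : ℕ) * (h / 2)) (k * h) (euler m (h / 2) (2 * k))) := by
        rw [← hcast k, ← hcast (k + 1)]; rfl
      rw [e0, sub_self, zero_sub, norm_neg, e1]
      have e2 : C * (1 + N) * h ^ (α - b) * h ^ b = C * (1 + N) * h ^ α := by
        rw [mul_assoc, ← Real.rpow_add hh, sub_add_cancel]
      rw [e2]
      have hmid : ((2 * k + 1 : ℕ) : ℝ) * (h / 2) = k * h + h / 2 := by push_cast; ring
      have hend : ((k + 1 : ℕ) : ℝ) * h = k * h + h := by push_cast; ring
      refine (H.comp_sub_le (k * h) _ _ (by positivity) (by rw [hmid]; linarith)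
        (by rw [hmid, hend]; linarith) hk _).trans ?_
      have e3 : ((k + 1 : ℕ) : ℝ) * h - k * h = h := by rw [hend]; ring
      rw [e3]
      gcongr
      exact hN' (2 * k) (by rw [hcast]; exact hk0.trans hk)
  set k := ⌊t / h⌋₊ with hk
  have hkt : (k : ℝ) * h ≤ t := floor_mul_le ht.1 hh
  have hkt' : t < (k : ℝ) * h + h := lt_floor_mul_add hh
  have hkT := hkt.trans ht.2
  -- Off the grid, the fine scheme may have made one additional half step after the last coarse grid
  -- point; this costs one more composition default.
  have hk' : ⌊t / (h / 2)⌋₊ = 2 * k ∨ ⌊t / (h / 2)⌋₊ = 2 * k + 1 := by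
    have h1 : 2 * k ≤ ⌊t / (h / 2)⌋₊ := by
      apply Nat.le_floor
      rw [le_div_iff₀ (by positivity), hcast]
      exact hkt
    have h2 : ⌊t / (h / 2)⌋₊ < 2 * k + 2 := by
      rw [Nat.floor_lt (div_nonneg ht.1 (by positivity)), div_lt_iff₀ (by positivity)]
      push_cast
      linarith
    omega
  have hlip : ‖m t (k * h) (euler m h k) - m t (k * h) (euler m (h / 2) (2 * k))‖ ≤
      A * (L * (C * (1 + N) * h ^ (α - b))) := by
    refine (H.lipschitz_const_le (by positivity) hkt ht.2 _ _).trans ?_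
    rw [hA, abs_of_nonneg hT]
    have := hcmp k hkT
    gcongr
  have hpos : 0 ≤ C * (1 + N) * h ^ (α - b) := by positivity
  unfold eulerAt
  rw [← hk]
  rcases hk' with hk' | hk' <;> rw [hk']
  · rw [hcast]
    linarith
  · have e1 : euler m (h / 2) (2 * k + 1) =
        m ((2 * k + 1 : ℕ) * (h / 2)) (k * h) (euler m (h / 2) (2 * k)) := by
      rw [← hcast k]; rfl
    have hmid : ((2 * k + 1 : ℕ) : ℝ) * (h / 2) = k * h + h / 2 := by push_cast; ring
    have hmt : ((2 * k + 1 : ℕ) : ℝ) * (h / 2) ≤ t := by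
      have := floor_mul_le ht.1 (half_pos hh)
      rwa [hk'] at this
    have h3 := H.comp_sub_le (k * h) ((2 * k + 1 : ℕ) * (h / 2)) t (by positivity)
      (by rw [hmid]; linarith) hmt ht.2 (euler m (h / 2) (2 * k))
    rw [← e1] at h3
    have h4 : C * (1 + ‖euler m (h / 2) (2 * k)‖) * (t - k * h) ^ α ≤
        C * (1 + N) * h ^ (α - b) := by
      have h5 : (t - k * h) ^ α ≤ h ^ (α - b) := by
        refine (Real.rpow_le_rpow (by linarith) (by linarith : t - k * h ≤ h)
          (by linarith)).trans ?_
        exact Real.rpow_le_rpow_of_exponent_ge hh hh1 (by linarith)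
      have h6 := hN' (2 * k) (by rw [hcast]; exact hkT)
      have : 0 ≤ t - k * h := by linarith
      gcongr
    have h5 := norm_sub_le_norm_sub_add_norm_sub (m t (k * h) (euler m h k))
      (m t (k * h) (euler m (h / 2) (2 * k)))
      (m t ((2 * k + 1 : ℕ) * (h / 2)) (euler m (h / 2) (2 * k + 1)))
    rw [norm_sub_rev (m t (k * h) (euler m (h / 2) (2 * k)))] at h5
    linarith

/-- Both interpolated values are compared with the step taken from the last grid point before s.
That point may precede s by nearly h, hence t-s+h on the right; the extra h disappears in the limit.
-/
theorem eulerAt_flow_line (H : AlmostFlow T γ α C m) :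
    ∃ η B : ℝ, 0 < η ∧ 0 ≤ B ∧ ∀ h : ℝ, 0 < h → h ≤ η → ∀ s t : ℝ, 0 ≤ s → s < t → t ≤ T →
      ‖eulerAt m h t - m t s (eulerAt m h s)‖ ≤ B * (t - s + h) ^ α := by
  have hC := H.const_nonneg
  have hα : 0 < α := by linarith [H.one_lt_exponent]
  obtain ⟨η, N, K, hη, hN, hK, hglob⟩ := H.euler_global
  set A := 1 + C * |T| ^ γ with hA
  have hA0 : 0 ≤ A := by positivity
  refine ⟨η, A * K + 2 * (C * (1 + N)), hη, by positivity, ?_⟩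
  intro h hh hhη s t hs hst htT
  obtain ⟨hN', hK'⟩ := hglob h hh hhη
  have hT : 0 ≤ T := by linarith
  unfold eulerAt
  set j := ⌊s / h⌋₊ with hj
  set k := ⌊t / h⌋₊ with hk
  have hjs : (j : ℝ) * h ≤ s := floor_mul_le hs hh
  have hjs' : s < (j : ℝ) * h + h := lt_floor_mul_add hh
  have hkt : (k : ℝ) * h ≤ t := floor_mul_le (by linarith) hh
  have hjk : j ≤ k := Nat.floor_le_floor (by gcongr)
  have hjk' : (j : ℝ) * h ≤ k * h := by gcongr
  have hj0 : 0 ≤ (j : ℝ) * h := by positivity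
  have hNj := hN' j (by linarith)
  have hts : 0 ≤ t - j * h := by linarith
  have hpow : (t - j * h) ^ α ≤ (t - s + h) ^ α := by gcongr; linarith
  have h1 := H.comp_sub_le (j * h) s t hj0 hjs hst.le htT (euler m h j)
  have h2 := H.comp_sub_le (j * h) (k * h) t hj0 hjk' hkt htT (euler m h j)
  have h3 : C * (1 + ‖euler m h j‖) * (t - j * h) ^ α ≤ C * (1 + N) * (t - s + h) ^ α := by
    gcongr
  have hpos : 0 ≤ C * (1 + N) * (t - s + h) ^ α := by
    have : 0 ≤ t - s + h := by linarith
    positivity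
  have hpos' : 0 ≤ A * K * (t - s + h) ^ α := by
    have : 0 ≤ t - s + h := by linarith
    positivity
  rcases hjk.eq_or_lt with heq | hlt
  · rw [← heq, norm_sub_rev]
    linarith
  · have h4 : ‖m t (k * h) (euler m h k) - m t (k * h) (m (k * h) (j * h) (euler m h j))‖ ≤
        A * K * (t - s + h) ^ α := by
      refine (H.lipschitz_const_le (by positivity) hkt htT _ _).trans ?_
      rw [hA, abs_of_nonneg hT, mul_assoc]
      have h5 : ((k : ℝ) * h - j * h) ^ α ≤ (t - s + h) ^ α :=
        Real.rpow_le_rpow (by linarith) (by linarith) hα.le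
      have h6 : K * ((k : ℝ) * h - j * h) ^ α ≤ K * (t - s + h) ^ α := by gcongr
      have h7 := (hK' j k hlt (by linarith)).trans h6
      gcongr
    have hsplit : m t (k * h) (euler m h k) - m t s (m s (j * h) (euler m h j)) =
        (m t (k * h) (euler m h k) - m t (k * h) (m (k * h) (j * h) (euler m h j)))
        + (m t (k * h) (m (k * h) (j * h) (euler m h j)) - m t (j * h) (euler m h j))
        - (m t s (m s (j * h) (euler m h j)) - m t (j * h) (euler m h j)) := by abel
    rw [hsplit]
    refine (norm_sub_le _ _).trans ?_
    have h5 := norm_add_le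
      (m t (k * h) (euler m h k) - m t (k * h) (m (k * h) (j * h) (euler m h j)))
      (m t (k * h) (m (k * h) (j * h) (euler m h j)) - m t (j * h) (euler m h j))
    linarith

/-- An almost flow has a path, started from zero, which follows it up to `O((t - s) ^ α)`. -/
theorem exists_flow_line [CompleteSpace E] (H : AlmostFlow T γ α C m) (hT : 0 ≤ T) :
    ∃ y : ℝ → E, y 0 = 0 ∧ ContinuousOn y (Icc 0 T) ∧ ∃ B : ℝ, 0 ≤ B ∧
      ∀ s t : ℝ, 0 ≤ s → s < t → t ≤ T → ‖y t - m t s (y s)‖ ≤ B * (t - s) ^ α := by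
  have hC := H.const_nonneg
  have hα := H.one_lt_exponent
  obtain ⟨b, hb1, hbα⟩ := H.exists_between_exponent
  obtain ⟨η₁, B₁, hη₁, hB₁, hhalf⟩ := H.euler_half_step hb1 hbα
  obtain ⟨η₂, B, hη₂, hB, hline⟩ := H.eulerAt_flow_line
  set η := min η₁ η₂
  have hη : 0 < η := lt_min hη₁ hη₂
  set h : ℕ → ℝ := fun n => η * (1 / 2) ^ n with hh
  have hpos : ∀ n, 0 < h n := fun n => by positivity
  have hle : ∀ n, h n ≤ η := fun n =>
    mul_le_of_le_one_right hη.le (pow_le_one₀ (by norm_num) (by norm_num))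
  have hh0 : Tendsto h atTop (𝓝 0) := by
    simpa [hh] using (tendsto_pow_atTop_nhds_zero_of_lt_one (by norm_num : (0 : ℝ) ≤ 1 / 2)
      (by norm_num)).const_mul η
  have hlim : ∀ t, ∃ l, t ∈ Icc 0 T → Tendsto (fun n => eulerAt m (h n) t) atTop (𝓝 l) := by
    intro t
    by_cases ht : t ∈ Icc 0 T
    · have hr : (1 / 2 : ℝ) ^ (α - b) < 1 :=
        Real.rpow_lt_one (by norm_num) (by norm_num) (by linarith)
      have hc : CauchySeq fun n => eulerAt m (h n) t := by
        -- Along meshes η 2^{-n} successive differences decay geometrically, with ratio 2^{-(α-b)}.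
        refine cauchySeq_of_le_geometric _ (B₁ * η ^ (α - b)) hr fun n => ?_
        have h1 := hhalf (h n) (hpos n) ((hle n).trans (min_le_left _ _)) t ht
        have h2 : h n / 2 = h (n + 1) := by simp only [hh]; ring
        rw [h2, ← dist_eq_norm] at h1
        refine h1.trans (le_of_eq ?_)
        simp only [hh]
        rw [Real.mul_rpow hη.le (by positivity), ← Real.rpow_natCast, ← Real.rpow_natCast,
          ← Real.rpow_mul (by norm_num), ← Real.rpow_mul (by norm_num), mul_assoc,
          mul_comm (n : ℝ)]
      obtain ⟨l, hl⟩ := cauchySeq_tendsto_of_complete hc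
      exact ⟨l, fun _ => hl⟩
    · exact ⟨0, fun h => absurd h ht⟩
  choose y hy using hlim
  have hflow : ∀ s t : ℝ, 0 ≤ s → s < t → t ≤ T → ‖y t - m t s (y s)‖ ≤ B * (t - s) ^ α := by
    intro s t hs hst htT
    have h1 := hy t ⟨by linarith, htT⟩
    have h2 := hy s ⟨hs, by linarith⟩
    have h3 : Tendsto (fun n => m t s (eulerAt m (h n) s)) atTop (𝓝 (m t s (y s))) := by
      rw [tendsto_iff_norm_sub_tendsto_zero] at h2 ⊢
      refine squeeze_zero (fun _ => norm_nonneg _)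
        (fun n => H.lipschitz_const_le hs hst.le htT _ _) ?_
      simpa using h2.const_mul (1 + C * T ^ γ)
    have h4 : Tendsto (fun n => B * (t - s + h n) ^ α) atTop (𝓝 (B * (t - s) ^ α)) := by
      have h5 : Tendsto (fun n => t - s + h n) atTop (𝓝 (t - s)) := by
        simpa using hh0.const_add (t - s)
      exact (((Real.continuousAt_rpow_const _ α (Or.inr (by linarith))).tendsto).comp
        h5).const_mul B
    exact le_of_tendsto_of_tendsto' (h1.sub h3).norm h4 fun n =>
      hline (h n) (hpos n) ((hle n).trans (min_le_right _ _)) s t hs hst htT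
  have hy0 : y 0 = 0 := by
    have h1 := hy 0 ⟨le_rfl, hT⟩
    have h2 : ∀ n, eulerAt m (h n) 0 = 0 := by
      intro n
      have : euler m (h n) 0 = 0 := rfl
      simp [eulerAt, this, H.map_zero_zero le_rfl hT]
    simp only [h2] at h1
    exact tendsto_nhds_unique h1 tendsto_const_nhds
  refine ⟨y, hy0, ?_, B, hB, hflow⟩
  rintro t ⟨ht0, htT⟩
  rw [Metric.continuousWithinAt_iff']
  intro ε hε
  -- The maps are continuous in the final time only, for a fixed starting time. So y near t is
  -- compared with v ↦ m_{vr}(y_r) for one fixed r slightly before t, the error being O((v-r)^α).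
  obtain ⟨δ, hδ, hδε⟩ : ∃ δ : ℝ, 0 < δ ∧ B * (2 * δ) ^ α < ε / 4 := by
    have h1 : Tendsto (fun δ : ℝ => B * (2 * δ) ^ α) (𝓝[>] 0) (𝓝 0) := by
      have : ContinuousAt (fun δ : ℝ => B * (2 * δ) ^ α) 0 := by
        refine continuousAt_const.mul (ContinuousAt.rpow_const ?_ (Or.inr (by linarith)))
        fun_prop
      have h2 := this.tendsto
      simp only [mul_zero, Real.zero_rpow (by linarith : α ≠ 0)] at h2
      exact h2.mono_left nhdsWithin_le_nhds
    obtain ⟨δ, h2, h3⟩ := ((h1.eventually_lt_const (by positivity : 0 < ε / 4)).and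
      self_mem_nhdsWithin).exists
    exact ⟨δ, h3, h2⟩
  -- Taking r strictly before t, unless r = 0, makes [r, T] a neighbourhood of t in [0, T], so left
  -- continuity is covered as well.
  obtain ⟨r, hr0, hrt, hr1, hr2⟩ : ∃ r : ℝ, 0 ≤ r ∧ r ≤ t ∧ t - r ≤ δ ∧ (r = 0 ∨ r < t) := by
    refine ⟨max 0 (t - δ), le_max_left _ _, max_le ht0 (by linarith), ?_, ?_⟩
    · linarith [le_max_right 0 (t - δ)]
    · rcases ht0.eq_or_lt with rfl | hlt
      · left; simp [hδ.le]
      · right; exact max_lt hlt (by linarith)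
  have hclose : ∀ t' ∈ Icc r T, t' < r + 2 * δ → ‖y t' - m t' r (y r)‖ < ε / 4 ∨ t' = r := by
    intro t' ht' hlt
    rcases ht'.1.eq_or_lt with heq | hlt'
    · exact Or.inr heq.symm
    · left
      refine (hflow r t' hr0 hlt' ht'.2).trans_lt (lt_of_le_of_lt ?_ hδε)
      have : 0 ≤ t' - r := by linarith
      gcongr
      linarith
  have hcont := H.continuousOn r hr0 (y r) t ⟨hrt, htT⟩
  rw [Metric.continuousWithinAt_iff'] at hcont
  have hc1 := hcont (ε / 4) (by positivity)
  have hnhds : 𝓝[Icc 0 T] t ≤ 𝓝[Icc r T] t := by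
    rcases hr2 with rfl | hlt
    · exact le_rfl
    · rw [nhdsWithin_le_iff]
      filter_upwards [self_mem_nhdsWithin, mem_nhdsWithin_of_mem_nhds (Ioi_mem_nhds hlt)]
        with v hv hv'
      exact ⟨le_of_lt hv', hv.2⟩
  have hclose' : ∀ t' ∈ Icc r T, t' < r + 2 * δ → (r < t' ∨ r = 0) →
      ‖y t' - m t' r (y r)‖ < ε / 4 := by
    intro t' ht' hlt hor
    rcases hor with hor | rfl
    · exact (hclose t' ht' hlt).resolve_right hor.ne'
    · rcases hclose t' ht' hlt with h1 | rfl
      · exact h1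
      · rw [hy0, H.map_zero_zero le_rfl hT, sub_zero, norm_zero]; positivity
  have hev : ∀ᶠ t' in 𝓝[Icc 0 T] t, t' ∈ Icc r T ∧ (r < t' ∨ r = 0) := by
    rcases hr2 with rfl | hlt
    · filter_upwards [self_mem_nhdsWithin] with v hv
      exact ⟨hv, Or.inr rfl⟩
    · filter_upwards [self_mem_nhdsWithin, mem_nhdsWithin_of_mem_nhds (Ioi_mem_nhds hlt)]
        with v hv hv'
      exact ⟨⟨le_of_lt hv', hv.2⟩, Or.inl hv'⟩
  filter_upwards [hnhds hc1, hev, mem_nhdsWithin_of_mem_nhds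
    (Iio_mem_nhds (by linarith : t < r + 2 * δ))] with v hv hvr hvδ
  have h1 := hclose' v hvr.1 hvδ hvr.2
  have h2 := hclose' t ⟨hrt, htT⟩ (by linarith) (hr2.symm)
  rw [dist_eq_norm] at hv ⊢
  have hsplit : y v - y t = (y v - m v r (y r)) + (m v r (y r) - m t r (y r))
      - (y t - m t r (y r)) := by abel
  rw [hsplit]
  have h3 := norm_sub_le ((y v - m v r (y r)) + (m v r (y r) - m t r (y r))) (y t - m t r (y r))
  have h4 := norm_add_le (y v - m v r (y r)) (m v r (y r) - m t r (y r))
  linarith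

end AlmostFlow

end AlmostFlow

section Laplace

open Filter Topology

/-! ### The semigroup and the integral on the Laplace space -/

variable {φhat : ℝ → ℝ}

theorem coeFn_decay (r : ℝ≥0) (g : LaplaceSpace φhat) :
    decay φhat r g =ᵐ[laplaceMeasure φhat] fun ξ => Real.exp (-(ξ * r)) * g ξ :=
  MemLp.coeFn_toLp _

theorem decay_add (r : ℝ≥0) (g g' : LaplaceSpace φhat) :
    decay φhat r (g + g') = decay φhat r g + decay φhat r g' := by
  refine Lp.ext ?_
  filter_upwards [coeFn_decay r (g + g'), coeFn_decay r g, coeFn_decay r g', Lp.coeFn_add g g',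
    Lp.coeFn_add (decay φhat r g) (decay φhat r g')] with ξ h1 h2 h3 h4 h5
  rw [h1, h5, Pi.add_apply, h2, h3, h4, Pi.add_apply, mul_add]

theorem decay_smul (r : ℝ≥0) (c : ℝ) (g : LaplaceSpace φhat) :
    decay φhat r (c • g) = c • decay φhat r g := by
  refine Lp.ext ?_
  filter_upwards [coeFn_decay r (c • g), coeFn_decay r g, Lp.coeFn_smul c g,
    Lp.coeFn_smul c (decay φhat r g)] with ξ h1 h2 h4 h5
  rw [h1, h5, Pi.smul_apply, h2, h4, Pi.smul_apply, smul_eq_mul, smul_eq_mul]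
  ring

theorem norm_decay_le (r : ℝ≥0) (g : LaplaceSpace φhat) : ‖decay φhat r g‖ ≤ ‖g‖ := by
  refine Lp.norm_le_norm_of_ae_le ?_
  filter_upwards [coeFn_decay r g, laplaceMeasure_nonneg φhat] with ξ h1 hξ
  rw [h1, norm_mul, Real.norm_eq_abs, abs_of_pos (Real.exp_pos _)]
  refine mul_le_of_le_one_left (norm_nonneg _) (Real.exp_le_one_iff.2 ?_)
  have : 0 ≤ ξ * (r : ℝ) := mul_nonneg hξ r.2
  linarith

theorem decay_decay (r r' : ℝ≥0) (g : LaplaceSpace φhat) :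
    decay φhat r (decay φhat r' g) = decay φhat (r + r') g := by
  refine Lp.ext ?_
  filter_upwards [coeFn_decay r (decay φhat r' g), coeFn_decay r' g, coeFn_decay (r + r') g]
    with ξ h1 h2 h3
  rw [h1, h2, h3, ← mul_assoc, ← Real.exp_add]
  congr 2
  push_cast
  ring

/-- Multiplication by `e^{-ξ r}` as a bounded operator. -/
noncomputable def decayL (φhat : ℝ → ℝ) (r : ℝ≥0) : LaplaceSpace φhat →L[ℝ] LaplaceSpace φhat :=
  LinearMap.mkContinuous ⟨⟨decay φhat r, decay_add r⟩, decay_smul r⟩ 1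
    fun g => by simpa using norm_decay_le r g

theorem decay_sub (r : ℝ≥0) (g g' : LaplaceSpace φhat) :
    decay φhat r (g - g') = decay φhat r g - decay φhat r g' := (decayL φhat r).map_sub g g'

/-- Dominated convergence, with no rate: g need not be integrable against an additional factor ξ. -/
theorem continuous_decay_left (g : LaplaceSpace φhat) : Continuous fun r => decay φhat r g := by
  rw [continuous_iff_continuousAt]
  intro r₀
  rw [ContinuousAt, tendsto_iff_norm_sub_tendsto_zero]
  have hnorm : ∀ r : ℝ≥0, ‖decay φhat r g - decay φhat r₀ g‖ =
      ∫ ξ, |Real.exp (-(ξ * r)) - Real.exp (-(ξ * r₀))| * ‖g ξ‖ ∂(laplaceMeasure φhat) := by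
    intro r
    rw [L1.norm_eq_integral_norm]
    refine integral_congr_ae ?_
    filter_upwards [coeFn_decay r g, coeFn_decay r₀ g,
      Lp.coeFn_sub (decay φhat r g) (decay φhat r₀ g)] with ξ h1 h2 h3
    rw [h3, Pi.sub_apply, h1, h2, ← sub_mul, norm_mul, Real.norm_eq_abs]
  simp only [hnorm]
  have hg : Integrable (fun ξ => 2 * ‖g ξ‖) (laplaceMeasure φhat) :=
    (L1.integrable_coeFn g).norm.const_mul 2
  have key : Continuous fun r : ℝ≥0 =>
      ∫ ξ, |Real.exp (-(ξ * r)) - Real.exp (-(ξ * r₀))| * ‖g ξ‖ ∂(laplaceMeasure φhat) := by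
    refine continuous_of_dominated (fun r => ?_) (fun r => ?_) hg ?_
    · exact (by fun_prop : Continuous fun ξ : ℝ =>
        |Real.exp (-(ξ * r)) - Real.exp (-(ξ * r₀))|).aestronglyMeasurable.mul
          (Lp.aestronglyMeasurable g).norm
    · filter_upwards [laplaceMeasure_nonneg φhat] with ξ hξ
      rw [norm_mul, norm_norm, Real.norm_eq_abs, abs_abs]
      refine mul_le_mul_of_nonneg_right ?_ (norm_nonneg _)
      have h1 : ∀ r : ℝ≥0, Real.exp (-(ξ * r)) ≤ 1 := fun r => Real.exp_le_one_iff.2 (by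
        have : 0 ≤ ξ * (r : ℝ) := mul_nonneg hξ r.2
        linarith)
      rw [abs_le]
      constructor <;> linarith [h1 r, h1 r₀, Real.exp_pos (-(ξ * r)), Real.exp_pos (-(ξ * r₀))]
    · filter_upwards with ξ
      fun_prop
  have := key.tendsto r₀
  simpa using this

/-- Strong continuity together with uniform contractivity gives joint continuity. -/
theorem continuous_decay : Continuous fun p : ℝ≥0 × LaplaceSpace φhat => decay φhat p.1 p.2 := by
  rw [continuous_iff_continuousAt]
  rintro ⟨r₀, g₀⟩
  rw [ContinuousAt, tendsto_iff_norm_sub_tendsto_zero]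
  have h1 : Tendsto (fun p : ℝ≥0 × LaplaceSpace φhat =>
      ‖p.2 - g₀‖ + ‖decay φhat p.1 g₀ - decay φhat r₀ g₀‖) (𝓝 (r₀, g₀)) (𝓝 0) := by
    have hc : Continuous fun p : ℝ≥0 × LaplaceSpace φhat =>
        ‖p.2 - g₀‖ + ‖decay φhat p.1 g₀ - decay φhat r₀ g₀‖ :=
      (continuous_snd.sub continuous_const).norm.add
        ((((continuous_decay_left g₀).comp continuous_fst)).sub continuous_const).norm
    simpa using hc.tendsto (r₀, g₀)
  refine squeeze_zero (fun _ => norm_nonneg _) (fun p => ?_) h1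
  refine (norm_sub_le_norm_sub_add_norm_sub _ (decay φhat p.1 g₀) _).trans ?_
  rw [← decay_sub]
  gcongr
  exact norm_decay_le _ _

/-- The density of `φ̂ dξ` with respect to `|φ̂| (1 + ξ) dξ`. -/
noncomputable def laplaceKernel (φhat : ℝ → ℝ) (ξ : ℝ) : ℝ := SignType.sign (φhat ξ) / (1 + ξ)

theorem abs_laplaceKernel_le (ξ : ℝ) (hξ : 0 ≤ ξ) : |laplaceKernel φhat ξ| ≤ 1 / (1 + ξ) := by
  rw [laplaceKernel, abs_div, abs_of_pos (by linarith : 0 < 1 + ξ)]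
  gcongr
  rcases lt_trichotomy (φhat ξ) 0 with h | h | h <;> simp [h]

theorem aestronglyMeasurable_laplaceKernel
    (hφ : AEMeasurable φhat (volume.restrict (Ioi (0 : ℝ)))) :
    AEStronglyMeasurable (laplaceKernel φhat) (laplaceMeasure φhat) := by
  have h1 : AEMeasurable (laplaceKernel φhat) (volume.restrict (Ioi (0 : ℝ))) := by
    have h2 : Measurable fun x : ℝ => ((SignType.sign x : SignType) : ℝ) := by
      have : (fun x : ℝ => ((SignType.sign x : SignType) : ℝ)) =
          fun x => if 0 < x then 1 else if x < 0 then -1 else 0 := by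
        funext x
        rcases lt_trichotomy x 0 with h | h | h <;> simp [h, h.le, not_lt.2]
      rw [this]
      exact Measurable.ite measurableSet_Ioi measurable_const
        (Measurable.ite measurableSet_Iio measurable_const measurable_const)
    exact (h2.comp_aemeasurable hφ).div (by fun_prop)
  exact (h1.mono_ac (withDensity_absolutelyContinuous _ _)).aestronglyMeasurable

/-- Passing to the weighted measure exhibits the factor 1/(1+ξ), on which every bound for this
functional rests. -/
theorem laplaceIntegral_eq (hφ : AEMeasurable φhat (volume.restrict (Ioi (0 : ℝ))))
    (g : LaplaceSpace φhat) :
    laplaceIntegral φhat g = ∫ ξ, laplaceKernel φhat ξ * g ξ ∂(laplaceMeasure φhat) := by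
  unfold laplaceMeasure laplaceIntegral
  rw [integral_withDensity_eq_integral_toReal_smul₀]
  · refine integral_congr_ae ?_
    filter_upwards [ae_restrict_mem measurableSet_Ioi] with ξ hξ
    have hξ' : (0 : ℝ) < 1 + ξ := by linarith [mem_Ioi.1 hξ]
    rw [ENNReal.toReal_ofReal (by positivity), laplaceKernel, smul_eq_mul, ← mul_assoc]
    congr 1
    field_simp
    rw [mul_comm, sign_mul_abs]
  · exact ((hφ.abs).mul (by fun_prop)).ennreal_ofReal
  · filter_upwards with ξ
    exact ENNReal.ofReal_lt_top

theorem integrable_laplaceKernel_mul (hφ : AEMeasurable φhat (volume.restrict (Ioi (0 : ℝ))))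
    (g : LaplaceSpace φhat) :
    Integrable (fun ξ => laplaceKernel φhat ξ * g ξ) (laplaceMeasure φhat) := by
  refine (L1.integrable_coeFn g).mono
    ((aestronglyMeasurable_laplaceKernel hφ).mul (Lp.aestronglyMeasurable g)) ?_
  filter_upwards [laplaceMeasure_nonneg φhat] with ξ hξ
  rw [norm_mul, Real.norm_eq_abs]
  refine mul_le_of_le_one_left (norm_nonneg _) ((abs_laplaceKernel_le ξ hξ).trans ?_)
  rw [div_le_one (by linarith)]
  linarith

theorem abs_laplaceIntegral_le (hφ : AEMeasurable φhat (volume.restrict (Ioi (0 : ℝ))))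
    (g : LaplaceSpace φhat) : |laplaceIntegral φhat g| ≤ ‖g‖ := by
  rw [laplaceIntegral_eq hφ, L1.norm_eq_integral_norm]
  refine (abs_integral_le_integral_abs).trans (integral_mono_ae
    (integrable_laplaceKernel_mul hφ g).abs (L1.integrable_coeFn g).norm ?_)
  filter_upwards [laplaceMeasure_nonneg φhat] with ξ hξ
  rw [abs_mul, Real.norm_eq_abs]
  refine mul_le_of_le_one_left (abs_nonneg _) ((abs_laplaceKernel_le ξ hξ).trans ?_)
  rw [div_le_one (by linarith)]
  linarith

theorem laplaceIntegral_add (hφ : AEMeasurable φhat (volume.restrict (Ioi (0 : ℝ))))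
    (g g' : LaplaceSpace φhat) :
    laplaceIntegral φhat (g + g') = laplaceIntegral φhat g + laplaceIntegral φhat g' := by
  rw [laplaceIntegral_eq hφ, laplaceIntegral_eq hφ, laplaceIntegral_eq hφ,
    ← integral_add (integrable_laplaceKernel_mul hφ g) (integrable_laplaceKernel_mul hφ g')]
  refine integral_congr_ae ?_
  filter_upwards [Lp.coeFn_add g g'] with ξ h
  rw [h, Pi.add_apply, mul_add]

theorem laplaceIntegral_smul (hφ : AEMeasurable φhat (volume.restrict (Ioi (0 : ℝ))))
    (c : ℝ) (g : LaplaceSpace φhat) :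
    laplaceIntegral φhat (c • g) = c * laplaceIntegral φhat g := by
  rw [laplaceIntegral_eq hφ, laplaceIntegral_eq hφ, ← integral_const_mul]
  refine integral_congr_ae ?_
  filter_upwards [Lp.coeFn_smul c g] with ξ h
  rw [h, Pi.smul_apply, smul_eq_mul]
  ring

/-- `g ↦ ∫₀^∞ φ̂(ξ) g(ξ) dξ` as a bounded functional. -/
noncomputable def laplaceIntegralL (hφ : AEMeasurable φhat (volume.restrict (Ioi (0 : ℝ)))) :
    LaplaceSpace φhat →L[ℝ] ℝ :=
  LinearMap.mkContinuous ⟨⟨laplaceIntegral φhat, laplaceIntegral_add hφ⟩, laplaceIntegral_smul hφ⟩ 1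
    fun g => by simpa using abs_laplaceIntegral_le hφ g

theorem laplaceIntegral_sum (hφ : AEMeasurable φhat (volume.restrict (Ioi (0 : ℝ)))) {ι : Type*}
    (s : Finset ι) (g : ι → LaplaceSpace φhat) :
    laplaceIntegral φhat (∑ i ∈ s, g i) = ∑ i ∈ s, laplaceIntegral φhat (g i) :=
  map_sum (laplaceIntegralL hφ) g s

theorem decay_sum (r : ℝ≥0) {ι : Type*} (s : Finset ι) (g : ι → LaplaceSpace φhat) :
    decay φhat r (∑ i ∈ s, g i) = ∑ i ∈ s, decay φhat r (g i) :=
  map_sum (decayL φhat r) g s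

theorem continuous_laplaceIntegral (hφ : AEMeasurable φhat (volume.restrict (Ioi (0 : ℝ)))) :
    Continuous (laplaceIntegral φhat) := (laplaceIntegralL hφ).continuous

/-- The reason for the weight 1+ξ: |e^{-ξr} - 1| ≤ ξr, and the kernel contributes 1/(1+ξ), so that
ξ/(1+ξ) ≤ 1 remains. Once integrated, the semigroup is Lipschitz in time at zero. -/
theorem abs_laplaceIntegral_decay_sub_le
    (hφ : AEMeasurable φhat (volume.restrict (Ioi (0 : ℝ)))) (r : ℝ≥0) (g : LaplaceSpace φhat) :
    |laplaceIntegral φhat (decay φhat r g - g)| ≤ r * ‖g‖ := by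
  rw [laplaceIntegral_eq hφ, L1.norm_eq_integral_norm, ← integral_const_mul]
  refine (abs_integral_le_integral_abs).trans (integral_mono_ae
    (integrable_laplaceKernel_mul hφ _).abs ((L1.integrable_coeFn g).norm.const_mul _) ?_)
  filter_upwards [laplaceMeasure_nonneg φhat, Lp.coeFn_sub (decay φhat r g) g, coeFn_decay r g]
    with ξ hξ h1 h2
  have hr : 0 ≤ ξ * (r : ℝ) := mul_nonneg hξ r.2
  have h3 : |Real.exp (-(ξ * r)) - 1| ≤ ξ * r := by
    rw [abs_sub_comm, abs_of_nonneg (by linarith [Real.exp_le_one_iff.2 (neg_nonpos.2 hr)])]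
    linarith [Real.add_one_le_exp (-(ξ * r))]
  have h4 := abs_laplaceKernel_le (φhat := φhat) ξ hξ
  have h5 : |laplaceKernel φhat ξ| * |Real.exp (-(ξ * r)) - 1| ≤ r := by
    calc _ ≤ 1 / (1 + ξ) * (ξ * r) := by gcongr
      _ = r * (ξ / (1 + ξ)) := by ring
      _ ≤ r * 1 := by
        gcongr
        rw [div_le_one (by linarith)]
        linarith
      _ = r := mul_one _
  simp only [h1, Pi.sub_apply, h2]
  rw [← sub_one_mul, ← mul_assoc, abs_mul, abs_mul, Real.norm_eq_abs]
  gcongr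

end Laplace

section SecondDifference

open Filter Topology

/-! ### Functions with controlled second differences -/

variable {W V : Type*} [NormedAddCommGroup W] [NormedAddCommGroup V]

/-- `f` is bounded by `C`, and its second differences are those of a function whose first two
derivatives are bounded by `C`. -/
structure HasSecondDifferenceBound (f : W → V) (C : ℝ) : Prop where
  norm_le : ∀ p, ‖f p‖ ≤ C
  second_difference : ∀ p q p' q', ‖(f p - f q) - (f p' - f q')‖ ≤
    C * ‖(p - q) - (p' - q')‖ + C * ‖p' - q'‖ * (‖p - p'‖ + ‖q - q'‖)

namespace HasSecondDifferenceBound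

variable {f : W → V} {C : ℝ}

theorem const_nonneg (hf : HasSecondDifferenceBound f C) : 0 ≤ C :=
  (norm_nonneg _).trans (hf.norm_le 0)

theorem lipschitz (hf : HasSecondDifferenceBound f C) (p q : W) : ‖f p - f q‖ ≤ C * ‖p - q‖ := by
  simpa using hf.second_difference p q q q

theorem mono (hf : HasSecondDifferenceBound f C) {C' : ℝ} (h : C ≤ C') :
    HasSecondDifferenceBound f C' := by
  refine ⟨fun p => (hf.norm_le p).trans h, fun p q p' q' => ?_⟩
  refine (hf.second_difference p q p' q').trans ?_
  gcongr

theorem pi {ι : Type*} [Fintype ι] {V : ι → Type*} [∀ i, NormedAddCommGroup (V i)]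
    {f : W → ∀ i, V i} (hf : ∀ i, HasSecondDifferenceBound (fun v => f v i) C) (hC : 0 ≤ C) :
    HasSecondDifferenceBound f C where
  norm_le p := (pi_norm_le_iff_of_nonneg hC).2 fun i => (hf i).norm_le p
  second_difference p q p' q' := (pi_norm_le_iff_of_nonneg (by positivity)).2 fun i =>
    (hf i).second_difference p q p' q'

theorem clm_pi {ι : Type*} [Fintype ι] {V : ι → Type*} [∀ i, NormedAddCommGroup (V i)]
    [∀ i, NormedSpace ℝ (V i)] {U : Type*} [NormedAddCommGroup U] [NormedSpace ℝ U]
    {f : W → ∀ i, U →L[ℝ] V i} (hf : ∀ i, HasSecondDifferenceBound (fun v => f v i) C)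
    (hC : 0 ≤ C) :
    HasSecondDifferenceBound (fun v => ContinuousLinearMap.pi (f v)) C where
  norm_le p := by
    refine ContinuousLinearMap.opNorm_le_bound _ hC fun w => ?_
    refine (pi_norm_le_iff_of_nonneg (by positivity)).2 fun i => ?_
    exact ContinuousLinearMap.le_of_opNorm_le _ ((hf i).norm_le p) w
  second_difference p q p' q' := by
    refine ContinuousLinearMap.opNorm_le_bound _ (by positivity) fun w => ?_
    refine (pi_norm_le_iff_of_nonneg (by positivity)).2 fun i => ?_
    exact ContinuousLinearMap.le_of_opNorm_le _ ((hf i).second_difference p q p' q') w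

variable [NormedSpace ℝ V]

/-- The Leibniz rule for second differences, needed for F = Dσ·σ. The products of the bounds of u
and w contain each quadratic term at most three times, hence the factor 3. -/
theorem clm_apply {U : Type*} [NormedAddCommGroup U] [NormedSpace ℝ U]
    {u : W → U →L[ℝ] V} {w : W → U} {C C' : ℝ} (hu : HasSecondDifferenceBound u C)
    (hw : HasSecondDifferenceBound w C') :
    HasSecondDifferenceBound (fun v => u v (w v)) (3 * (C * C')) where
  norm_le p := by
    have hC := hu.const_nonneg
    have hC' := hw.const_nonneg
    have h1 := (u p).le_of_opNorm_le_of_le (hu.norm_le p) (hw.norm_le p)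
    have : 0 ≤ C * C' := by positivity
    linarith
  second_difference p q p' q' := by
    have hC := hu.const_nonneg
    have hC' := hw.const_nonneg
    have hsplit : (u p (w p) - u q (w q)) - (u p' (w p') - u q' (w q')) =
        ((u p - u q) - (u p' - u q')) (w p) + (u p' - u q') (w p - w p')
          + u q ((w p - w q) - (w p' - w q')) + (u q - u q') (w p' - w q') := by
      simp only [map_sub, sub_apply]
      abel
    have h1 := ((u p - u q) - (u p' - u q')).le_of_opNorm_le_of_le
      (hu.second_difference p q p' q') (hw.norm_le p)
    have h2 := (u p' - u q').le_of_opNorm_le_of_le (hu.lipschitz p' q') (hw.lipschitz p p')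
    have h3 := (u q).le_of_opNorm_le_of_le (hu.norm_le q) (hw.second_difference p q p' q')
    have h4 := (u q - u q').le_of_opNorm_le_of_le (hu.lipschitz q q') (hw.lipschitz p' q')
    rw [hsplit]
    refine (norm_add_le _ _).trans ?_
    refine (add_le_add_left norm_add₃_le _).trans ?_
    set a := ‖(p - q) - (p' - q')‖
    set b := ‖p' - q'‖
    set c := ‖p - p'‖
    set d := ‖q - q'‖
    have e1 : 0 ≤ C * C' * a := by positivity
    have e2 : 0 ≤ C * C' * (b * c) := by positivity
    have e3 : 0 ≤ C * C' * (b * d) := by positivity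
    linarith

variable [NormedSpace ℝ W]

/-- The segments from q to p and from q' to p' are traversed simultaneously, and the mean value
inequality is applied to the difference of f along them. -/
theorem of_hasFDerivAt {f' : W → W →L[ℝ] V} (hf : ∀ v, HasFDerivAt f (f' v) v)
    (hC : ∀ v, ‖f v‖ ≤ C) (hC' : ∀ v, ‖f' v‖ ≤ C) (hlip : ∀ v w, ‖f' v - f' w‖ ≤ C * ‖v - w‖) :
    HasSecondDifferenceBound f C where
  norm_le := hC
  second_difference p q p' q' := by
    have hC0 : 0 ≤ C := (norm_nonneg _).trans (hC 0)
    have hline : ∀ (a b : W) (x : ℝ), HasDerivAt (fun t : ℝ => f (b + t • (a - b)))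
        (f' (b + x • (a - b)) (a - b)) x := by
      intro a b x
      have h1 : HasDerivAt (fun t : ℝ => b + t • (a - b)) (a - b) x := by
        simpa using ((hasDerivAt_id x).smul_const (a - b)).const_add b
      exact (hf _).comp_hasDerivAt x h1
    have key := norm_image_sub_le_of_norm_deriv_le_segment_01'
      (f := fun t : ℝ => f (q + t • (p - q)) - f (q' + t • (p' - q')))
      (f' := fun x => f' (q + x • (p - q)) (p - q) - f' (q' + x • (p' - q')) (p' - q'))
      (C := C * ‖(p - q) - (p' - q')‖ + C * ‖p' - q'‖ * (‖p - p'‖ + ‖q - q'‖))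
      (fun x _ => ((hline p q x).sub (hline p' q' x)).hasDerivWithinAt) (fun x hx => ?_)
    · simp only [one_smul, zero_smul, add_zero, add_sub_cancel] at key
      have e : (f p - f q) - (f p' - f q') = (f p - f p') - (f q - f q') := by abel
      rw [e]
      exact key
    · have hsplit : f' (q + x • (p - q)) (p - q) - f' (q' + x • (p' - q')) (p' - q') =
          f' (q + x • (p - q)) ((p - q) - (p' - q'))
            + (f' (q + x • (p - q)) - f' (q' + x • (p' - q'))) (p' - q') := by
        simp only [map_sub, sub_apply]
        abel
      rw [hsplit]
      refine (norm_add_le _ _).trans (add_le_add ?_ ?_)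
      · exact ContinuousLinearMap.le_of_opNorm_le _ (hC' _) _
      · refine (ContinuousLinearMap.le_of_opNorm_le _ (hlip _ _) _).trans ?_
        have e : (q + x • (p - q)) - (q' + x • (p' - q')) =
            x • (p - p') + (1 - x) • (q - q') := by module
        rw [e]
        have h1 : ‖x • (p - p') + (1 - x) • (q - q')‖ ≤ ‖p - p'‖ + ‖q - q'‖ := by
          refine (norm_add_le _ _).trans ?_
          rw [norm_smul, norm_smul, Real.norm_of_nonneg hx.1,
            Real.norm_of_nonneg (by linarith [hx.2] : 0 ≤ 1 - x)]
          exact add_le_add (mul_le_of_le_one_left (norm_nonneg _) hx.2.le)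
            (mul_le_of_le_one_left (norm_nonneg _) (by linarith [hx.1]))
        calc C * ‖x • (p - p') + (1 - x) • (q - q')‖ * ‖p' - q'‖
            ≤ C * (‖p - p'‖ + ‖q - q'‖) * ‖p' - q'‖ := by gcongr
          _ = _ := by ring

/-- Two bounded derivatives suffice. Applied to both σ and Dσ, this uses the derivatives of σ up to
order three. -/
theorem of_contDiff (hf : ContDiff ℝ 2 f)
    (hb : ∀ m : ℕ, m ≤ 2 → ∃ C : ℝ, ∀ v, ‖iteratedFDeriv ℝ m f v‖ ≤ C) :
    ∃ C, HasSecondDifferenceBound f C := by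
  obtain ⟨C₀, h0⟩ := hb 0 (by norm_num)
  obtain ⟨C₁, h1⟩ := hb 1 (by norm_num)
  obtain ⟨C₂, h2⟩ := hb 2 le_rfl
  have hd : Differentiable ℝ f := hf.differentiable (by norm_num)
  have hf' : ContDiff ℝ 1 (fderiv ℝ f) := hf.fderiv_right (by norm_num)
  have hd' : Differentiable ℝ (fderiv ℝ f) := hf'.differentiable (by norm_num)
  refine ⟨max C₀ (max C₁ C₂), of_hasFDerivAt (f' := fderiv ℝ f)
    (fun v => (hd v).hasFDerivAt) (fun v => ?_) (fun v => ?_) (fun v w => ?_)⟩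
  · exact (by simpa using h0 v : ‖f v‖ ≤ C₀).trans (le_max_left _ _)
  · have := h1 v
    rw [norm_iteratedFDeriv_one] at this
    exact this.trans ((le_max_left _ _).trans (le_max_right _ _))
  · refine convex_univ.norm_image_sub_le_of_norm_fderiv_le (fun x _ => hd' x) (fun x _ => ?_)
      (mem_univ w) (mem_univ v)
    have := h2 x
    rw [← norm_iteratedFDeriv_fderiv, norm_iteratedFDeriv_one] at this
    exact this.trans ((le_max_right _ _).trans (le_max_right _ _))

/-- The first-order Taylor remainder of `f` in the direction `p`, perturbed by `r`, is Lipschitz in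
all its arguments. -/
theorem taylor_sub_le {f' : W → W →L[ℝ] V} (hf : HasSecondDifferenceBound f C)
    (hder : ∀ v, HasFDerivAt f (f' v) v) (hf' : HasSecondDifferenceBound f' C)
    (v v' p p' r r' : W) :
    ‖(f (v + (p + r)) - f v - f' v p) - (f (v' + (p' + r')) - f v' - f' v' p')‖ ≤
      C * (‖r - r'‖ + ‖r'‖ * (2 * ‖v - v'‖ + 2 * ‖p - p'‖ + ‖r - r'‖))
        + C * (‖p‖ * ‖p - p'‖
          + (‖p - p'‖ + ‖p'‖ * (2 * ‖v - v'‖ + ‖p - p'‖)) * ‖p'‖) := by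
  have hC := hf.const_nonneg
  -- The effect of r is a second difference of f. The Taylor remainder in the direction p is then
  -- treated by differentiating along t ↦ v + t p, which brings in second differences of f'.
  have hsplit : (f (v + (p + r)) - f v - f' v p) - (f (v' + (p' + r')) - f v' - f' v' p') =
      ((f (v + (p + r)) - f (v + p)) - (f (v' + (p' + r')) - f (v' + p')))
      + ((f (v + p) - f' v p - (f (v' + p') - f' v' p')) - (f v - f v')) := by abel
  rw [hsplit]
  refine (norm_add_le _ _).trans (add_le_add ?_ ?_)
  · refine (hf.second_difference _ _ _ _).trans ?_
    have e1 : v + (p + r) - (v + p) = r := by abel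
    have e2 : v' + (p' + r') - (v' + p') = r' := by abel
    have e3 : v + (p + r) - (v' + (p' + r')) = (v - v') + (p - p') + (r - r') := by abel
    have e4 : v + p - (v' + p') = (v - v') + (p - p') := by abel
    rw [e1, e2, e3, e4, mul_assoc, ← mul_add]
    have h1 := norm_add₃_le (a := v - v') (b := p - p') (c := r - r')
    have h2 := norm_add_le (v - v') (p - p')
    exact mul_le_mul_of_nonneg_left (add_le_add le_rfl
      (mul_le_mul_of_nonneg_left (by linarith) (norm_nonneg _))) hC
  · have hline : ∀ (v p : W) (x : ℝ), HasDerivAt (fun t : ℝ => f (v + t • p) - t • f' v p)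
        (f' (v + x • p) p - f' v p) x := by
      intro v p x
      have h1 : HasDerivAt (fun t : ℝ => v + t • p) p x := by
        simpa using ((hasDerivAt_id x).smul_const p).const_add v
      have h2 : HasDerivAt (fun t : ℝ => t • f' v p) (f' v p) x := by
        simpa using (hasDerivAt_id x).smul_const (f' v p)
      exact ((hder _).comp_hasDerivAt x h1).sub h2
    have key := norm_image_sub_le_of_norm_deriv_le_segment_01'
      (f := fun t : ℝ => (f (v + t • p) - t • f' v p) - (f (v' + t • p') - t • f' v' p'))
      (f' := fun x => (f' (v + x • p) p - f' v p) - (f' (v' + x • p') p' - f' v' p'))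
      (C := C * (‖p‖ * ‖p - p'‖
          + (‖p - p'‖ + ‖p'‖ * (2 * ‖v - v'‖ + ‖p - p'‖)) * ‖p'‖))
      (fun x _ => ((hline v p x).sub (hline v' p' x)).hasDerivWithinAt) (fun x hx => ?_)
    · simpa using key
    · have hs : (f' (v + x • p) p - f' v p) - (f' (v' + x • p') p' - f' v' p') =
          (f' (v + x • p) - f' v) (p - p')
            + ((f' (v + x • p) - f' v) - (f' (v' + x • p') - f' v')) p' := by
        simp only [map_sub, sub_apply]
        abel
      have hx1 : ∀ w : W, ‖x • w‖ ≤ ‖w‖ := by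
        intro w
        rw [norm_smul, Real.norm_of_nonneg hx.1]
        exact mul_le_of_le_one_left (norm_nonneg _) hx.2.le
      have h1 : ‖f' (v + x • p) - f' v‖ ≤ C * ‖p‖ := by
        refine (hf'.lipschitz _ _).trans ?_
        rw [add_sub_cancel_left]
        gcongr
        exact hx1 p
      have h2 : ‖(f' (v + x • p) - f' v) - (f' (v' + x • p') - f' v')‖ ≤
          C * (‖p - p'‖ + ‖p'‖ * (2 * ‖v - v'‖ + ‖p - p'‖)) := by
        refine (hf'.second_difference _ _ _ _).trans ?_
        have e3 : v + x • p - (v' + x • p') = (v - v') + x • (p - p') := by module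
        rw [add_sub_cancel_left, add_sub_cancel_left, e3, ← smul_sub, mul_assoc, ← mul_add]
        have h3 := norm_add_le (v - v') (x • (p - p'))
        have h4 := hx1 (p - p')
        have h5 := hx1 p'
        exact mul_le_mul_of_nonneg_left (add_le_add h4
          (mul_le_mul h5 (by linarith) (by positivity) (norm_nonneg _))) hC
      rw [hs]
      refine (norm_add_le _ _).trans ?_
      have h3 := (f' (v + x • p) - f' v).le_of_opNorm_le h1 (p - p')
      have h4 := ((f' (v + x • p) - f' v) - (f' (v' + x • p') - f' v')).le_of_opNorm_le h2 p'
      linarith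

theorem taylor_le {f' : W → W →L[ℝ] V} (hf : HasSecondDifferenceBound f C)
    (hder : ∀ v, HasFDerivAt f (f' v) v) (hf' : HasSecondDifferenceBound f' C)
    (v p r : W) :
    ‖f (v + (p + r)) - f v - f' v p‖ ≤ C * ‖r‖ + C * (‖p‖ * ‖p‖) := by
  simpa using hf.taylor_sub_le hder hf' v v p 0 r 0

end HasSecondDifferenceBound

end SecondDifference

section RoughField

open Filter Topology

/-! ### The almost flow of a rough convolution equation -/

variable {E W V₁ V₂ : Type*} [NormedAddCommGroup E] [NormedSpace ℝ E]
  [NormedAddCommGroup W] [NormedSpace ℝ W] [NormedAddCommGroup V₁] [NormedSpace ℝ V₁]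
  [NormedAddCommGroup V₂] [NormedSpace ℝ V₂]

/-- A level-two rough driver `(P, Q)` twisted by the contraction semigroup `S`, and a vector field
`f` with `F = f' · f`, composed with the observation `I`. -/
structure IsRoughField (T γ K C : ℝ) (S : ℝ≥0 → E →ₗ[ℝ] E) (I : E →ₗ[ℝ] W)
    (P : ℝ → ℝ → V₁ →ₗ[ℝ] E) (Q : ℝ → ℝ → V₂ →ₗ[ℝ] E) (R : ℝ → ℝ → ℝ → V₂ →ₗ[ℝ] E)
    (f : W → V₁) (f' : W → W →L[ℝ] V₁) (F : W → V₂) : Prop where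
  const_nonneg : 0 ≤ K
  norm_semigroup_le : ∀ r e, ‖S r e‖ ≤ ‖e‖
  semigroup_add : ∀ r r' e, S (r + r') e = S r (S r' e)
  continuous_semigroup : ∀ e, Continuous fun r => S r e
  norm_observation_le : ∀ e, ‖I e‖ ≤ ‖e‖
  norm_observation_semigroup_sub_le : ∀ (r : ℝ≥0) e, ‖I (S r e - e)‖ ≤ r * ‖e‖
  norm_first_le : ∀ s t : ℝ, 0 ≤ s → s ≤ t → t ≤ T → ∀ c, ‖P t s c‖ ≤ K * (t - s) ^ γ * ‖c‖
  norm_second_le : ∀ s t : ℝ, 0 ≤ s → s ≤ t → t ≤ T → ∀ c,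
    ‖Q t s c‖ ≤ K * ((t - s) ^ γ) ^ 2 * ‖c‖
  norm_third_le : ∀ s u t : ℝ, 0 ≤ s → s ≤ u → u ≤ t → t ≤ T → ∀ c,
    ‖R t u s c‖ ≤ K * ((t - s) ^ γ) ^ 3 * ‖c‖
  first_add : ∀ s u t : ℝ, 0 ≤ s → s ≤ u → u ≤ t → t ≤ T → ∀ c,
    P t s c = P t u c + S (t - u).toNNReal (P u s c)
  second_add : ∀ s u t : ℝ, 0 ≤ s → s ≤ u → u ≤ t → t ≤ T → ∀ v,
    Q t s (F v) = Q t u (F v) + S (t - u).toNNReal (Q u s (F v))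
      + P t u (f' v (I (P u s (f v)))) + R t u s (F v)
  continuousOn_first : ∀ s : ℝ, 0 ≤ s → ∀ c, ContinuousOn (fun t => P t s c) (Icc s T)
  continuousOn_second : ∀ s : ℝ, 0 ≤ s → ∀ c, ContinuousOn (fun t => Q t s c) (Icc s T)
  hasFDerivAt : ∀ v, HasFDerivAt f (f' v) v
  bound_field : HasSecondDifferenceBound f C
  bound_deriv : HasSecondDifferenceBound f' C
  bound_second : HasSecondDifferenceBound F C

/-- One step of the second-order scheme for a rough convolution equation. -/
def roughStep (S : ℝ≥0 → E →ₗ[ℝ] E) (I : E →ₗ[ℝ] W)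
    (P : ℝ → ℝ → V₁ →ₗ[ℝ] E) (Q : ℝ → ℝ → V₂ →ₗ[ℝ] E)
    (f : W → V₁) (F : W → V₂) (a : W) (t s : ℝ) (e : E) : E :=
  S (t - s).toNNReal e + (P t s (f (a + I e)) + Q t s (F (a + I e)))

/-- A product of order x^{1+γ} + x^{3γ} is absorbed into x^α on [0, T], where both exponents are at
least α. -/
theorem exists_power_bound {T γ α : ℝ} (hT : 0 ≤ T) (hγ : 0 < γ) (hα : 0 < α)
    (h1 : α ≤ 1 + γ) (h3 : α ≤ 3 * γ) :
    ∃ M : ℝ, 1 ≤ M ∧ ∀ x : ℝ, 0 ≤ x → x ≤ T → x ^ γ ≤ M ∧ x + (x ^ γ) ^ 2 ≤ M ∧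
      x ^ γ * (x + (x ^ γ) ^ 2) ≤ M * x ^ α := by
  refine ⟨1 + T ^ γ + (T + (T ^ γ) ^ 2) + (T ^ (1 + γ - α) + T ^ (3 * γ - α)), ?_, ?_⟩
  · have : 0 ≤ T ^ γ + (T + (T ^ γ) ^ 2) + (T ^ (1 + γ - α) + T ^ (3 * γ - α)) := by positivity
    linarith
  · intro x hx hxT
    have e1 : x ^ γ ≤ T ^ γ := by gcongr
    have e2 : (x ^ γ) ^ 2 ≤ (T ^ γ) ^ 2 := by gcongr
    have p1 : 0 ≤ T ^ γ := by positivity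
    have p2 : 0 ≤ (T ^ γ) ^ 2 := by positivity
    have p3 : 0 ≤ T ^ (1 + γ - α) := by positivity
    have p4 : 0 ≤ T ^ (3 * γ - α) := by positivity
    refine ⟨by linarith, by linarith, ?_⟩
    rcases hx.eq_or_lt with rfl | hx0
    · simp [Real.zero_rpow hγ.ne', Real.zero_rpow hα.ne']
    have f1 : x ^ γ * x = x ^ (1 + γ - α) * x ^ α := by
      rw [← Real.rpow_add hx0, sub_add_cancel, add_comm, Real.rpow_add_one hx0.ne']
    have f2 : x ^ γ * (x ^ γ) ^ 2 = x ^ (3 * γ - α) * x ^ α := by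
      rw [← Real.rpow_add hx0, sub_add_cancel, mul_comm 3 γ, Real.rpow_mul hx]
      norm_cast
      ring
    rw [mul_add, f1, f2, ← add_mul]
    have g1 : x ^ (1 + γ - α) ≤ T ^ (1 + γ - α) :=
      Real.rpow_le_rpow hx hxT (by linarith)
    have g2 : x ^ (3 * γ - α) ≤ T ^ (3 * γ - α) :=
      Real.rpow_le_rpow hx hxT (by linarith)
    exact mul_le_mul_of_nonneg_right (by linarith) (by positivity)

/-! ### Consistency of the second-order step -/

namespace IsRoughField

variable {T γ K C : ℝ} {S : ℝ≥0 → E →ₗ[ℝ] E} {I : E →ₗ[ℝ] W}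
  {P : ℝ → ℝ → V₁ →ₗ[ℝ] E} {Q : ℝ → ℝ → V₂ →ₗ[ℝ] E} {R : ℝ → ℝ → ℝ → V₂ →ₗ[ℝ] E}
  {f : W → V₁} {f' : W → W →L[ℝ] V₁} {F : W → V₂}

/-- The algebraic relations for P and Q cancel every term of low order. In the argument of f, the
increment of the observed state splits into the rough part p = I P f and the remainder r, made of
I(S - 1)e and I Q F. -/
theorem comp_sub_eq (H : IsRoughField T γ K C S I P Q R f f' F) (a : W) {s u t : ℝ}
    (hs : 0 ≤ s) (hsu : s ≤ u) (hut : u ≤ t) (htT : t ≤ T) (e : E) :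
    roughStep S I P Q f F a t u (roughStep S I P Q f F a u s e) - roughStep S I P Q f F a t s e =
      P t u (f ((a + I e) + (I (P u s (f (a + I e))) +
          (I (S (u - s).toNNReal e - e) + I (Q u s (F (a + I e)))))) - f (a + I e)
          - f' (a + I e) (I (P u s (f (a + I e)))))
        + Q t u (F ((a + I e) + (I (P u s (f (a + I e))) +
          (I (S (u - s).toNNReal e - e) + I (Q u s (F (a + I e)))))) - F (a + I e))
        - R t u s (F (a + I e)) := by
  have hS : (t - s).toNNReal = (t - u).toNNReal + (u - s).toNNReal := by
    rw [← Real.toNNReal_add (by linarith) (by linarith)]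
    congr 1; ring
  have hI : a + I (roughStep S I P Q f F a u s e) =
      (a + I e) + (I (P u s (f (a + I e))) +
          (I (S (u - s).toNNReal e - e) + I (Q u s (F (a + I e))))) := by
    simp only [roughStep, map_add, map_sub]
    abel
  rw [roughStep, hI]
  generalize (a + I e) + (I (P u s (f (a + I e))) +
          (I (S (u - s).toNNReal e - e) + I (Q u s (F (a + I e))))) = w
  simp only [roughStep]
  rw [H.first_add s u t hs hsu hut htT (f (a + I e)), H.second_add s u t hs hsu hut htT (a + I e),
    hS, H.semigroup_add]
  simp only [map_add, map_sub]
  abel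

/-- Sizes and Lipschitz constants of p and r. The linear growth in ‖e‖ comes from the semigroup part
of r alone, and it is the origin of the factors 1+‖e‖ in `AlmostFlow`. -/
theorem bounds (H : IsRoughField T γ K C S I P Q R f f' F) (hγ : 0 < γ) (a : W) {s u t : ℝ}
    (hs : 0 ≤ s) (hsu : s ≤ u) (hut : u ≤ t) (htT : t ≤ T) (e e' : E) :
    ‖I (P u s (f (a + I e)))‖ ≤ K * C * (t - s) ^ γ ∧
    ‖I (P u s (f (a + I e))) - I (P u s (f (a + I e')))‖ ≤ K * C * (t - s) ^ γ * ‖e - e'‖ ∧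
    ‖I (S (u - s).toNNReal e - e) + I (Q u s (F (a + I e)))‖ ≤
      (1 + K * C) * (1 + ‖e‖) * ((t - s) + ((t - s) ^ γ) ^ 2) ∧
    ‖(I (S (u - s).toNNReal e - e) + I (Q u s (F (a + I e))))
      - (I (S (u - s).toNNReal e' - e') + I (Q u s (F (a + I e'))))‖ ≤
      (1 + K * C) * ((t - s) + ((t - s) ^ γ) ^ 2) * ‖e - e'‖ := by
  have hK := H.const_nonneg
  have hC := H.bound_field.const_nonneg
  have huT : u ≤ T := hut.trans htT
  have hy : 0 ≤ u - s := by linarith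
  have hx : 0 ≤ t - s := by linarith
  have hq : (u - s) ^ γ ≤ (t - s) ^ γ := Real.rpow_le_rpow hy (by linarith) hγ.le
  have hq0 : 0 ≤ (u - s) ^ γ := by positivity
  have hv : ‖(a + I e) - (a + I e')‖ ≤ ‖e - e'‖ := by
    rw [add_sub_add_left_eq_sub, ← map_sub]
    exact H.norm_observation_le _
  have hr : (((u - s).toNNReal : ℝ≥0) : ℝ) ≤ t - s := by
    rw [Real.coe_toNNReal _ hy]; linarith
  refine ⟨?_, ?_, ?_, ?_⟩
  · calc _ ≤ K * (u - s) ^ γ * ‖f (a + I e)‖ :=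
          (H.norm_observation_le _).trans (H.norm_first_le s u hs hsu huT _)
      _ ≤ K * (t - s) ^ γ * C := by
          have := H.bound_field.norm_le (a + I e)
          gcongr
      _ = _ := by ring
  · rw [← map_sub, ← map_sub]
    calc _ ≤ K * (u - s) ^ γ * ‖f (a + I e) - f (a + I e')‖ :=
          (H.norm_observation_le _).trans (H.norm_first_le s u hs hsu huT _)
      _ ≤ K * (t - s) ^ γ * (C * ‖e - e'‖) := by
          have := H.bound_field.lipschitz (a + I e) (a + I e')
          gcongr
          exact this.trans (by gcongr)
      _ = _ := by ring
  · have h1 : ‖I (S (u - s).toNNReal e - e)‖ ≤ (t - s) * ‖e‖ :=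
      (H.norm_observation_semigroup_sub_le _ _).trans (by gcongr)
    have h2 : ‖I (Q u s (F (a + I e)))‖ ≤ K * ((t - s) ^ γ) ^ 2 * C := by
      refine ((H.norm_observation_le _).trans (H.norm_second_le s u hs hsu huT _)).trans ?_
      have := H.bound_second.norm_le (a + I e)
      gcongr
    refine (norm_add_le _ _).trans ?_
    have e1 : 0 ≤ ((t - s) ^ γ) ^ 2 := by positivity
    have e2 : 0 ≤ K * C := by positivity
    have e3 : 0 ≤ ‖e‖ := norm_nonneg _
    have e4 : 0 ≤ K * C * (1 + ‖e‖) * (t - s) := by positivity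
    have e5 : 0 ≤ (1 + ‖e‖) * ((t - s) ^ γ) ^ 2 := by positivity
    have e6 : 0 ≤ K * C * ‖e‖ * ((t - s) ^ γ) ^ 2 := by positivity
    linarith
  · have h1 : ‖I (S (u - s).toNNReal (e - e') - (e - e'))‖ ≤ (t - s) * ‖e - e'‖ :=
      (H.norm_observation_semigroup_sub_le _ _).trans (by gcongr)
    have h2 : ‖I (Q u s (F (a + I e) - F (a + I e')))‖ ≤
        K * ((t - s) ^ γ) ^ 2 * (C * ‖e - e'‖) := by
      refine ((H.norm_observation_le _).trans (H.norm_second_le s u hs hsu huT _)).trans ?_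
      have := H.bound_second.lipschitz (a + I e) (a + I e')
      gcongr
      exact this.trans (by gcongr)
    have hsplit : (I (S (u - s).toNNReal e - e) + I (Q u s (F (a + I e))))
        - (I (S (u - s).toNNReal e' - e') + I (Q u s (F (a + I e')))) =
        I (S (u - s).toNNReal (e - e') - (e - e')) + I (Q u s (F (a + I e) - F (a + I e'))) := by
      simp only [map_sub]
      abel
    rw [hsplit]
    refine (norm_add_le _ _).trans ?_
    have e1 : 0 ≤ ((t - s) ^ γ) ^ 2 * ‖e - e'‖ := by positivity
    have e2 : 0 ≤ K * C * (t - s) * ‖e - e'‖ := by positivity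
    linarith

-- Lipschitz form of the consistency estimate. Each of the three terms of `comp_sub_eq` is compared
-- at e and e'; they contribute 11, 10 and 1 to the constant 22.
set_option maxHeartbeats 1000000 in
theorem comp_sub_sub_le (H : IsRoughField T γ K C S I P Q R f f' F) (hγ : 0 < γ) (a : W) {M : ℝ}
    (hM : 1 ≤ M) {s u t : ℝ} (hs : 0 ≤ s) (hsu : s ≤ u) (hut : u ≤ t) (htT : t ≤ T)
    (hqM : (t - s) ^ γ ≤ M) (hyM : (t - s) + ((t - s) ^ γ) ^ 2 ≤ M) (e e' : E) :
    ‖(roughStep S I P Q f F a t u (roughStep S I P Q f F a u s e) - roughStep S I P Q f F a t s e)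
      - (roughStep S I P Q f F a t u (roughStep S I P Q f F a u s e')
        - roughStep S I P Q f F a t s e')‖ ≤
      22 * (K * C * (1 + K * C) ^ 3 * M ^ 2) * (1 + ‖e'‖) * ‖e - e'‖
        * ((t - s) ^ γ * ((t - s) + ((t - s) ^ γ) ^ 2)) := by
  have hK := H.const_nonneg
  have hC := H.bound_field.const_nonneg
  obtain ⟨hp, hpp, -, hrr⟩ := H.bounds hγ a hs hsu hut htT e e'
  obtain ⟨hp', -, hr', -⟩ := H.bounds hγ a hs hsu hut htT e' e
  rw [H.comp_sub_eq a hs hsu hut htT, H.comp_sub_eq a hs hsu hut htT]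
  -- From here on only the sizes of v-v', p, r and of their differences matter, so the expressions
  -- themselves are generalised away.
  have hv : ‖(a + I e) - (a + I e')‖ ≤ ‖e - e'‖ := by
    rw [add_sub_add_left_eq_sub, ← map_sub]
    exact H.norm_observation_le _
  generalize a + I e = v at *
  generalize a + I e' = v' at *
  generalize I (P u s (f v)) = p at *
  generalize I (P u s (f v')) = p' at *
  generalize I (S (u - s).toNNReal e - e) + I (Q u s (F v)) = r at *
  generalize I (S (u - s).toNNReal e' - e') + I (Q u s (F v')) = r' at *
  have hx : 0 ≤ t - s := by linarith
  have hqq : (t - u) ^ γ ≤ (t - s) ^ γ := Real.rpow_le_rpow (by linarith) (by linarith) hγ.le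
  have hqu : 0 ≤ (t - u) ^ γ := Real.rpow_nonneg (by linarith) _
  have h1 := H.norm_first_le u t (by linarith) hut htT
    ((f (v + (p + r)) - f v - f' v p) - (f (v' + (p' + r')) - f v' - f' v' p'))
  have h2 := H.norm_second_le u t (by linarith) hut htT
    ((F (v + (p + r)) - F v) - (F (v' + (p' + r')) - F v'))
  have h3 := H.norm_third_le s u t hs hsu hut htT (F v - F v')
  have h4 := H.bound_field.taylor_sub_le H.hasFDerivAt H.bound_deriv v v' p p' r r'
  have h5 := H.bound_second.second_difference (v + (p + r)) v (v' + (p' + r')) v'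
  have h6 := H.bound_second.lipschitz v v'
  set q := (t - s) ^ γ with hq
  have hq0 : 0 ≤ q := Real.rpow_nonneg hx _
  set y := (t - s) + q ^ 2 with hy
  have hq2 : q ^ 2 ≤ y := by linarith
  have hy0 : 0 ≤ y := by positivity
  set D := 1 + K * C with hD
  have hKC : 0 ≤ K * C := by positivity
  have hD1 : 1 ≤ D := by linarith
  set ε := ‖e - e'‖
  have hε : 0 ≤ ε := norm_nonneg _
  set n := 1 + ‖e'‖ with hn
  have hn1 : 1 ≤ n := by linarith [norm_nonneg e']
  have b1 : ‖p‖ ≤ D * q := hp.trans (by gcongr; linarith)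
  have b2 : ‖p'‖ ≤ D * q := hp'.trans (by gcongr; linarith)
  have b3 : ‖p - p'‖ ≤ D * q * ε := hpp.trans (by gcongr; linarith)
  have b3' : ‖p - p'‖ ≤ D * M * ε := b3.trans (by gcongr)
  have b4' : ‖r - r'‖ ≤ D * M * ε := hrr.trans (by gcongr)
  have hDM : 1 ≤ D * M := one_le_mul_of_one_le_of_one_le hD1 hM
  have t1 : ‖(f (v + (p + r)) - f v - f' v p) - (f (v' + (p' + r')) - f v' - f' v' p')‖ ≤
      11 * (C * D ^ 3 * M) * (n * ε * y) := by
    refine h4.trans ?_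
    have c1 : 2 * ‖v - v'‖ + 2 * ‖p - p'‖ + ‖r - r'‖ ≤ 5 * (D * M) * ε := by
      have : 1 * ε ≤ D * M * ε := by gcongr
      linarith
    have c2 : 2 * ‖v - v'‖ + ‖p - p'‖ ≤ 3 * (D * M) * ε := by
      have : 1 * ε ≤ D * M * ε := by gcongr
      linarith
    have d1 : ‖r - r'‖ + ‖r'‖ * (2 * ‖v - v'‖ + 2 * ‖p - p'‖ + ‖r - r'‖) ≤
        D * y * ε + D * n * y * (5 * (D * M) * ε) := by gcongr
    have d2 : ‖p‖ * ‖p - p'‖ + (‖p - p'‖ + ‖p'‖ * (2 * ‖v - v'‖ + ‖p - p'‖)) * ‖p'‖ ≤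
        D * q * (D * q * ε) + (D * q * ε + D * q * (3 * (D * M) * ε)) * (D * q) := by gcongr
    have e0 : 0 ≤ ε * y := by positivity
    have hD3M : D ≤ D ^ 3 * M := by
      calc D = D ^ 1 * 1 := by ring
        _ ≤ D ^ 3 * M := by gcongr; norm_num
    have hD3M' : D ^ 2 * M ≤ D ^ 3 * M := by gcongr; norm_num
    have hD3M'' : D ^ 2 ≤ D ^ 3 * M := by
      calc D ^ 2 = D ^ 2 * 1 := by ring
        _ ≤ D ^ 3 * M := by gcongr; norm_num
    have e1 : D * y * ε ≤ (D ^ 3 * M) * (n * ε * y) := by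
      calc D * y * ε = D * (1 * ε * y) := by ring
        _ ≤ _ := by gcongr
    have e2 : D * n * y * (5 * (D * M) * ε) ≤ 5 * (D ^ 3 * M) * (n * ε * y) := by
      calc D * n * y * (5 * (D * M) * ε) = 5 * (D ^ 2 * M) * (n * ε * y) := by ring
        _ ≤ _ := by gcongr
    have e3 : D * q * (D * q * ε) + (D * q * ε + D * q * (3 * (D * M) * ε)) * (D * q) ≤
        5 * (D ^ 3 * M) * (n * ε * y) := by
      calc _ = (2 * D ^ 2 + 3 * (D ^ 3 * M)) * (1 * ε * q ^ 2) := by ring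
        _ ≤ (2 * (D ^ 3 * M) + 3 * (D ^ 3 * M)) * (n * ε * y) := by gcongr
        _ = _ := by ring
    calc _ ≤ C * ((D ^ 3 * M) * (n * ε * y) + 5 * (D ^ 3 * M) * (n * ε * y))
        + C * (5 * (D ^ 3 * M) * (n * ε * y)) :=
          add_le_add (mul_le_mul_of_nonneg_left (d1.trans (add_le_add e1 e2)) hC)
            (mul_le_mul_of_nonneg_left (d2.trans e3) hC)
      _ = _ := by ring
  have t2 : q * ‖(F (v + (p + r)) - F v) - (F (v' + (p' + r')) - F v')‖ ≤
      10 * (C * D ^ 3 * M ^ 2) * (n * ε * y) := by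
    have i1 : v + (p + r) - v = p + r := by abel
    have i2 : v' + (p' + r') - v' = p' + r' := by abel
    have i3 : v + (p + r) - (v' + (p' + r')) = (v - v') + ((p - p') + (r - r')) := by abel
    have i4 : (p + r) - (p' + r') = (p - p') + (r - r') := by abel
    rw [i1, i2, i3, i4] at h5
    have c1 : ‖(p - p') + (r - r')‖ ≤ D * q * ε + D * y * ε :=
      (norm_add_le _ _).trans (add_le_add b3 hrr)
    have c2 : ‖p' + r'‖ ≤ D * q + D * n * y := (norm_add_le _ _).trans (add_le_add b2 hr')
    have c3 : ‖(v - v') + ((p - p') + (r - r'))‖ + ‖v - v'‖ ≤ 4 * (D * M) * ε := by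
      have k1 := norm_add_le (v - v') ((p - p') + (r - r'))
      have k2 := norm_add_le (p - p') (r - r')
      have : 1 * ε ≤ D * M * ε := by gcongr
      linarith
    have hM2 : M ≤ M ^ 2 := by
      calc M = M ^ 1 := by ring
        _ ≤ M ^ 2 := by gcongr; norm_num
    have hD3 : D ≤ D ^ 3 := by
      calc D = D ^ 1 := by ring
        _ ≤ D ^ 3 := by gcongr; norm_num
    have e1 : q * (D * q * ε + D * y * ε) ≤ 2 * (D ^ 3 * M ^ 2) * (n * ε * y) := by
      calc q * (D * q * ε + D * y * ε) = D * 1 * (1 * ε * q ^ 2) + D * q * (1 * ε * y) := by ring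
        _ ≤ D ^ 3 * M ^ 2 * (n * ε * y) + D ^ 3 * M ^ 2 * (n * ε * y) := by
          gcongr
          · exact hM.trans hM2
          · exact hqM.trans hM2
        _ = _ := by ring
    have e2 : q * (D * q + D * n * y) ≤ 2 * (D * M) * (n * y) := by
      calc q * (D * q + D * n * y) = D * 1 * (1 * q ^ 2) + D * q * (n * y) := by ring
        _ ≤ D * M * (n * y) + D * M * (n * y) := by gcongr
        _ = _ := by ring
    calc _ ≤ q * (C * (D * q * ε + D * y * ε)
          + C * (D * q + D * n * y) * (4 * (D * M) * ε)) := by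
          gcongr
          exact h5.trans (by gcongr)
      _ = C * (q * (D * q * ε + D * y * ε))
          + C * (q * (D * q + D * n * y)) * (4 * (D * M) * ε) := by ring
      _ ≤ C * (2 * (D ^ 3 * M ^ 2) * (n * ε * y))
          + C * (2 * (D * M) * (n * y)) * (4 * (D * M) * ε) := by gcongr
      _ = 2 * (C * D ^ 3 * M ^ 2) * (n * ε * y) + 8 * (C * D ^ 2 * M ^ 2) * (n * ε * y) := by ring
      _ ≤ 2 * (C * D ^ 3 * M ^ 2) * (n * ε * y) + 8 * (C * D ^ 3 * M ^ 2) * (n * ε * y) := by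
          gcongr
          norm_num
      _ = _ := by ring
  have hsplit : (P t u (f (v + (p + r)) - f v - f' v p) + Q t u (F (v + (p + r)) - F v)
        - R t u s (F v))
      - (P t u (f (v' + (p' + r')) - f v' - f' v' p') + Q t u (F (v' + (p' + r')) - F v')
        - R t u s (F v')) =
      P t u ((f (v + (p + r)) - f v - f' v p) - (f (v' + (p' + r')) - f v' - f' v' p'))
        + Q t u ((F (v + (p + r)) - F v) - (F (v' + (p' + r')) - F v'))
        + -(R t u s (F v - F v')) := by
    simp only [map_sub]
    abel
  rw [hsplit]
  refine norm_add₃_le.trans ?_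
  rw [norm_neg]
  have g1 := h1.trans (show _ ≤ K * q * (11 * (C * D ^ 3 * M) * (n * ε * y)) by gcongr)
  have g2 : K * ((t - u) ^ γ) ^ 2 *
      ‖(F (v + (p + r)) - F v) - (F (v' + (p' + r')) - F v')‖ ≤
      K * q * (10 * (C * D ^ 3 * M ^ 2) * (n * ε * y)) := by
    calc _ ≤ K * q ^ 2 * ‖(F (v + (p + r)) - F v) - (F (v' + (p' + r')) - F v')‖ := by gcongr
      _ = K * q * (q * ‖(F (v + (p + r)) - F v) - (F (v' + (p' + r')) - F v')‖) := by ring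
      _ ≤ _ := by gcongr
  have g3 : K * q ^ 3 * ‖F v - F v'‖ ≤ K * q * ((C * D ^ 3 * M ^ 2) * (n * ε * y)) := by
    calc K * q ^ 3 * ‖F v - F v'‖ ≤ K * q ^ 3 * (C * ε) := by
          gcongr
          exact h6.trans (by gcongr)
      _ = K * q * ((C * 1 ^ 3 * 1 ^ 2) * (1 * ε * q ^ 2)) := by ring
      _ ≤ _ := by gcongr
  have g4 : K * q * (11 * (C * D ^ 3 * M) * (n * ε * y)) ≤
      K * q * (11 * (C * D ^ 3 * M ^ 2) * (n * ε * y)) := by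
    have hM2 : M ≤ M ^ 2 := by
      calc M = M ^ 1 := by ring
        _ ≤ M ^ 2 := by gcongr; norm_num
    gcongr
  calc _ ≤ K * q * (11 * (C * D ^ 3 * M ^ 2) * (n * ε * y))
        + K * q * (10 * (C * D ^ 3 * M ^ 2) * (n * ε * y))
        + K * q * ((C * D ^ 3 * M ^ 2) * (n * ε * y)) :=
        add_le_add (add_le_add (g1.trans g4) (h2.trans g2)) (h3.trans g3)
    _ = _ := by ring

/-- The same three terms at a single point, contributing 2, 2 and 1 to the constant 5. -/
theorem comp_sub_le (H : IsRoughField T γ K C S I P Q R f f' F) (hγ : 0 < γ) (a : W) {M : ℝ}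
    (hM : 1 ≤ M) {s u t : ℝ} (hs : 0 ≤ s) (hsu : s ≤ u) (hut : u ≤ t) (htT : t ≤ T)
    (hqM : (t - s) ^ γ ≤ M) (e : E) :
    ‖roughStep S I P Q f F a t u (roughStep S I P Q f F a u s e) - roughStep S I P Q f F a t s e‖ ≤
      5 * (K * C * (1 + K * C) ^ 2 * M) * (1 + ‖e‖)
        * ((t - s) ^ γ * ((t - s) + ((t - s) ^ γ) ^ 2)) := by
  have hK := H.const_nonneg
  have hC := H.bound_field.const_nonneg
  obtain ⟨hp, -, hr, -⟩ := H.bounds hγ a hs hsu hut htT e e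
  rw [H.comp_sub_eq a hs hsu hut htT]
  generalize a + I e = v at *
  generalize I (P u s (f v)) = p at *
  generalize I (S (u - s).toNNReal e - e) + I (Q u s (F v)) = r at *
  have hx : 0 ≤ t - s := by linarith
  have hqq : (t - u) ^ γ ≤ (t - s) ^ γ := Real.rpow_le_rpow (by linarith) (by linarith) hγ.le
  have hqu : 0 ≤ (t - u) ^ γ := Real.rpow_nonneg (by linarith) _
  have h1 := H.norm_first_le u t (by linarith) hut htT (f (v + (p + r)) - f v - f' v p)
  have h2 := H.norm_second_le u t (by linarith) hut htT (F (v + (p + r)) - F v)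
  have h3 := H.norm_third_le s u t hs hsu hut htT (F v)
  have h4 := H.bound_field.taylor_le H.hasFDerivAt H.bound_deriv v p r
  have h5 := H.bound_second.lipschitz (v + (p + r)) v
  have h6 := H.bound_second.norm_le v
  set q := (t - s) ^ γ with hq
  have hq0 : 0 ≤ q := Real.rpow_nonneg hx _
  set y := (t - s) + q ^ 2 with hy
  have hq2 : q ^ 2 ≤ y := by linarith
  have hy0 : 0 ≤ y := by positivity
  set D := 1 + K * C with hD
  have hKC : 0 ≤ K * C := by positivity
  have hD1 : 1 ≤ D := by linarith
  have hD2 : D ≤ D ^ 2 := by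
    calc D = D ^ 1 := by ring
      _ ≤ D ^ 2 := by gcongr; norm_num
  set n := 1 + ‖e‖ with hn
  have hn1 : 1 ≤ n := by linarith [norm_nonneg e]
  have b1 : ‖p‖ ≤ D * q := hp.trans (by gcongr; linarith)
  have t1 : ‖f (v + (p + r)) - f v - f' v p‖ ≤ 2 * (C * D ^ 2 * M) * (n * y) := by
    calc _ ≤ C * (D * n * y) + C * (D * q * (D * q)) := h4.trans (by gcongr)
      _ = C * D * 1 * (n * y) + C * D ^ 2 * 1 * (1 * q ^ 2) := by ring
      _ ≤ C * D ^ 2 * M * (n * y) + C * D ^ 2 * M * (n * y) := by gcongr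
      _ = _ := by ring
  have t2 : q * ‖F (v + (p + r)) - F v‖ ≤ 2 * (C * D ^ 2 * M) * (n * y) := by
    have i1 : v + (p + r) - v = p + r := by abel
    rw [i1] at h5
    have k1 := norm_add_le p r
    calc _ ≤ q * (C * (D * q + D * n * y)) := by
          gcongr
          exact h5.trans (by gcongr; linarith)
      _ = C * D * 1 * (1 * q ^ 2) + C * D * q * (n * y) := by ring
      _ ≤ C * D ^ 2 * M * (n * y) + C * D ^ 2 * M * (n * y) := by gcongr
      _ = _ := by ring
  rw [sub_eq_add_neg]
  refine norm_add₃_le.trans ?_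
  rw [norm_neg]
  have g1 := h1.trans (show _ ≤ K * q * (2 * (C * D ^ 2 * M) * (n * y)) by gcongr)
  have g2 : K * ((t - u) ^ γ) ^ 2 * ‖F (v + (p + r)) - F v‖ ≤
      K * q * (2 * (C * D ^ 2 * M) * (n * y)) := by
    calc _ ≤ K * q ^ 2 * ‖F (v + (p + r)) - F v‖ := by gcongr
      _ = K * q * (q * ‖F (v + (p + r)) - F v‖) := by ring
      _ ≤ _ := by gcongr
  have g3 : K * q ^ 3 * ‖F v‖ ≤ K * q * ((C * D ^ 2 * M) * (n * y)) := by
    calc K * q ^ 3 * ‖F v‖ ≤ K * q ^ 3 * C := by gcongr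
      _ = K * q * ((C * 1 ^ 2 * 1) * (1 * q ^ 2)) := by ring
      _ ≤ _ := by gcongr
  calc _ ≤ K * q * (2 * (C * D ^ 2 * M) * (n * y)) + K * q * (2 * (C * D ^ 2 * M) * (n * y))
        + K * q * ((C * D ^ 2 * M) * (n * y)) :=
        add_le_add (add_le_add g1 (h2.trans g2)) (h3.trans g3)
    _ = _ := by ring

theorem almostFlow (H : IsRoughField T γ K C S I P Q R f f' F) (hT : 0 ≤ T) (hγ : 0 < γ) {α : ℝ}
    (hα : 1 < α) (hα1 : α ≤ 1 + γ) (hα3 : α ≤ 3 * γ) (a : W) :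
    ∃ C', AlmostFlow T γ α C' (roughStep S I P Q f F a) := by
  obtain ⟨M, hM, hpow⟩ := exists_power_bound hT hγ (by linarith) hα1 hα3
  have hK := H.const_nonneg
  have hC := H.bound_field.const_nonneg
  set D := 1 + K * C with hD
  have hKC : 0 ≤ K * C := by positivity
  have hD1 : 1 ≤ D := by linarith
  have hDk : ∀ k l : ℕ, 1 ≤ D ^ k * M ^ l := fun k l =>
    one_le_mul_of_one_le_of_one_le (one_le_pow₀ hD1) (one_le_pow₀ hM)
  -- One constant for all the requirements: the largest consistency constant times the M that
  -- converts the order of the default into (t-s)^α.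
  set C' := 22 * (K * C * D ^ 3 * M ^ 2) * M with hC'
  have hpq : ∀ (A : ℝ) {x : ℝ}, 0 ≤ A → 0 ≤ x → x ≤ T → A ≤ 22 * (K * C * D ^ 3 * M ^ 2) →
      A * (x ^ γ * (x + (x ^ γ) ^ 2)) ≤ C' * x ^ α := by
    intro A x hA hx hxT hAle
    calc _ ≤ 22 * (K * C * D ^ 3 * M ^ 2) * (M * x ^ α) :=
          mul_le_mul hAle (hpow x hx hxT).2.2 (by positivity) (by positivity)
      _ = _ := by rw [hC']; ring
  have h2KCM : 2 * (K * C * M) ≤ C' := by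
    calc 2 * (K * C * M) ≤ 22 * (K * C * M) := by gcongr; norm_num
      _ = 22 * (K * C * 1) * M := by ring
      _ ≤ 22 * (K * C * (D ^ 3 * M ^ 2)) * M := by
          gcongr
          exact hDk 3 2
      _ = C' := by rw [hC']; ring
  have hsq : ∀ x : ℝ, 0 ≤ x → x ≤ T → (x ^ γ) ^ 2 ≤ M * x ^ γ := by
    intro x hx hxT
    have := (hpow x hx hxT).1
    rw [sq]
    gcongr
  have hq1 : ∀ x : ℝ, 0 ≤ x → x ^ γ ≤ M * x ^ γ := fun x hx =>
    le_mul_of_one_le_left (by positivity) hM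
  refine ⟨C', ⟨by positivity, hγ, hα, ?_, ?_, ?_, ?_, ?_⟩⟩
  · intro s t hs hst htT p q p' q'
    have hx : 0 ≤ t - s := by linarith
    have hxT : t - s ≤ T := by linarith
    have hi : ∀ e e' : E, ‖(a + I e) - (a + I e')‖ ≤ ‖e - e'‖ := by
      intro e e'
      rw [add_sub_add_left_eq_sub, ← map_sub]
      exact H.norm_observation_le _
    have hii : ‖((a + I p) - (a + I q)) - ((a + I p') - (a + I q'))‖ ≤
        ‖(p - q) - (p' - q')‖ := by
      rw [add_sub_add_left_eq_sub, add_sub_add_left_eq_sub, ← map_sub, ← map_sub, ← map_sub]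
      exact H.norm_observation_le _
    have hsplit : (roughStep S I P Q f F a t s p - roughStep S I P Q f F a t s q)
        - (roughStep S I P Q f F a t s p' - roughStep S I P Q f F a t s q') =
        S (t - s).toNNReal ((p - q) - (p' - q'))
        + P t s ((f (a + I p) - f (a + I q)) - (f (a + I p') - f (a + I q')))
        + Q t s ((F (a + I p) - F (a + I q)) - (F (a + I p') - F (a + I q'))) := by
      simp only [roughStep, map_sub]
      abel
    rw [hsplit]
    refine norm_add₃_le.trans ?_
    have h1 := H.norm_semigroup_le (t - s).toNNReal ((p - q) - (p' - q'))
    have hsd : ∀ d b c c' d' b' g g' : ℝ, 0 ≤ b → 0 ≤ c → 0 ≤ c' → d ≤ d' → b ≤ b' → c ≤ g →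
        c' ≤ g' → C * d + C * b * (c + c') ≤ C * d' + C * b' * (g + g') := by
      intro d b c c' d' b' g g' hb hc hc' h1 h2 h3 h4
      have : 0 ≤ b' := hb.trans h2
      gcongr
    have h2 := (H.norm_first_le s t hs hst htT _).trans
      (mul_le_mul_of_nonneg_left ((H.bound_field.second_difference (a + I p) (a + I q)
        (a + I p') (a + I q')).trans (hsd _ _ _ _ _ _ _ _ (norm_nonneg _) (norm_nonneg _)
          (norm_nonneg _) hii (hi _ _) (hi _ _) (hi _ _)))
        (by positivity : 0 ≤ K * (t - s) ^ γ))
    have h3 := (H.norm_second_le s t hs hst htT _).trans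
      (mul_le_mul_of_nonneg_left ((H.bound_second.second_difference (a + I p) (a + I q)
        (a + I p') (a + I q')).trans (hsd _ _ _ _ _ _ _ _ (norm_nonneg _) (norm_nonneg _)
          (norm_nonneg _) hii (hi _ _) (hi _ _) (hi _ _)))
        (by positivity : 0 ≤ K * ((t - s) ^ γ) ^ 2))
    have hqsum : (t - s) ^ γ + ((t - s) ^ γ) ^ 2 ≤ 2 * (M * (t - s) ^ γ) := by
      linarith [hsq _ hx hxT, hq1 _ hx]
    have hqM2 : (t - s) ^ γ + ((t - s) ^ γ) ^ 2 ≤ 2 * M := by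
      have := (hpow _ hx hxT).1
      linarith [(hpow _ hx hxT).2.1]
    have k1 : K * C * ((t - s) ^ γ + ((t - s) ^ γ) ^ 2) ≤ C' * (t - s) ^ γ := by
      calc _ ≤ K * C * (2 * (M * (t - s) ^ γ)) := by gcongr
        _ = 2 * (K * C * M) * (t - s) ^ γ := by ring
        _ ≤ _ := by gcongr
    have k2 : K * C * ((t - s) ^ γ + ((t - s) ^ γ) ^ 2) ≤ C' := by
      calc _ ≤ K * C * (2 * M) := by gcongr
        _ = 2 * (K * C * M) := by ring
        _ ≤ _ := h2KCM
    have k3 := mul_le_mul_of_nonneg_right k1 (norm_nonneg ((p - q) - (p' - q')))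
    have k4 := mul_le_mul_of_nonneg_right k2
      (by positivity : 0 ≤ ‖p' - q'‖ * (‖p - p'‖ + ‖q - q'‖))
    linarith
  · intro s u t hs hsu hut htT e
    have hx : 0 ≤ t - s := by linarith
    have hxT : t - s ≤ T := by linarith
    refine (H.comp_sub_le hγ a hM hs hsu hut htT (hpow _ hx hxT).1 e).trans ?_
    have h1 := hpq (5 * (K * C * D ^ 2 * M)) (by positivity) hx hxT (by
      calc 5 * (K * C * D ^ 2 * M) ≤ 22 * (K * C * D ^ 2 * M) := by gcongr; norm_num
        _ = 22 * (K * C * D ^ 2 * M ^ 1) := by ring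
        _ ≤ _ := by gcongr <;> norm_num)
    have h2 := mul_le_mul_of_nonneg_right h1 (by positivity : 0 ≤ 1 + ‖e‖)
    linarith
  · intro s u t hs hsu hut htT e e'
    have hx : 0 ≤ t - s := by linarith
    have hxT : t - s ≤ T := by linarith
    refine (H.comp_sub_sub_le hγ a hM hs hsu hut htT (hpow _ hx hxT).1 (hpow _ hx hxT).2.1
      e e').trans ?_
    have h1 := hpq (22 * (K * C * D ^ 3 * M ^ 2)) (by positivity) hx hxT le_rfl
    have h2 := mul_le_mul_of_nonneg_right h1 (by positivity : 0 ≤ (1 + ‖e'‖) * ‖e - e'‖)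
    linarith
  · intro s t hs hst htT e
    have hx : 0 ≤ t - s := by linarith
    have hxT : t - s ≤ T := by linarith
    unfold roughStep
    rw [← add_assoc]
    refine norm_add₃_le.trans ?_
    have h1 := H.norm_semigroup_le (t - s).toNNReal e
    have h2 := (H.norm_first_le s t hs hst htT (f (a + I e))).trans
      (mul_le_mul_of_nonneg_left (H.bound_field.norm_le _)
        (by positivity : 0 ≤ K * (t - s) ^ γ))
    have h3 := (H.norm_second_le s t hs hst htT (F (a + I e))).trans
      (mul_le_mul_of_nonneg_left (H.bound_second.norm_le _)
        (by positivity : 0 ≤ K * ((t - s) ^ γ) ^ 2))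
    have k1 : K * C * ((t - s) ^ γ + ((t - s) ^ γ) ^ 2) ≤ C' * (t - s) ^ γ := by
      calc _ ≤ K * C * (2 * (M * (t - s) ^ γ)) := by
            gcongr
            linarith [hsq _ hx hxT, hq1 _ hx]
        _ = 2 * (K * C * M) * (t - s) ^ γ := by ring
        _ ≤ _ := by gcongr
    linarith
  · intro s hs e
    refine ContinuousOn.add ?_ ((H.continuousOn_first s hs _).add (H.continuousOn_second s hs _))
    exact ((H.continuous_semigroup e).comp
      (continuous_real_toNNReal.comp (continuous_id.sub continuous_const))).continuousOn

end IsRoughField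

end RoughField

section Driver

open Filter Topology

/-! ### Convolutional rough paths as drivers -/

/-- The Hölder bound is only given for s < t. Continuity on the simplex extends it to s = t, where
it forces the function to vanish. -/
theorem HolderTwo.exists_bound {E : Type*} [NormedAddCommGroup E] {T μ : ℝ} {f : ℝ → ℝ → E}
    (hf : HolderTwo T μ f) (hT : 0 < T) (hμ : 0 < μ) :
    ∃ K : ℝ, 0 ≤ K ∧ ∀ s t : ℝ, 0 ≤ s → s ≤ t → t ≤ T → ‖f t s‖ ≤ K * (t - s) ^ μ := by
  obtain ⟨hc, K, hK⟩ := hf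
  refine ⟨max K 0, le_max_right _ _, fun s t hs hst ht => ?_⟩
  have hstrict : ∀ s t : ℝ, 0 ≤ s → s < t → t ≤ T → ‖f t s‖ ≤ max K 0 * (t - s) ^ μ := by
    intro s t hs hst ht
    refine (hK s t hs hst ht).trans ?_
    have : 0 ≤ (t - s) ^ μ := Real.rpow_nonneg (by linarith) _
    gcongr
    exact le_max_left _ _
  -- A convex combination with the point (T, 0), which moves (t, s) to points of the simplex with s
  -- < t.
  set p : ℝ → ℝ × ℝ := fun ε => ((1 - ε) * t + ε * T, (1 - ε) * s) with hp
  have hp0 : p 0 = (t, s) := by simp [hp]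
  have hpc : Continuous p := by fun_prop
  have hmem : ∀ ε ∈ Ioc (0 : ℝ) 1, p ε ∈ simplexTwo T ∧ (p ε).2 < (p ε).1 := by
    rintro ε ⟨h0, h1⟩
    have h2 : 0 ≤ (1 - ε) * s := mul_nonneg (by linarith) hs
    have h3 : (1 - ε) * s ≤ (1 - ε) * t := mul_le_mul_of_nonneg_left hst (by linarith)
    have h4 : 0 < ε * T := mul_pos h0 hT
    have h5 : (1 - ε) * t ≤ (1 - ε) * T := mul_le_mul_of_nonneg_left ht (by linarith)
    simp only [hp, simplexTwo, mem_ofPred_eq]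
    refine ⟨⟨h2, by linarith, by linarith⟩, by linarith⟩
  have hev : ∀ᶠ ε : ℝ in 𝓝[>] 0, ε ∈ Ioc (0 : ℝ) 1 := Ioc_mem_nhdsGT one_pos
  have hlim : Tendsto p (𝓝[>] 0) (𝓝[simplexTwo T] (t, s)) := by
    refine tendsto_nhdsWithin_iff.2 ⟨?_, hev.mono fun ε h => (hmem ε h).1⟩
    rw [← hp0]
    exact (hpc.tendsto 0).mono_left nhdsWithin_le_nhds
  have h1 := ((hc (t, s) ⟨hs, hst, ht⟩).tendsto.comp hlim).norm
  have h2 : Tendsto (fun ε => max K 0 * ((p ε).1 - (p ε).2) ^ μ) (𝓝[>] 0)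
      (𝓝 (max K 0 * (t - s) ^ μ)) := by
    have h3 : Continuous fun q : ℝ × ℝ => max K 0 * (q.1 - q.2) ^ μ :=
      continuous_const.mul ((continuous_fst.sub continuous_snd).rpow_const fun _ => Or.inr hμ.le)
    exact (h3.tendsto (t, s)).comp (hlim.mono_right nhdsWithin_le_nhds)
  exact le_of_tendsto_of_tendsto h1 h2 (hev.mono fun ε h =>
    hstrict _ _ (hmem ε h).1.1 (hmem ε h).2 (hmem ε h).1.2.2)

/-- Only the total exponent μ is needed later: each product of powers is at most (t-s)^μ, and the
series is summed with |K i|, the given constants having no prescribed sign. Degenerate triples are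
reached by continuity. -/
theorem HolderThree.exists_bound {E : Type*} [NormedAddCommGroup E] {T μ : ℝ}
    {f : ℝ → ℝ → ℝ → E} (hf : HolderThree T μ f) (hT : 0 < T) (hμ : 0 < μ) :
    ∃ K : ℝ, 0 ≤ K ∧ ∀ s u t : ℝ, 0 ≤ s → s ≤ u → u ≤ t → t ≤ T →
      ‖f t u s‖ ≤ K * (t - s) ^ μ := by
  obtain ⟨hc, H, ρ, K, hK, hρ, -, hH, hsum⟩ := hf
  have hA : 0 ≤ ∑' i, |K i| := tsum_nonneg fun i => abs_nonneg _
  refine ⟨∑' i, |K i|, hA, fun s u t hs hsu hut ht => ?_⟩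
  have hstrict : ∀ s u t : ℝ, 0 ≤ s → s < u → u < t → t ≤ T →
      ‖f t u s‖ ≤ (∑' i, |K i|) * (t - s) ^ μ := by
    intro s u t hs hsu hut ht
    rw [← (hsum s u t hs hsu.le hut.le ht).tsum_eq]
    refine tsum_of_norm_bounded ((hK.abs.hasSum).mul_right ((t - s) ^ μ)) fun i => ?_
    refine (hH i s u t hs hsu hut ht).trans ?_
    have h1 : (t - u) ^ ρ i * (u - s) ^ (μ - ρ i) ≤ (t - s) ^ μ := by
      calc _ ≤ (t - s) ^ ρ i * (t - s) ^ (μ - ρ i) := by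
            have := hρ i
            refine mul_le_mul (Real.rpow_le_rpow ?_ ?_ ?_) (Real.rpow_le_rpow ?_ ?_ ?_)
              (Real.rpow_nonneg ?_ _) (Real.rpow_nonneg ?_ _) <;> linarith
        _ = _ := by
            rw [← Real.rpow_add (by linarith), add_sub_cancel]
    have h2 : 0 ≤ (t - u) ^ ρ i * (u - s) ^ (μ - ρ i) :=
      mul_nonneg (Real.rpow_nonneg (by linarith) _) (Real.rpow_nonneg (by linarith) _)
    calc _ ≤ |K i| * ((t - u) ^ ρ i * (u - s) ^ (μ - ρ i)) := by
          gcongr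
          exact le_abs_self _
      _ ≤ _ := by gcongr
  set p : ℝ → ℝ × ℝ × ℝ := fun ε =>
    ((1 - ε) * t + ε * T, (1 - ε) * u + ε * (T / 2), (1 - ε) * s) with hp
  have hp0 : p 0 = (t, u, s) := by simp [hp]
  have hpc : Continuous p := by fun_prop
  have hmem : ∀ ε ∈ Ioc (0 : ℝ) 1,
      p ε ∈ simplexThree T ∧ (p ε).2.2 < (p ε).2.1 ∧ (p ε).2.1 < (p ε).1 := by
    rintro ε ⟨h0, h1⟩
    have h2 : 0 ≤ (1 - ε) * s := mul_nonneg (by linarith) hs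
    have h3 : (1 - ε) * s ≤ (1 - ε) * u := mul_le_mul_of_nonneg_left hsu (by linarith)
    have h3' : (1 - ε) * u ≤ (1 - ε) * t := mul_le_mul_of_nonneg_left hut (by linarith)
    have h4 : 0 < ε * T := mul_pos h0 hT
    have h5 : (1 - ε) * t ≤ (1 - ε) * T := mul_le_mul_of_nonneg_left ht (by linarith)
    simp only [hp, simplexThree, mem_ofPred_eq]
    refine ⟨⟨h2, by linarith, by linarith, by linarith⟩, by linarith, by linarith⟩
  have hev : ∀ᶠ ε : ℝ in 𝓝[>] 0, ε ∈ Ioc (0 : ℝ) 1 := Ioc_mem_nhdsGT one_pos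
  have hlim : Tendsto p (𝓝[>] 0) (𝓝[simplexThree T] (t, u, s)) := by
    refine tendsto_nhdsWithin_iff.2 ⟨?_, hev.mono fun ε h => (hmem ε h).1⟩
    rw [← hp0]
    exact (hpc.tendsto 0).mono_left nhdsWithin_le_nhds
  have h1 := ((hc (t, u, s) ⟨hs, hsu, hut, ht⟩).tendsto.comp hlim).norm
  have h2 : Tendsto (fun ε => (∑' i, |K i|) * ((p ε).1 - (p ε).2.2) ^ μ) (𝓝[>] 0)
      (𝓝 ((∑' i, |K i|) * (t - s) ^ μ)) := by
    have h3 : Continuous fun q : ℝ × ℝ × ℝ => (∑' i, |K i|) * (q.1 - q.2.2) ^ μ :=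
      continuous_const.mul ((continuous_fst.sub (continuous_snd.comp continuous_snd)).rpow_const
        fun _ => Or.inr hμ.le)
    exact (h3.tendsto (t, u, s)).comp (hlim.mono_right nhdsWithin_le_nhds)
  exact le_of_tendsto_of_tendsto h1 h2 (hev.mono fun ε h =>
    hstrict _ _ _ (hmem ε h).1.1 (hmem ε h).2.1 (hmem ε h).2.2 (hmem ε h).1.2.2.2)

noncomputable section

variable {φhat : ℝ → ℝ}

/-- Componentwise multiplication by `e^{-ξ r}`. -/
def decayPi (φhat : ℝ → ℝ) (d : ℕ) (r : ℝ≥0) :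
    (Fin d → LaplaceSpace φhat) →ₗ[ℝ] (Fin d → LaplaceSpace φhat) where
  toFun e i := decay φhat r (e i)
  map_add' e e' := by funext i; exact decay_add r (e i) (e' i)
  map_smul' c e := by funext i; exact decay_smul r c (e i)

/-- Componentwise integration against `φ̂`. -/
def laplaceIntegralPi (hφ : AEMeasurable φhat (volume.restrict (Ioi (0 : ℝ)))) (d : ℕ) :
    (Fin d → LaplaceSpace φhat) →ₗ[ℝ] (Fin d → ℝ) where
  toFun e i := laplaceIntegral φhat (e i)
  map_add' e e' := by funext i; exact laplaceIntegral_add hφ (e i) (e' i)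
  map_smul' c e := by funext i; exact laplaceIntegral_smul hφ c (e i)

namespace ConvRoughPath

variable {T γ : ℝ} {n : ℕ}

/-- `c ↦ x̃¹_{ts} c`, column by column. -/
def firstLevel (X : ConvRoughPath φhat T γ n) (d : ℕ) (t s : ℝ) :
    (Fin d → Fin n → ℝ) →ₗ[ℝ] (Fin d → LaplaceSpace φhat) where
  toFun c i := ∑ j, c i j • X.x1 t s j
  map_add' c c' := by funext i; simp [add_smul, Finset.sum_add_distrib]
  map_smul' c c' := by funext i; simp [mul_smul, Finset.smul_sum]

/-- `c ↦ x̃²_{ts} · c`, column by column. -/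
def secondLevel (X : ConvRoughPath φhat T γ n) (d : ℕ) (t s : ℝ) :
    (Fin d → Fin n → Fin n → ℝ) →ₗ[ℝ] (Fin d → LaplaceSpace φhat) where
  toFun c i := ∑ j, ∑ l, c i j l • X.x2 t s j l
  map_add' c c' := by funext i; simp [add_smul, Finset.sum_add_distrib]
  map_smul' c c' := by funext i; simp [mul_smul, Finset.smul_sum]

/-- `c ↦ x̃³_{tus} · c`, column by column. -/
def thirdLevel (X : ConvRoughPath φhat T γ n) (d : ℕ) (t u s : ℝ) :
    (Fin d → Fin n → Fin n → ℝ) →ₗ[ℝ] (Fin d → LaplaceSpace φhat) where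
  toFun c i := ∑ j, ∑ l, c i j l • X.x3 t u s j l
  map_add' c c' := by funext i; simp [add_smul, Finset.sum_add_distrib]
  map_smul' c c' := by funext i; simp [mul_smul, Finset.smul_sum]

theorem x1_add (X : ConvRoughPath φhat T γ n) {s u t : ℝ} (hs : 0 ≤ s) (hsu : s ≤ u) (hut : u ≤ t)
    (htT : t ≤ T) (j : Fin n) :
    X.x1 t s j = X.x1 t u j + decay φhat (t - u).toNNReal (X.x1 u s j) := by
  have h := X.delta_x1 s u t hs hsu hut htT j
  rw [twistedDeltaTwo] at h
  rw [← sub_eq_zero, ← h]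
  abel

theorem x2_add (X : ConvRoughPath φhat T γ n) {s u t : ℝ} (hs : 0 ≤ s) (hsu : s ≤ u) (hut : u ≤ t)
    (htT : t ≤ T) (j l : Fin n) :
    X.x2 t s j l = X.x2 t u j l + decay φhat (t - u).toNNReal (X.x2 u s j l)
      + (X.x1int u s l • X.x1 t u j + X.x3 t u s j l) := by
  have h := X.delta_x2 s u t hs hsu hut htT j l
  rw [x1int, ← h, twistedDeltaTwo]
  abel

end ConvRoughPath

/-- The derivative of `v ↦ σ(v)ᵀ`. -/
def fieldDeriv {n d : ℕ} (σ : (Fin d → ℝ) → Matrix (Fin n) (Fin d) ℝ) (v : Fin d → ℝ) :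
    (Fin d → ℝ) →L[ℝ] (Fin d → Fin n → ℝ) :=
  ContinuousLinearMap.pi fun i => ContinuousLinearMap.pi fun j => fderiv ℝ (fun v => σ v j i) v

/-- The array `Dσ_{ji}(v) σ_l(v)`, where `σ_l` is the `l`-th row of `σ`. -/
def fieldSecond {n d : ℕ} (σ : (Fin d → ℝ) → Matrix (Fin n) (Fin d) ℝ) (v : Fin d → ℝ)
    (i : Fin d) (j l : Fin n) : ℝ :=
  fderiv ℝ (fun v => σ v j i) v (σ v l)

theorem hasFDerivAt_field {n d : ℕ} {σ : (Fin d → ℝ) → Matrix (Fin n) (Fin d) ℝ}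
    (hσ : ∀ j k, IsCThreeBounded fun v => σ v j k) (v : Fin d → ℝ) :
    HasFDerivAt (fun v i j => σ v j i) (fieldDeriv σ v) v := by
  refine hasFDerivAt_pi.2 fun i => hasFDerivAt_pi.2 fun j => ?_
  exact ((hσ j i).1.differentiable (by norm_num) v).hasFDerivAt

/-- Entrywise bounds are combined into one constant by summing over the finitely many entries; F is
handled by the Leibniz rule. -/
theorem exists_field_bounds {n d : ℕ} {σ : (Fin d → ℝ) → Matrix (Fin n) (Fin d) ℝ}
    (hσ : ∀ j k, IsCThreeBounded fun v => σ v j k) :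
    ∃ C, HasSecondDifferenceBound (fun v (i : Fin d) (j : Fin n) => σ v j i) C ∧
      HasSecondDifferenceBound (fieldDeriv σ) C ∧ HasSecondDifferenceBound (fieldSecond σ) C := by
  have h1 : ∀ q : Fin d × Fin n, ∃ C, HasSecondDifferenceBound (fun v => σ v q.2 q.1) C :=
    fun q => HasSecondDifferenceBound.of_contDiff ((hσ q.2 q.1).1.of_le (by norm_num))
      fun m hm => (hσ q.2 q.1).2 m (by omega)
  have h2 : ∀ q : Fin d × Fin n,
      ∃ C, HasSecondDifferenceBound (fderiv ℝ fun v => σ v q.2 q.1) C := by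
    intro q
    refine HasSecondDifferenceBound.of_contDiff ((hσ q.2 q.1).1.fderiv_right (by norm_num)) ?_
    intro m hm
    obtain ⟨C, hC⟩ := (hσ q.2 q.1).2 (m + 1) (by omega)
    exact ⟨C, fun v => by rw [norm_iteratedFDeriv_fderiv]; exact hC v⟩
  choose C₁ hC₁ using h1
  choose C₂ hC₂ using h2
  set B := ∑ q, (C₁ q + C₂ q) with hB
  have hle : ∀ q, C₁ q + C₂ q ≤ B := fun q => Finset.single_le_sum
    (f := fun q => C₁ q + C₂ q)
    (fun q _ => add_nonneg (hC₁ q).const_nonneg (hC₂ q).const_nonneg) (Finset.mem_univ q)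
  have hB0 : 0 ≤ B :=
    Finset.sum_nonneg fun q _ => add_nonneg (hC₁ q).const_nonneg (hC₂ q).const_nonneg
  have k1 : ∀ i j, HasSecondDifferenceBound (fun v => σ v j i) B := fun i j =>
    (hC₁ (i, j)).mono (by linarith [hle (i, j), (hC₂ (i, j)).const_nonneg])
  have k2 : ∀ i j, HasSecondDifferenceBound (fderiv ℝ fun v => σ v j i) B := fun i j =>
    (hC₂ (i, j)).mono (by linarith [hle (i, j), (hC₁ (i, j)).const_nonneg])
  have k3 : ∀ i j l, HasSecondDifferenceBound (fun v => fieldSecond σ v i j l) (3 * (B * B)) :=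
    fun i j l => (k2 i j).clm_apply
      (HasSecondDifferenceBound.pi (f := fun v => σ v l) (fun k => k1 k l) hB0)
  refine ⟨max B (3 * (B * B)), ?_, ?_, ?_⟩
  · exact (HasSecondDifferenceBound.pi
      (fun i => HasSecondDifferenceBound.pi (fun j => k1 i j) hB0) hB0).mono (le_max_left _ _)
  · exact (HasSecondDifferenceBound.clm_pi
      (fun i => HasSecondDifferenceBound.clm_pi (fun j => k2 i j) hB0) hB0).mono (le_max_left _ _)
  · have : 0 ≤ 3 * (B * B) := by positivity
    exact (HasSecondDifferenceBound.pi (fun i => HasSecondDifferenceBound.pi (fun j =>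
      HasSecondDifferenceBound.pi (fun l => k3 i j l) this) this) this).mono (le_max_right _ _)

theorem norm_sum_smul_le {L : Type*} [NormedAddCommGroup L] [NormedSpace ℝ L] {n : ℕ}
    (c : Fin n → ℝ) (x : Fin n → L) {A B : ℝ} (hc : ∀ j, |c j| ≤ A) (hx : ∀ j, ‖x j‖ ≤ B) :
    ‖∑ j, c j • x j‖ ≤ n * (A * B) := by
  refine (norm_sum_le _ _).trans ((Finset.sum_le_card_nsmul _ _ (A * B) fun j _ => ?_).trans ?_)
  · rw [norm_smul, Real.norm_eq_abs]
    exact mul_le_mul (hc j) (hx j) (norm_nonneg _) ((abs_nonneg _).trans (hc j))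
  · simp

theorem norm_sum_sum_smul_le {L : Type*} [NormedAddCommGroup L] [NormedSpace ℝ L] {n : ℕ}
    (c : Fin n → Fin n → ℝ) (x : Fin n → Fin n → L) {A B : ℝ} (hc : ∀ j l, |c j l| ≤ A)
    (hx : ∀ j l, ‖x j l‖ ≤ B) :
    ‖∑ j, ∑ l, c j l • x j l‖ ≤ n * (n * (A * B)) := by
  refine (norm_sum_le _ _).trans ((Finset.sum_le_card_nsmul _ _ (n * (A * B)) fun j _ => ?_).trans ?_)
  · exact norm_sum_smul_le _ _ (hc j) (hx j)
  · simp

theorem abs_apply_apply_le {d n : ℕ} (c : Fin d → Fin n → ℝ) (i : Fin d) (j : Fin n) :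
    |c i j| ≤ ‖c‖ := (norm_le_pi_norm (c i) j).trans (norm_le_pi_norm c i)

theorem norm_apply_apply_le {L : Type*} [NormedAddCommGroup L] {n m : ℕ} (c : Fin n → Fin m → L)
    (i : Fin n) (j : Fin m) : ‖c i j‖ ≤ ‖c‖ := (norm_le_pi_norm (c i) j).trans (norm_le_pi_norm c i)

theorem ConvRoughPath.laplaceIntegralPi_firstLevel
    (hφ : AEMeasurable φhat (volume.restrict (Ioi (0 : ℝ)))) {T γ : ℝ} {n d : ℕ}
    (X : ConvRoughPath φhat T γ n) (A : Matrix (Fin n) (Fin d) ℝ) (t s : ℝ) :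
    laplaceIntegralPi hφ d (X.firstLevel d t s fun i j => A j i) = ∑ l, X.x1int t s l • A l := by
  funext k
  change laplaceIntegral φhat (∑ l, A l k • X.x1 t s l) = _
  rw [laplaceIntegral_sum hφ, Finset.sum_apply]
  refine Finset.sum_congr rfl fun l _ => ?_
  rw [laplaceIntegral_smul hφ, mul_comm]
  rfl

theorem ConvRoughPath.isRoughField (hφ : AEMeasurable φhat (volume.restrict (Ioi (0 : ℝ))))
    {T γ : ℝ} (hT : 0 < T) (hγ : 0 < γ) {n d : ℕ} (X : ConvRoughPath φhat T γ n)
    {σ : (Fin d → ℝ) → Matrix (Fin n) (Fin d) ℝ}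
    (hσ : ∀ j k, IsCThreeBounded fun v => σ v j k) :
    ∃ K C, IsRoughField T γ K C (decayPi φhat d) (laplaceIntegralPi hφ d) (X.firstLevel d)
      (X.secondLevel d) (X.thirdLevel d) (fun v i j => σ v j i) (fieldDeriv σ) (fieldSecond σ) := by
  obtain ⟨C, hC1, hC2, hC3⟩ := exists_field_bounds hσ
  obtain ⟨K₁, hK₁0, hK₁⟩ := X.holder_x1.exists_bound hT hγ
  obtain ⟨K₂, hK₂0, hK₂⟩ := X.holder_x2.exists_bound hT (by linarith)
  obtain ⟨K₃, hK₃0, hK₃⟩ := X.holder_x3.exists_bound hT (by linarith)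
  have hpow : ∀ (k : ℕ) {x : ℝ}, 0 ≤ x → x ^ ((k : ℝ) * γ) = (x ^ γ) ^ k := by
    intro k x hx
    rw [mul_comm, Real.rpow_mul hx, Real.rpow_natCast]
  refine ⟨n * K₁ + n * (n * K₂) + n * (n * K₃), C, ?_⟩
  have hKn : 0 ≤ n * K₁ ∧ 0 ≤ n * (n * K₂) ∧ 0 ≤ n * (n * K₃) :=
    ⟨by positivity, by positivity, by positivity⟩
  constructor
  case const_nonneg => positivity
  case norm_semigroup_le =>
    exact fun r e => (pi_norm_le_iff_of_nonneg (norm_nonneg _)).2 fun i =>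
      (norm_decay_le r (e i)).trans (norm_le_pi_norm e i)
  case semigroup_add => exact fun r r' e => funext fun i => (decay_decay r r' (e i)).symm
  case continuous_semigroup => exact fun e => continuous_pi fun i => continuous_decay_left (e i)
  case norm_observation_le =>
    exact fun e => (pi_norm_le_iff_of_nonneg (norm_nonneg _)).2 fun i =>
      (abs_laplaceIntegral_le hφ (e i)).trans (norm_le_pi_norm e i)
  case norm_observation_semigroup_sub_le =>
    intro r e
    refine (pi_norm_le_iff_of_nonneg (by positivity)).2 fun i =>
      (abs_laplaceIntegral_decay_sub_le hφ r (e i)).trans ?_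
    gcongr
    exact norm_le_pi_norm e i
  case norm_first_le =>
    intro s t hs hst htT c
    have hx : 0 ≤ (t - s) ^ γ := Real.rpow_nonneg (by linarith) _
    refine (pi_norm_le_iff_of_nonneg (by positivity)).2 fun i => ?_
    refine (norm_sum_smul_le _ _ (fun j => abs_apply_apply_le c i j)
      fun j => (norm_le_pi_norm _ j).trans (hK₁ s t hs hst htT)).trans ?_
    calc _ = n * K₁ * ((t - s) ^ γ * ‖c‖) := by ring
      _ ≤ (n * K₁ + n * (n * K₂) + n * (n * K₃)) * ((t - s) ^ γ * ‖c‖) := by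
          gcongr
          linarith
      _ = _ := by ring
  case norm_second_le =>
    intro s t hs hst htT c
    have hx : 0 ≤ (t - s) ^ γ := Real.rpow_nonneg (by linarith) _
    refine (pi_norm_le_iff_of_nonneg (by positivity)).2 fun i => ?_
    refine (norm_sum_sum_smul_le _ _
      (fun j l => (abs_apply_apply_le (c i) j l).trans (norm_le_pi_norm c i))
      fun j l => (norm_apply_apply_le _ j l).trans (hK₂ s t hs hst htT)).trans ?_
    have e := hpow 2 (by linarith : 0 ≤ t - s)
    push_cast at e
    rw [e]
    calc _ = n * (n * K₂) * (((t - s) ^ γ) ^ 2 * ‖c‖) := by ring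
      _ ≤ (n * K₁ + n * (n * K₂) + n * (n * K₃)) * (((t - s) ^ γ) ^ 2 * ‖c‖) := by
          gcongr
          linarith
      _ = _ := by ring
  case norm_third_le =>
    intro s u t hs hsu hut htT c
    have hx : 0 ≤ (t - s) ^ γ := Real.rpow_nonneg (by linarith) _
    refine (pi_norm_le_iff_of_nonneg (by positivity)).2 fun i => ?_
    refine (norm_sum_sum_smul_le _ _
      (fun j l => (abs_apply_apply_le (c i) j l).trans (norm_le_pi_norm c i))
      fun j l => (norm_apply_apply_le _ j l).trans (hK₃ s u t hs hsu hut htT)).trans ?_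
    have e := hpow 3 (by linarith : 0 ≤ t - s)
    push_cast at e
    rw [e]
    calc _ = n * (n * K₃) * (((t - s) ^ γ) ^ 3 * ‖c‖) := by ring
      _ ≤ (n * K₁ + n * (n * K₂) + n * (n * K₃)) * (((t - s) ^ γ) ^ 3 * ‖c‖) := by
          gcongr
          linarith
      _ = _ := by ring
  case first_add =>
    intro s u t hs hsu hut htT c
    funext i
    change ∑ j, c i j • X.x1 t s j = ∑ j, c i j • X.x1 t u j
      + decay φhat (t - u).toNNReal (∑ j, c i j • X.x1 u s j)
    rw [decay_sum, ← Finset.sum_add_distrib]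
    refine Finset.sum_congr rfl fun j _ => ?_
    rw [X.x1_add hs hsu hut htT j, decay_smul, smul_add]
  -- The product term in the relation for x̃² has coefficients x¹_{us}. Contracted with Dσ·σ it
  -- becomes Dσ(v) applied to the sum of x¹_{us,l} σ_l(v), which is the observation of the first
  -- level.
  case second_add =>
    intro s u t hs hsu hut htT v
    funext i
    change ∑ j, ∑ l, fieldSecond σ v i j l • X.x2 t s j l =
      ∑ j, ∑ l, fieldSecond σ v i j l • X.x2 t u j l
      + decay φhat (t - u).toNNReal (∑ j, ∑ l, fieldSecond σ v i j l • X.x2 u s j l)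
      + ∑ j, fderiv ℝ (fun v => σ v j i) v
          (laplaceIntegralPi hφ d (X.firstLevel d u s fun i j => σ v j i)) • X.x1 t u j
      + ∑ j, ∑ l, fieldSecond σ v i j l • X.x3 t u s j l
    rw [X.laplaceIntegralPi_firstLevel hφ, decay_sum, ← Finset.sum_add_distrib, ← Finset.sum_add_distrib,
      ← Finset.sum_add_distrib]
    refine Finset.sum_congr rfl fun j _ => ?_
    rw [map_sum, Finset.sum_smul, decay_sum, ← Finset.sum_add_distrib, ← Finset.sum_add_distrib,
      ← Finset.sum_add_distrib]
    refine Finset.sum_congr rfl fun l _ => ?_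
    rw [X.x2_add hs hsu hut htT j l, decay_smul, map_smul, smul_add, smul_add, smul_add, smul_smul,
      smul_eq_mul, mul_comm (X.x1int u s l), ← add_assoc]
    rfl
  case continuousOn_first =>
    intro s hs c
    refine continuousOn_pi.2 fun i => ?_
    change ContinuousOn (fun t => ∑ j, c i j • X.x1 t s j) _
    refine continuousOn_finsetSum _ fun j _ => ContinuousOn.fun_const_smul ?_ _
    have h1 : ContinuousOn (fun t : ℝ => X.x1 t s) (Icc s T) :=
      X.holder_x1.1.comp (f := fun t : ℝ => (t, s)) (by fun_prop)
        fun t ht => ⟨hs, ht.1, ht.2⟩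
    exact continuousOn_pi.1 h1 j
  case continuousOn_second =>
    intro s hs c
    refine continuousOn_pi.2 fun i => ?_
    change ContinuousOn (fun t => ∑ j, ∑ l, c i j l • X.x2 t s j l) _
    refine continuousOn_finsetSum _ fun j _ => continuousOn_finsetSum _ fun l _ =>
      ContinuousOn.fun_const_smul ?_ _
    have h1 : ContinuousOn (fun t : ℝ => X.x2 t s) (Icc s T) :=
      X.holder_x2.1.comp (f := fun t : ℝ => (t, s)) (by fun_prop)
        fun t ht => ⟨hs, ht.1, ht.2⟩
    exact continuousOn_pi.1 (continuousOn_pi.1 h1 j) l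
  case hasFDerivAt => exact hasFDerivAt_field hσ
  case bound_field => exact hC1
  case bound_deriv => exact hC2
  case bound_second => exact hC3

end

end Driver

section Equation

open Filter Topology

/-! ### Solutions of the Volterra equation as flow lines -/

theorem HasSecondDifferenceBound.continuous {W V : Type*} [NormedAddCommGroup W]
    [NormedAddCommGroup V] {f : W → V} {C : ℝ} (hf : HasSecondDifferenceBound f C) :
    Continuous f :=
  (LipschitzWith.of_dist_le' fun p q => by
    rw [dist_eq_norm, dist_eq_norm]; exact hf.lipschitz p q).continuous

theorem rpow_le_mul_rpow {T x b β : ℝ} (hx : 0 < x) (hxT : x ≤ T) (hb : b ≤ β) :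
    x ^ β ≤ T ^ (β - b) * x ^ b := by
  calc x ^ β = x ^ (β - b) * x ^ b := by rw [← Real.rpow_add hx, sub_add_cancel]
    _ ≤ _ := by
        have : 0 ≤ β - b := by linarith
        gcongr

variable {φhat : ℝ → ℝ}

theorem twistedDeltaOne_eq (A : ℝ → LaplaceSpace φhat) (t s : ℝ) :
    twistedDeltaOne φhat A t s = A t - decay φhat (t - s).toNNReal (A s) := by
  rw [twistedDeltaOne]; abel

theorem twistedDeltaTwo_eq (B : ℝ → ℝ → LaplaceSpace φhat) (t u s : ℝ) :
    twistedDeltaTwo φhat B t u s = B t s - B t u - decay φhat (t - u).toNNReal (B u s) := by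
  rw [twistedDeltaTwo]; abel

theorem twistedDeltaTwo_twistedDeltaOne (A : ℝ → LaplaceSpace φhat) {s u t : ℝ} (hsu : s ≤ u)
    (hut : u ≤ t) : twistedDeltaTwo φhat (twistedDeltaOne φhat A) t u s = 0 := by
  have h : (t - s).toNNReal = (t - u).toNNReal + (u - s).toNNReal := by
    rw [← Real.toNNReal_add (by linarith) (by linarith)]
    congr 1; ring
  rw [twistedDeltaTwo_eq, twistedDeltaOne_eq, twistedDeltaOne_eq, twistedDeltaOne_eq, decay_sub,
    decay_decay, h]
  abel

theorem twistedDeltaTwo_sub (B B' : ℝ → ℝ → LaplaceSpace φhat) (t u s : ℝ) :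
    twistedDeltaTwo φhat (fun t s => B t s - B' t s) t u s =
      twistedDeltaTwo φhat B t u s - twistedDeltaTwo φhat B' t u s := by
  simp only [twistedDeltaTwo_eq, decay_sub]
  abel

namespace ConvRoughPath

variable {T γ : ℝ} {n d : ℕ}

/-- The term x̃¹_{tu} ⊗ x¹_{us} in δ̃x̃² is exactly what turns the increment of z into its
remainder. -/
theorem twistedDeltaTwo_germ (X : ConvRoughPath φhat T γ n) (z : ℝ → Fin n → ℝ)
    (ζ : ℝ → Fin n → Fin n → ℝ) {s u t : ℝ} (hs : 0 ≤ s) (hsu : s ≤ u) (hut : u ≤ t)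
    (htT : t ≤ T) : twistedDeltaTwo φhat (X.germ z ζ) t u s = -X.defect z ζ t u s := by
  rw [twistedDeltaTwo_eq]
  simp only [germ, defect, remainder, decay_add, decay_sum, ← Finset.sum_add_distrib,
    ← Finset.sum_sub_distrib, ← Finset.sum_neg_distrib]
  refine Finset.sum_congr rfl fun j _ => ?_
  rw [X.x1_add hs hsu hut htT j]
  have h : ∀ l, ζ s l j • X.x2 t s j l = ζ s l j • X.x2 t u j l
      + decay φhat (t - u).toNNReal (ζ s l j • X.x2 u s j l)
      + ((X.x1int u s l * ζ s l j) • X.x1 t u j + ζ s l j • X.x3 t u s j l) := by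
    intro l
    rw [X.x2_add hs hsu hut htT j l, decay_smul, mul_comm, mul_smul]
    simp only [smul_add]
  simp only [h, Finset.sum_add_distrib, sub_smul, Finset.sum_sub_distrib, Finset.sum_smul,
    smul_add, decay_smul]
  abel

/-- One step of the second-order scheme for the Volterra equation. -/
noncomputable def step (X : ConvRoughPath φhat T γ n)
    (hφ : AEMeasurable φhat (volume.restrict (Ioi (0 : ℝ))))
    (σ : (Fin d → ℝ) → Matrix (Fin n) (Fin d) ℝ) (a : Fin d → ℝ) :
    ℝ → ℝ → (Fin d → LaplaceSpace φhat) → (Fin d → LaplaceSpace φhat) :=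
  roughStep (decayPi φhat d) (laplaceIntegralPi hφ d) (X.firstLevel d) (X.secondLevel d)
    (fun v i j => σ v j i) (fieldSecond σ) a

theorem step_apply (X : ConvRoughPath φhat T γ n)
    (hφ : AEMeasurable φhat (volume.restrict (Ioi (0 : ℝ))))
    (σ : (Fin d → ℝ) → Matrix (Fin n) (Fin d) ℝ) (a : Fin d → ℝ)
    (ytil : ℝ → Fin d → LaplaceSpace φhat) {ζ : ℝ → Fin n → Fin d → ℝ} {s : ℝ}
    (hζ : ∀ j k, ζ s j k = σ (pathOf φhat a ytil s) j k) (t : ℝ) (i : Fin d) :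
    X.step hφ σ a t s (ytil s) i = decay φhat (t - s).toNNReal (ytil s i)
      + X.germ (fun t j => σ (pathOf φhat a ytil t) j i)
        (fun t j l => fderiv ℝ (fun v => σ v l i) (pathOf φhat a ytil t) (ζ t j)) t s := by
  have h : ζ s = σ (pathOf φhat a ytil s) := by
    funext j k; exact hζ j k
  simp only [germ, h]
  rfl

end ConvRoughPath

/-! ### Equivalence of the Volterra equation with the flow-line property -/

variable {T γ κ : ℝ} {n d : ℕ} {X : ConvRoughPath φhat T γ n}
  {σ : (Fin d → ℝ) → Matrix (Fin n) (Fin d) ℝ} {a : Fin d → ℝ}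

/-- With ζ = σ(y), one step of the scheme is the semigroup plus the germ, so the default of a
solution is the sewing term M, whose Hölder bound is part of its definition. -/
theorem IsVolterraSolution.flow_line (hφ : AEMeasurable φhat (volume.restrict (Ioi (0 : ℝ))))
    {ytil : ℝ → Fin d → LaplaceSpace φhat} {ζ : ℝ → Fin n → Fin d → ℝ}
    (H : IsVolterraSolution X κ σ a ytil ζ) :
    ∃ K : ℝ, ∀ s t : ℝ, 0 ≤ s → s < t → t ≤ T →
      ‖ytil t - X.step hφ σ a t s (ytil s)‖ ≤ K * (t - s) ^ (γ + 2 * κ) := by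
  have h1 : ∀ i, ∃ K : ℝ, ∀ s t : ℝ, 0 ≤ s → s < t → t ≤ T →
      ‖ytil t i - X.step hφ σ a t s (ytil s) i‖ ≤ K * (t - s) ^ (γ + 2 * κ) := by
    intro i
    obtain ⟨M, hM, hJ⟩ := (H.equation i).eq_germ_add_sewing
    obtain ⟨K, hK⟩ := hM.holder.2
    refine ⟨K, fun s t hs hst htT => ?_⟩
    have h2 := hJ s t hs hst.le htT
    rw [twistedDeltaOne_eq] at h2
    rw [X.step_apply hφ σ a ytil (H.deriv_eq s ⟨hs, by linarith⟩), ← sub_sub, h2, add_sub_cancel_left]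
    exact hK s t hs hst htT
  choose K hK using h1
  refine ⟨∑ i, |K i|, fun s t hs hst htT => ?_⟩
  have hpos : 0 ≤ (t - s) ^ (γ + 2 * κ) := Real.rpow_nonneg (by linarith) _
  have hsum : 0 ≤ ∑ i, |K i| := Finset.sum_nonneg fun i _ => abs_nonneg _
  refine (pi_norm_le_iff_of_nonneg (by positivity)).2 fun i => (hK i s t hs hst htT).trans ?_
  gcongr
  exact (le_abs_self _).trans
    (Finset.single_le_sum (f := fun i => |K i|) (fun i _ => abs_nonneg _) (Finset.mem_univ i))

theorem pathOf_eq (hφ : AEMeasurable φhat (volume.restrict (Ioi (0 : ℝ))))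
    (ytil : ℝ → Fin d → LaplaceSpace φhat) (t : ℝ) :
    pathOf φhat a ytil t = a + laplaceIntegralPi hφ d (ytil t) := rfl

theorem continuous_laplaceIntegralPi (hφ : AEMeasurable φhat (volume.restrict (Ioi (0 : ℝ)))) :
    Continuous (laplaceIntegralPi hφ d) :=
  continuous_pi fun i => (continuous_laplaceIntegral hφ).comp (continuous_apply i)

/-- Increments of the path observed along a flow line. -/
theorem exists_path_increment (hφ : AEMeasurable φhat (volume.restrict (Ioi (0 : ℝ)))) {K C : ℝ}
    (HX : IsRoughField T γ K C (decayPi φhat d) (laplaceIntegralPi hφ d) (X.firstLevel d)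
      (X.secondLevel d) (X.thirdLevel d) (fun v i j => σ v j i) (fieldDeriv σ) (fieldSecond σ))
    (hγ : γ < 1 / 2) (hκ : 0 < κ) (hκγ : κ < γ) {ytil : ℝ → Fin d → LaplaceSpace φhat} {N B : ℝ}
    (hN : ∀ t ∈ Icc 0 T, ‖ytil t‖ ≤ N) (hB0 : 0 ≤ B)
    (hB : ∀ s t : ℝ, 0 ≤ s → s < t → t ≤ T →
      ‖ytil t - X.step hφ σ a t s (ytil s)‖ ≤ B * (t - s) ^ (γ + 2 * κ)) :
    ∃ A : ℝ, 0 ≤ A ∧ ∀ s t : ℝ, 0 ≤ s → s < t → t ≤ T → ∃ r : Fin d → ℝ,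
      pathOf φhat a ytil t = pathOf φhat a ytil s + (laplaceIntegralPi hφ d
        (X.firstLevel d t s fun i j => σ (pathOf φhat a ytil s) j i) + r) ∧
      ‖laplaceIntegralPi hφ d (X.firstLevel d t s fun i j => σ (pathOf φhat a ytil s) j i)‖ ≤
        A * (t - s) ^ κ ∧
      ‖r‖ ≤ A * (t - s) ^ (2 * κ) ∧
      ‖(ytil t - X.step hφ σ a t s (ytil s))
        + X.secondLevel d t s (fieldSecond σ (pathOf φhat a ytil s))‖ ≤ A * (t - s) ^ (2 * κ) := by
  have hK := HX.const_nonneg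
  have hC := HX.bound_field.const_nonneg
  have hN' : 0 ≤ |N| := abs_nonneg _
  set T' := |T|
  have hT' : 0 ≤ T' := abs_nonneg _
  have q1 : 0 ≤ K * C * T' ^ (γ - κ) := by positivity
  have q2 : 0 ≤ B * T' ^ γ := by positivity
  have q3 : 0 ≤ |N| * T' ^ (1 - 2 * κ) := by positivity
  have q4 : 0 ≤ K * C * T' ^ (2 * γ - 2 * κ) := by positivity
  -- The four summands come from the first level, the flow-line default, the semigroup and the
  -- second level. The last three are compared with (t-s)^{2κ}, the semigroup because 2κ ≤ 1.
  refine ⟨K * C * T' ^ (γ - κ) + B * T' ^ γ + |N| * T' ^ (1 - 2 * κ)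
    + K * C * T' ^ (2 * γ - 2 * κ), by positivity, fun s t hs hst htT => ?_⟩
  have hx : 0 < t - s := by linarith
  have hxT : t - s ≤ T' := le_trans (by linarith) (le_abs_self T)
  have hxκ : 0 ≤ (t - s) ^ κ := by positivity
  have hx2κ : 0 ≤ (t - s) ^ (2 * κ) := by positivity
  have b1 : ‖ytil t - X.step hφ σ a t s (ytil s)‖ ≤ B * T' ^ γ * (t - s) ^ (2 * κ) := by
    refine (hB s t hs hst htT).trans ?_
    have := rpow_le_mul_rpow hx hxT (by linarith : 2 * κ ≤ γ + 2 * κ)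
    rw [add_sub_cancel_right] at this
    rw [mul_assoc]
    gcongr
  have b2 : ‖X.secondLevel d t s (fieldSecond σ (pathOf φhat a ytil s))‖ ≤
      K * C * T' ^ (2 * γ - 2 * κ) * (t - s) ^ (2 * κ) := by
    refine (HX.norm_second_le s t hs hst.le htT _).trans ?_
    have h1 := rpow_le_mul_rpow hx hxT (by linarith : 2 * κ ≤ 2 * γ)
    have h2 : ((t - s) ^ γ) ^ 2 = (t - s) ^ (2 * γ) := by
      rw [mul_comm, Real.rpow_mul hx.le, Real.rpow_two]
    have h3 := HX.bound_second.norm_le (pathOf φhat a ytil s)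
    rw [h2]
    calc _ ≤ K * (T' ^ (2 * γ - 2 * κ) * (t - s) ^ (2 * κ)) * C := by gcongr
      _ = _ := by ring
  have b3 : ‖laplaceIntegralPi hφ d (decayPi φhat d (t - s).toNNReal (ytil s) - ytil s)‖ ≤
      |N| * T' ^ (1 - 2 * κ) * (t - s) ^ (2 * κ) := by
    refine (HX.norm_observation_semigroup_sub_le _ _).trans ?_
    rw [Real.coe_toNNReal _ hx.le]
    have h1 := rpow_le_mul_rpow hx hxT (by linarith : 2 * κ ≤ 1)
    rw [Real.rpow_one] at h1
    have h2 := (hN s ⟨hs, by linarith⟩).trans (le_abs_self N)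
    calc _ ≤ T' ^ (1 - 2 * κ) * (t - s) ^ (2 * κ) * |N| := by gcongr
      _ = _ := by ring
  -- The remainder r collects the observations of everything except the first level.
  refine ⟨laplaceIntegralPi hφ d (ytil t - X.step hφ σ a t s (ytil s))
    + laplaceIntegralPi hφ d (decayPi φhat d (t - s).toNNReal (ytil s) - ytil s)
    + laplaceIntegralPi hφ d (X.secondLevel d t s (fieldSecond σ (pathOf φhat a ytil s))),
    ?_, ?_, ?_, ?_⟩
  · rw [pathOf_eq hφ, pathOf_eq hφ]
    simp only [ConvRoughPath.step, roughStep, map_add, map_sub]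
    abel
  · refine (HX.norm_observation_le _).trans ((HX.norm_first_le s t hs hst.le htT _).trans ?_)
    have h1 := rpow_le_mul_rpow hx hxT hκγ.le
    have h3 := HX.bound_field.norm_le (pathOf φhat a ytil s)
    calc _ ≤ K * (T' ^ (γ - κ) * (t - s) ^ κ) * C := by gcongr
      _ = K * C * T' ^ (γ - κ) * (t - s) ^ κ := by ring
      _ ≤ _ := by gcongr; linarith
  · refine norm_add₃_le.trans ?_
    have h1 := (HX.norm_observation_le _).trans b1
    have h2 := (HX.norm_observation_le _).trans b2
    have h3 := mul_nonneg q1 hx2κ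
    linarith
  · refine (norm_add_le _ _).trans ?_
    have h3 := mul_nonneg q1 hx2κ
    have h4 := mul_nonneg q3 hx2κ
    linarith

/-- The flow-line bound already has the exponent required of the sewing term. What remains is
regularity: y is κ-Hölder, and a Taylor expansion shows that σ(y) is controlled. -/
theorem isVolterraSolution_of_flow_line
    (hφ : AEMeasurable φhat (volume.restrict (Ioi (0 : ℝ)))) (hT : 0 < T)
    (hγ : γ < 1 / 2) (hκ : 0 < κ) (hκγ : κ < γ)
    (hσ : ∀ j k, IsCThreeBounded fun v => σ v j k)
    {ytil : ℝ → Fin d → LaplaceSpace φhat} {B : ℝ} (hy0 : ytil 0 = 0)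
    (hcont : ContinuousOn ytil (Icc 0 T)) (hB0 : 0 ≤ B)
    (hB : ∀ s t : ℝ, 0 ≤ s → s < t → t ≤ T →
      ‖ytil t - X.step hφ σ a t s (ytil s)‖ ≤ B * (t - s) ^ (γ + 2 * κ)) :
    IsVolterraSolution X κ σ a ytil fun t j k => σ (pathOf φhat a ytil t) j k := by
  obtain ⟨K, C, HX⟩ := X.isRoughField hφ hT (hκ.trans hκγ) hσ
  obtain ⟨N, hN⟩ := isCompact_Icc.exists_bound_of_continuousOn hcont
  obtain ⟨A, hA, hinc⟩ := exists_path_increment hφ HX hγ hκ hκγ hN hB0 hB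
  have hC := HX.bound_field.const_nonneg
  set y := pathOf φhat a ytil with hy
  have hyc : ContinuousOn y (Icc 0 T) :=
    continuousOn_const.add ((continuous_laplaceIntegralPi hφ).comp_continuousOn hcont)
  have hyinc : ∀ s t : ℝ, 0 ≤ s → s < t → t ≤ T →
      ‖y t - y s‖ ≤ (A + A * T ^ κ) * (t - s) ^ κ := by
    intro s t hs hst htT
    obtain ⟨r, h1, h2, h3, -⟩ := hinc s t hs hst htT
    rw [h1, add_sub_cancel_left]
    refine (norm_add_le _ _).trans ?_
    have h4 := rpow_le_mul_rpow (by linarith : 0 < t - s) (by linarith : t - s ≤ T)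
      (by linarith : κ ≤ 2 * κ)
    rw [two_mul, add_sub_cancel_right, ← two_mul] at h4
    have h5 := mul_le_mul_of_nonneg_left h4 hA
    linarith
  have hfst : MapsTo (fun p : ℝ × ℝ => p.1) (simplexTwo T) (Icc 0 T) :=
    fun p hp => ⟨hp.1.trans hp.2.1, hp.2.2⟩
  have hsnd : MapsTo (fun p : ℝ × ℝ => p.2) (simplexTwo T) (Icc 0 T) :=
    fun p hp => ⟨hp.1, hp.2.1.trans hp.2.2⟩
  have hFc : Continuous (fieldSecond σ) := HX.bound_second.continuous
  have cσ : ∀ j k, Continuous fun v => σ v j k := fun j k => (hσ j k).1.continuous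
  have cF : ∀ i j l, Continuous fun v => fieldSecond σ v i j l := fun i j l =>
    continuous_pi_iff.1 (continuous_pi_iff.1 (continuous_pi_iff.1 hFc i) j) l
  have y1 : ContinuousOn (fun p : ℝ × ℝ => y p.1) (simplexTwo T) :=
    hyc.comp continuous_fst.continuousOn hfst
  have y2 : ContinuousOn (fun p : ℝ × ℝ => y p.2) (simplexTwo T) :=
    hyc.comp continuous_snd.continuousOn hsnd
  have cx1 : ∀ j, ContinuousOn (fun p : ℝ × ℝ => X.x1 p.1 p.2 j) (simplexTwo T) :=
    fun j => continuousOn_pi.1 X.holder_x1.1 j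
  have cx2 : ∀ j l, ContinuousOn (fun p : ℝ × ℝ => X.x2 p.1 p.2 j l) (simplexTwo T) :=
    fun j l => continuousOn_pi.1 (continuousOn_pi.1 X.holder_x2.1 j) l
  have cδ : ∀ i, ContinuousOn
      (fun p : ℝ × ℝ => twistedDeltaOne φhat (fun v => ytil v i) p.1 p.2) (simplexTwo T) := by
    intro i
    simp only [twistedDeltaOne_eq]
    have h1 : ContinuousOn (fun p : ℝ × ℝ => ytil p.1 i) (simplexTwo T) :=
      (continuousOn_pi.1 hcont i).comp continuous_fst.continuousOn hfst
    have h2 : ContinuousOn (fun p : ℝ × ℝ => ytil p.2 i) (simplexTwo T) :=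
      (continuousOn_pi.1 hcont i).comp continuous_snd.continuousOn hsnd
    refine h1.sub (continuous_decay.comp_continuousOn (ContinuousOn.prodMk ?_ h2))
    exact (continuous_real_toNNReal.comp (continuous_fst.sub continuous_snd)).continuousOn
  have hstep := fun (s t : ℝ) (i : Fin d) => X.step_apply hφ σ a ytil
    (ζ := fun t j k => σ (pathOf φhat a ytil t) j k) (s := s) (fun _ _ => rfl) t i
  have hζ : HolderOne T κ fun t j k => σ (y t) j k := by
    refine ⟨continuousOn_pi.2 fun j => continuousOn_pi.2 fun k => (cσ j k).comp_continuousOn hyc,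
      C * (A + A * T ^ κ), fun s t hs hst htT => ?_⟩
    have hx : 0 ≤ t - s := by linarith
    have hTκ : 0 ≤ T ^ κ := by positivity
    refine (pi_norm_le_iff_of_nonneg (by positivity)).2 fun j =>
      (pi_norm_le_iff_of_nonneg (by positivity)).2 fun k => ?_
    have h1 := (HX.bound_field.lipschitz (y t) (y s)).trans
      (mul_le_mul_of_nonneg_left (hyinc s t hs hst htT) hC)
    rw [← mul_assoc] at h1
    exact (abs_apply_apply_le _ k j).trans h1
  refine ⟨⟨hcont, hζ, ?_, A, fun s t hs hst htT => ?_⟩, hy0, fun t _ j k => rfl, fun i => ⟨⟨?_, ?_,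
    ?_⟩, ?_⟩⟩
  · refine continuousOn_pi.2 fun k => (cδ k).sub (continuousOn_finsetSum _ fun j _ => ?_)
    exact ((cσ j k).comp_continuousOn y2).smul (cx1 j)
  -- The twisted remainder is the flow-line default plus the second-level term, both of order 2κ.
  · obtain ⟨-, -, -, -, h4⟩ := hinc s t hs hst htT
    have : X.twistedRemainder ytil (fun t j k => σ (y t) j k) t s =
        (ytil t - X.step hφ σ a t s (ytil s)) + X.secondLevel d t s (fieldSecond σ (y s)) := by
      funext k
      change _ = ytil t k - (decay φhat (t - s).toNNReal (ytil s k)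
        + (∑ j, σ (y s) j k • X.x1 t s j + X.secondLevel d t s (fieldSecond σ (y s)) k))
          + X.secondLevel d t s (fieldSecond σ (y s)) k
      rw [ConvRoughPath.twistedRemainder, twistedDeltaOne_eq]
      abel
    rw [this]
    exact h4
  · exact continuousOn_pi.2 fun j => (cσ j i).comp_continuousOn hyc
  · refine ⟨continuousOn_pi.2 fun j => continuousOn_pi.2 fun l =>
      (cF i l j).comp_continuousOn hyc, C * (A + A * T ^ κ), fun s t hs hst htT => ?_⟩
    have hx : 0 ≤ t - s := by linarith
    have hTκ : 0 ≤ T ^ κ := by positivity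
    refine (pi_norm_le_iff_of_nonneg (by positivity)).2 fun j =>
      (pi_norm_le_iff_of_nonneg (by positivity)).2 fun l => ?_
    have h1 := (HX.bound_second.lipschitz (y t) (y s)).trans
      (mul_le_mul_of_nonneg_left (hyinc s t hs hst htT) hC)
    rw [← mul_assoc] at h1
    exact ((abs_apply_apply_le (fun l j => fieldSecond σ (y t) i l j - fieldSecond σ (y s) i l j)
      l j).trans (norm_le_pi_norm (fieldSecond σ (y t) - fieldSecond σ (y s)) i)).trans h1
  · refine ⟨continuousOn_pi.2 fun l => ?_, C * A + C * (A * A), fun s t hs hst htT => ?_⟩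
    · refine (((cσ l i).comp_continuousOn y1).sub ((cσ l i).comp_continuousOn y2)).sub
        (continuousOn_finsetSum _ fun j _ => ContinuousOn.mul ?_ ((cF i l j).comp_continuousOn y2))
      exact (continuous_laplaceIntegral hφ).comp_continuousOn (cx1 j)
    · obtain ⟨r, h1, h2, h3, -⟩ := hinc s t hs hst htT
      have hx : 0 < t - s := by linarith
      -- The increment of y is p + r with p of order κ and r of order 2κ, so the remainder of σ(y)
      -- is bounded by multiples of ‖r‖ and ‖p‖², both of order 2κ.
      have h4 := HX.bound_field.taylor_le HX.hasFDerivAt HX.bound_deriv (y s)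
        (laplaceIntegralPi hφ d (X.firstLevel d t s fun i j => σ (y s) j i)) r
      rw [← h1] at h4
      have h5 : C * ‖r‖ + C * (‖laplaceIntegralPi hφ d
          (X.firstLevel d t s fun i j => σ (y s) j i)‖ * ‖laplaceIntegralPi hφ d
          (X.firstLevel d t s fun i j => σ (y s) j i)‖) ≤
          (C * A + C * (A * A)) * (t - s) ^ (2 * κ) := by
        calc _ ≤ C * (A * (t - s) ^ (2 * κ)) + C * (A * (t - s) ^ κ * (A * (t - s) ^ κ)) := by
              gcongr
          _ = _ := by
              rw [two_mul, Real.rpow_add hx]; ring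
      refine (pi_norm_le_iff_of_nonneg (by positivity)).2 fun l => ?_
      have h6 := (abs_apply_apply_le _ i l).trans (h4.trans h5)
      refine le_trans (le_of_eq ?_) h6
      rw [X.laplaceIntegralPi_firstLevel hφ (σ (y s)) t s, Real.norm_eq_abs]
      congr 1
      change _ = σ (y t) l i - σ (y s) l i
        - fderiv ℝ (fun v => σ v l i) (y s) (∑ j, X.x1int t s j • σ (y s) j)
      rw [map_sum]
      simp only [map_smul, smul_eq_mul]
      rfl
  -- The sewing term is defined as the difference of δ̃ỹ and the germ. Its twisted coboundary is the
  -- defect because δ̃δ̃ = 0.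
  · refine ⟨fun t s => twistedDeltaOne φhat (fun v => ytil v i) t s
      - X.germ (fun t j => σ (y t) j i)
        (fun t j l => fderiv ℝ (fun v => σ v l i) (y t) fun k => σ (y t) j k) t s,
      ⟨⟨?_, B, fun s t hs hst htT => ?_⟩, fun s u t hs hsu hut htT => ?_⟩,
      fun s t _ _ _ => (add_sub_cancel _ _).symm⟩
    · refine (cδ i).sub (ContinuousOn.add ?_ ?_)
      · exact continuousOn_finsetSum _ fun j _ => ((cσ j i).comp_continuousOn y2).smul (cx1 j)
      · exact continuousOn_finsetSum _ fun j _ => continuousOn_finsetSum _ fun l _ =>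
          ((cF i j l).comp_continuousOn y2).smul (cx2 j l)
    · have h1 := hB s t hs hst htT
      refine le_trans (le_of_eq ?_) ((norm_le_pi_norm _ i).trans h1)
      beta_reduce
      rw [Pi.sub_apply, hstep, twistedDeltaOne_eq, sub_sub]
    · rw [twistedDeltaTwo_sub, twistedDeltaTwo_twistedDeltaOne _ hsu hut, zero_sub, neg_eq_iff_eq_neg]
      exact X.twistedDeltaTwo_germ _ _ hs hsu hut htT

end Equation

end RoughVolterra

/-! ### Existence and uniqueness -/

theorem theorem4 (φhat : ℝ → ℝ)
    (hφ : AEMeasurable φhat (MeasureTheory.volume.restrict (Set.Ioi (0 : ℝ))))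
    (T : ℝ) (hT : 0 < T) (γ κ : ℝ) (hγ : 1 / 3 < γ ∧ γ < 1 / 2)
    (hκ : 1 / 3 < κ) (hκγ : κ < γ) (n d : ℕ) (X : RoughVolterra.ConvRoughPath φhat T γ n)
    (σ : (Fin d → ℝ) → Matrix (Fin n) (Fin d) ℝ)
    (hσ : ∀ j k, RoughVolterra.IsCThreeBounded fun v => σ v j k)
    (a : Fin d → ℝ) :
    ∃ (ytil : ℝ → Fin d → RoughVolterra.LaplaceSpace φhat) (ζ : ℝ → Fin n → Fin d → ℝ),
      RoughVolterra.IsVolterraSolution X κ σ a ytil ζ ∧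
      ∀ (ytil' : ℝ → Fin d → RoughVolterra.LaplaceSpace φhat) (ζ' : ℝ → Fin n → Fin d → ℝ),
        RoughVolterra.IsVolterraSolution X κ σ a ytil' ζ' →
          Set.EqOn ytil' ytil (Set.Icc 0 T) ∧ Set.EqOn ζ' ζ (Set.Icc 0 T) := by
  obtain ⟨K, C, HX⟩ := X.isRoughField hφ hT (by linarith) hσ
  -- The three conditions on α = γ+2κ are α > 1, from γ, κ > 1/3; α ≤ 1+γ, from κ < 1/2; and α ≤ 3γ,
  -- from κ < γ.
  obtain ⟨C', HF⟩ := HX.almostFlow hT.le (by linarith) (α := γ + 2 * κ) (by linarith) (by linarith)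
    (by linarith) a
  obtain ⟨ytil, hy0, hcont, B, hB0, hB⟩ := HF.exists_flow_line hT.le
  refine ⟨ytil, _, RoughVolterra.isVolterraSolution_of_flow_line hφ hT hγ.2 (by linarith) hκγ hσ hy0
    hcont hB0 hB, fun ytil' ζ' H' => ?_⟩
  obtain ⟨B', hB'⟩ := H'.flow_line hφ
  obtain ⟨N, hN⟩ := isCompact_Icc.exists_bound_of_continuousOn hcont
  have hmono : ∀ {D x : ℝ}, D ≤ max B B' → 0 < x →
      D * x ^ (γ + 2 * κ) ≤ max B B' * x ^ (γ + 2 * κ) := fun hD hx => by gcongr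
  -- Both paths are flow lines with the common constant max B B'. Only the constructed path has to
  -- be bounded, which follows from its continuity on a compact interval.
  have heq : Set.EqOn ytil' ytil (Set.Icc 0 T) :=
    HF.eqOn_of_flow_line (K := max B B') hN (H'.initial.trans hy0.symm)
      (fun s t hs hst htT => (hB' s t hs hst htT).trans (hmono (le_max_right _ _) (sub_pos.2 hst)))
      (fun s t hs hst htT => (hB s t hs hst htT).trans (hmono (le_max_left _ _) (sub_pos.2 hst)))
  refine ⟨heq, fun t ht => ?_⟩
  funext j k
  rw [H'.deriv_eq t ht j k]
  have : RoughVolterra.pathOf φhat a ytil' t = RoughVolterra.pathOf φhat a ytil t := by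
    funext k
    simp only [RoughVolterra.pathOf, heq ht]
  rw [this]
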